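/- Let $G$ be a finite group, $q=|G|$, and let $n\ge 0$. **Dowling geometry.** A partial $G$-partition of $[n]$ is a subset $S\subseteq[n]$ with a partition $S=A_1\sqcup\dots\sqcup A_k$ into nonempty blocks and a function $f\colon S\to G$. Two of them are equivalent if they have the same $S$ and the same blocks and if on each block the two functions differ by left multiplication by an element of $G$. Equivalence classes are ordered by letting $x\le y$ if $y$ is obtained from $x$, up to equivalence, by merging and deleting blocks. The resulting poset is the lattice of flats of a simple matroid on its set of atoms, the Dowling geometry $\mathsf Q_n(G)$. The group $(G\wr\mathfrak S_n)\rtimes\operatorname{Aut}(G)$, with underlying set $G^n\times\mathfrak S_n\times\operatorname{Aut}(G)$ and multiplication $((g_i),\sigma,\phi)\cdot((h_i),\tau,\psi)=((\phi(h_i)g_{\tau(i)}),\sigma\tau,\phi\psi)$, acts on partial $G$-partitions by sending $(S,f,A_1,\dots,A_k)$ to $(\sigma(S),f',\sigma(A_1),\dots,\sigma(A_k))$ with $$f'(i)=\phi\bigl(f(\sigma^{-1}(i))\bigr)\,g_{\sigma^{-1}(i)},$$ and hence acts on $\mathsf Q_n(G)$. Let $\Gamma\le\operatorname{Aut}(\mathsf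 Q_n(G))$ be the image of this action, i.e. the subgroup generated by the actions of $\mathfrak S_n$, $G^n$ and $\operatorname{Aut}(G)$. **Labeled matroids.** A matroid is series-parallel if it is obtained from a single loop or a single coloop by a finite sequence of series and parallel extensions ($M$ is a parallel extension of $M\setminus e$ if $e$ lies in a two-element circuit of $M$, and a series extension of $M/e$ if $e$ lies in a two-element cocircuit of $M$); it is quasi series-parallel if all its connected components are series-parallel. A $G$-labeling of a matroid on $E$ is a function $E\to G$; two labelings $\phi,\psi$ are equivalent if for each connected component $C$ there is $g_C\in G$ with $\phi|_C=g_C\cdot\psi|_C$. Let $\mathcal A_G(n,r)$ be the set of equivalence classes of $G$-labeled quasi series-parallel matroids on $[n]$ of rank $r$ (empty if $r<0$), and let $\mathcal S_G(n,r)$ be the subset of those whose matroid is simple. The group $(G\wr\mathfrak S_n)\rtimes\operatorname{Aut}(G)$ acts on labelings by the formula above and on matroids through $\mathfrak S_n$, and the action on equivalence classes factors through $\Gamma$. **Equivariant polynomials.** Fix a field $k$ of characteristic $0$ and let $\operatorname{VRep}(H)$ be the Grothendieck group of finite-dimensional representations of a finite group $H$ over $k$. There is a unique assignment to each action of a finite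 group $H$ on a finite loopless matroid $\mathsf M$ (sending flats to flats) of a polynomial $P^H_{\mathsf M}(t)$ with coefficients in $\operatorname{VRep}(H)$ such that $P^H_{\mathsf M}(t)$ is the trivial representation if $\operatorname{rk}\mathsf M=0$; $\deg P^H_{\mathsf M}(t)<\tfrac12\operatorname{rk}\mathsf M$ if $\operatorname{rk}\mathsf M>0$; and always $$Z^H_{\mathsf M}(t)=\sum_{[F]}t^{\operatorname{rk}F}\operatorname{Ind}_{H_F}^H P^{H_F}_{\mathsf M/F}(t),$$ the sum being over $H$-orbits of flats with $H_F$ the stabilizer of $F$, is palindromic of degree $\operatorname{rk}\mathsf M$. The polynomials $P^H_{\mathsf M}$ and $Z^H_{\mathsf M}$ are the equivariant Kazhdan–Lusztig polynomial and the equivariant $Z$-polynomial. The ordinary polynomials $P_{\mathsf M}(t),Z_{\mathsf M}(t)\in\mathbb Z[t]$ are defined by the same conditions without the group: $Z_{\mathsf M}(t)=\sum_F t^{\operatorname{rk}F}P_{\mathsf M/F}(t)$ over all flats $F$. **Theorem.** 1. (Bonin) If $G$ is nontrivial and $n\ge 3$, then $\Gamma=\operatorname{Aut}(\mathsf Q_n(G))$.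 2. For every $i\ge 0$, the coefficient of $t^i$ in $P^\Gamma_{\mathsf Q_n(G)}(t)$ is the class of the permutation representation of $\Gamma$ on $\mathcal S_G(n,n-i)$. 3. For every $i\ge 0$, the coefficient of $t^i$ in $Z^\Gamma_{\mathsf Q_n(G)}(t)$ is the class of the permutation representation of $\Gamma$ on $\mathcal A_G(n,n-i)$. 4. In particular, for every $i\ge 0$, the coefficient of $t^i$ in $P_{\mathsf Q_n(G)}(t)$, respectively in $Z_{\mathsf Q_n(G)}(t)$, is $\sum_{M}q^{\,n-c(M)}$, the sum being over the simple quasi series-parallel matroids, respectively all quasi series-parallel matroids, $M$ on $[n]$ of rank $n-i$, where $c(M)$ is the number of connected components of $M$. -/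

import Mathlib

open scoped Pointwise Matroid

universe u v

namespace DowlingKL

noncomputable section

/-! ### Virtual representations -/

section VRep

variable (k : Type*) [Field k] (H : Type*) [Group H]

/-- The relations `[W] = [U] + [V]`, one for each isomorphism `W ≅ U ⊕ V` of representations. -/
def VRep.relations : Set (FreeAbelianGroup (Σ d : ℕ, Representation k H (Fin d → k))) :=
  {x | ∃ U V W : Σ d : ℕ, Representation k H (Fin d → k),
    Nonempty (W.2.Equiv (U.2.prod V.2)) ∧
      x = FreeAbelianGroup.of W - FreeAbelianGroup.of U - FreeAbelianGroup.of V}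

/-- The (additive) group of virtual representations of `H` over `k`: the Grothendieck group of
finite-dimensional representations of `H` under direct sum. Every finite-dimensional representation
is isomorphic to one on some `k ^ d`, so these are used as generators. -/
def VRep : Type _ :=
  FreeAbelianGroup (Σ d : ℕ, Representation k H (Fin d → k)) ⧸
    AddSubgroup.closure (VRep.relations k H)

instance : AddCommGroup (VRep k H) :=
  inferInstanceAs (AddCommGroup (FreeAbelianGroup (Σ d : ℕ, Representation k H (Fin d → k)) ⧸
    AddSubgroup.closure (VRep.relations k H)))

variable {k H}

/-- A finite-dimensional representation written in coordinates with respect to a basis. -/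
def coordRep {V : Type*} [AddCommGroup V] [Module k V] [Module.Finite k V]
    (ρ : Representation k H V) :
    Representation k H (Fin (Module.finrank k V) → k) where
  toFun h := (Module.finBasis k V).equivFun.toLinearMap ∘ₗ ρ h ∘ₗ
    (Module.finBasis k V).equivFun.symm.toLinearMap
  map_one' := by
    apply LinearMap.ext
    intro v
    rw [map_one]
    exact (Module.finBasis k V).equivFun.apply_symm_apply v
  map_mul' a b := by
    apply LinearMap.ext
    intro v
    simp

/-- The class of a finite-dimensional representation in the group of virtual representations. -/
def VRep.of {V : Type*} [AddCommGroup V] [Module k V] [Module.Finite k V]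
    (ρ : Representation k H V) : VRep k H :=
  QuotientAddGroup.mk (FreeAbelianGroup.of ⟨Module.finrank k V, coordRep ρ⟩)

/-- The isomorphism between a representation and its coordinate form. -/
def coordRepEquiv {V : Type*} [AddCommGroup V] [Module k V] [Module.Finite k V]
    (ρ : Representation k H V) : (coordRep ρ).Equiv ρ :=
  .mk (Module.finBasis k V).equivFun.symm fun g => by
    apply LinearMap.ext
    intro v
    simp [coordRep]

/-- The product of two isomorphisms of representations. -/
def prodEquiv {V V' W W' : Type*} [AddCommGroup V] [Module k V] [AddCommGroup W] [Module k W]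
    [AddCommGroup V'] [Module k V'] [AddCommGroup W'] [Module k W']
    {ρ : Representation k H V} {ρ' : Representation k H V'}
    {σ : Representation k H W} {σ' : Representation k H W'}
    (e : ρ.Equiv ρ') (f : σ.Equiv σ') : (ρ.prod σ).Equiv (ρ'.prod σ') :=
  .mk (e.toLinearEquiv.prodCongr f.toLinearEquiv) fun g => by
    apply LinearMap.ext
    rintro ⟨v, w⟩
    have h1 := LinearMap.congr_fun (e.toIntertwiningMap.isIntertwining' g) v
    have h2 := LinearMap.congr_fun (f.toIntertwiningMap.isIntertwining' g) w
    exact Prod.ext h1 h2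

theorem VRep.mk_eq_add (U V W : Σ d : ℕ, Representation k H (Fin d → k))
    (h : Nonempty (W.2.Equiv (U.2.prod V.2))) :
    (QuotientAddGroup.mk (FreeAbelianGroup.of W) : VRep k H) =
      (QuotientAddGroup.mk (FreeAbelianGroup.of U) : VRep k H) +
      (QuotientAddGroup.mk (FreeAbelianGroup.of V) : VRep k H) := by
  have h0 : (QuotientAddGroup.mk (FreeAbelianGroup.of W - FreeAbelianGroup.of U -
      FreeAbelianGroup.of V) : VRep k H) = 0 :=
    (QuotientAddGroup.eq_zero_iff _).2 (AddSubgroup.subset_closure ⟨U, V, W, h, rfl⟩)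
  have h1 : (QuotientAddGroup.mk (FreeAbelianGroup.of W) : VRep k H) -
      (QuotientAddGroup.mk (FreeAbelianGroup.of U) : VRep k H) -
      (QuotientAddGroup.mk (FreeAbelianGroup.of V) : VRep k H) = 0 := h0
  rw [sub_sub, sub_eq_zero] at h1
  exact h1

theorem VRep.of_eq_add {U V W : Type*} [AddCommGroup U] [Module k U] [Module.Finite k U]
    [AddCommGroup V] [Module k V] [Module.Finite k V]
    [AddCommGroup W] [Module k W] [Module.Finite k W]
    {ρ : Representation k H U} {σ : Representation k H V} {τ : Representation k H W}
    (e : τ.Equiv (ρ.prod σ)) : VRep.of τ = VRep.of ρ + VRep.of σ :=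
  VRep.mk_eq_add ⟨_, coordRep ρ⟩ ⟨_, coordRep σ⟩ ⟨_, coordRep τ⟩
    ⟨((coordRepEquiv τ).trans e).trans (prodEquiv (coordRepEquiv ρ).symm (coordRepEquiv σ).symm)⟩

instance IndV.finite [Finite H] {K : Type*} [Group K] (φ : K →* H) {V : Type*} [AddCommGroup V]
    [Module k V] [Module.Finite k V] (ρ : Representation k K V) :
    Module.Finite k (Representation.IndV φ ρ) :=
  Module.Finite.of_surjective (Representation.Coinvariants.mk _)
    (Representation.Coinvariants.mk_surjective _)

/-- The map of induced representations coming from a map of representations. -/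
def indMap {K : Type*} [Group K] (φ : K →* H) {V W : Type*} [AddCommGroup V] [Module k V]
    [AddCommGroup W] [Module k W] {ρ : Representation k K V} {σ : Representation k K W}
    (f : ρ.IntertwiningMap σ) :
    Representation.IndV φ ρ →ₗ[k] Representation.IndV φ σ :=
  Representation.Coinvariants.map _ _ ⟨f.toLinearMap.lTensor _, fun g => by
    apply TensorProduct.ext'
    intro x y
    have h : f (ρ g y) = σ g (f y) := LinearMap.congr_fun (f.isIntertwining' g) y
    simp [Representation.tprod_apply, h]⟩

theorem indMap_mk {K : Type*} [Group K] (φ : K →* H) {V W : Type*} [AddCommGroup V] [Module k V]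
    [AddCommGroup W] [Module k W] {ρ : Representation k K V} {σ : Representation k K W}
    (f : ρ.IntertwiningMap σ) (h : H) (v : V) :
    indMap φ f (Representation.IndV.mk φ ρ h v) = Representation.IndV.mk φ σ h (f v) := rfl

/-- Induction of representations commutes with direct sums. -/
def indProdEquiv {K : Type*} [Group K] (φ : K →* H) {U V W : Type*}
    [AddCommGroup U] [Module k U] [AddCommGroup V] [Module k V] [AddCommGroup W] [Module k W]
    {ρ : Representation k K U} {σ : Representation k K V} {τ : Representation k K W}
    (e : τ.Equiv (ρ.prod σ)) : (τ.ind φ).Equiv ((ρ.ind φ).prod (σ.ind φ)) :=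
  .mk (LinearEquiv.ofLinearMap
    ((indMap φ ((Representation.IntertwiningMap.fst k ρ σ).comp e.toIntertwiningMap)).prod
      (indMap φ ((Representation.IntertwiningMap.snd k ρ σ).comp e.toIntertwiningMap)))
    ((indMap φ (e.symm.toIntertwiningMap.comp (Representation.IntertwiningMap.inl k ρ σ))).coprod
      (indMap φ (e.symm.toIntertwiningMap.comp (Representation.IntertwiningMap.inr k ρ σ))))
    (by
      apply LinearMap.prod_ext
      · apply Representation.IndV.hom_ext
        intro h
        apply LinearMap.ext
        intro u
        have h1 : (e (e.symm ((u, 0) : U × V))) = (u, 0) := e.apply_symm_apply _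
        refine Prod.ext ?_ ?_
        · change Representation.IndV.mk φ ρ h (e (e.symm ((u, 0) : U × V))).1 = _
          rw [h1]
          rfl
        · change Representation.IndV.mk φ σ h (e (e.symm ((u, 0) : U × V))).2 = 0
          rw [h1]
          exact map_zero _
      · apply Representation.IndV.hom_ext
        intro h
        apply LinearMap.ext
        intro u
        have h1 : (e (e.symm ((0, u) : U × V))) = (0, u) := e.apply_symm_apply _
        refine Prod.ext ?_ ?_
        · change Representation.IndV.mk φ ρ h (e (e.symm ((0, u) : U × V))).1 = 0
          rw [h1]
          exact map_zero _
        · change Representation.IndV.mk φ σ h (e (e.symm ((0, u) : U × V))).2 = _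
          rw [h1]
          rfl)
    (by
      apply Representation.IndV.hom_ext
      intro h
      apply LinearMap.ext
      intro w
      change Representation.IndV.mk φ τ h (e.symm (((e w).1, 0) : U × V)) +
        Representation.IndV.mk φ τ h (e.symm ((0, (e w).2) : U × V)) =
        Representation.IndV.mk φ τ h w
      rw [← map_add, ← map_add, Prod.mk_add_mk, add_zero, zero_add, Prod.mk.eta]
      exact congrArg _ (e.symm_apply_apply w))) fun g => by
    apply Representation.IndV.hom_ext
    intro h
    apply LinearMap.ext
    intro w
    exact (congrArg
      ((indMap φ ((Representation.IntertwiningMap.fst k ρ σ).comp e.toIntertwiningMap)).prod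
      (indMap φ ((Representation.IntertwiningMap.snd k ρ σ).comp e.toIntertwiningMap)))
      (Representation.ind_mk φ τ g h w)).trans
      (Prod.ext (Representation.ind_mk φ ρ g h (e w).1)
      (Representation.ind_mk φ σ g h (e w).2)).symm

theorem VRep.of_congr {V W : Type*} [AddCommGroup V] [Module k V] [Module.Finite k V]
    [AddCommGroup W] [Module k W] [Module.Finite k W]
    {ρ : Representation k H V} {σ : Representation k H W} (e : ρ.Equiv σ) :
    VRep.of ρ = VRep.of σ := by
  have h0 : VRep.of (Representation.trivial k H (Fin 0 → k)) = 0 := by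
    have h := VRep.of_eq_add (ρ := Representation.trivial k H (Fin 0 → k))
      (σ := Representation.trivial k H (Fin 0 → k)) (τ := Representation.trivial k H (Fin 0 → k))
      (.mk (0 : (Fin 0 → k) ≃ₗ[k] (Fin 0 → k) × (Fin 0 → k)) fun g => by
        apply LinearMap.ext
        intro v
        exact Subsingleton.elim _ _)
    exact left_eq_add.1 h
  have h := VRep.of_eq_add (ρ := σ) (σ := Representation.trivial k H (Fin 0 → k)) (τ := ρ)
    (.mk (e.toLinearEquiv.trans (LinearEquiv.prodUnique (R := k)).symm) fun g => by
      apply LinearMap.ext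
      intro v
      refine Prod.ext ?_ (Subsingleton.elim _ _)
      exact LinearMap.congr_fun (e.toIntertwiningMap.isIntertwining' g) v)
  rw [h, h0, add_zero]

/-- Isomorphic representations induce to isomorphic representations. -/
def indEquiv {K : Type*} [Group K] (φ : K →* H) {V W : Type*} [AddCommGroup V]
    [Module k V] [AddCommGroup W] [Module k W] {ρ : Representation k K V}
    {σ : Representation k K W} (e : ρ.Equiv σ) : (ρ.ind φ).Equiv (σ.ind φ) :=
  .mk (LinearEquiv.ofLinearMap (indMap φ e.toIntertwiningMap) (indMap φ e.symm.toIntertwiningMap)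
    (by
      apply Representation.IndV.hom_ext
      intro h
      apply LinearMap.ext
      intro w
      exact congrArg (Representation.IndV.mk φ σ h) (e.apply_symm_apply w))
    (by
      apply Representation.IndV.hom_ext
      intro h
      apply LinearMap.ext
      intro w
      exact congrArg (Representation.IndV.mk φ ρ h) (e.symm_apply_apply w))) fun g => by
    apply Representation.IndV.hom_ext
    intro h
    apply LinearMap.ext
    intro w
    exact (congrArg (indMap φ e.toIntertwiningMap) (Representation.ind_mk φ ρ g h w)).trans
      (Representation.ind_mk φ σ g h (e w)).symm

/-- Induction of virtual representations along a homomorphism to a finite group; on the class of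
a representation it is the class of the induced representation. -/
def VRep.ind [Finite H] {K : Type*} [Group K] (φ : K →* H) : VRep k K →+ VRep k H :=
  QuotientAddGroup.lift _
    (FreeAbelianGroup.lift fun ρ : Σ d : ℕ, Representation k K (Fin d → k) =>
      VRep.of (ρ.2.ind φ)) (by
    rw [AddSubgroup.closure_le]
    rintro x ⟨U, V, W, ⟨e⟩, rfl⟩
    have h := VRep.of_eq_add (indProdEquiv φ e)
    simp [AddMonoidHom.mem_ker, h])

theorem VRep.ind_mk [Finite H] {K : Type*} [Group K] (φ : K →* H)
    (ρ : Σ d : ℕ, Representation k K (Fin d → k)) :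
    VRep.ind φ (QuotientAddGroup.mk (FreeAbelianGroup.of ρ) : VRep k K) =
      VRep.of (ρ.2.ind φ) := by
  exact FreeAbelianGroup.lift_apply_of _ _

theorem VRep.ind_of [Finite H] {K : Type*} [Group K] (φ : K →* H) {V : Type*} [AddCommGroup V]
    [Module k V] [Module.Finite k V] (ρ : Representation k K V) :
    VRep.ind φ (VRep.of ρ) = VRep.of (ρ.ind φ) :=
  (VRep.ind_mk φ _).trans (VRep.of_congr (indEquiv φ (coordRepEquiv ρ)))

/-- The dimension of a virtual representation. -/
def VRep.dim : VRep k H →+ ℤ :=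
  QuotientAddGroup.lift _
    (FreeAbelianGroup.lift fun ρ : Σ d : ℕ, Representation k H (Fin d → k) => (ρ.1 : ℤ)) (by
    rw [AddSubgroup.closure_le]
    rintro x ⟨U, V, W, ⟨e⟩, rfl⟩
    have h := e.toLinearEquiv.finrank_eq
    simp only [Module.finrank_fin_fun, Module.finrank_prod] at h
    simp [AddMonoidHom.mem_ker, h])

theorem VRep.dim_of {V : Type*} [AddCommGroup V] [Module k V] [Module.Finite k V]
    (ρ : Representation k H V) : VRep.dim (VRep.of ρ) = Module.finrank k V :=
  FreeAbelianGroup.lift_apply_of _ _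

variable (k H) in
/-- The class of the one-dimensional trivial representation. -/
def VRep.triv : VRep k H := VRep.of (Representation.trivial k H k)

theorem VRep.triv_ne_zero : VRep.triv k H ≠ 0 := by
  intro h
  have h1 := congrArg VRep.dim h
  simp [VRep.triv, VRep.dim_of] at h1

theorem VRep.ind_triv_ne_zero [Finite H] {K : Type*} [Group K] (φ : K →* H) :
    VRep.ind φ (VRep.triv k K) ≠ 0 := by
  intro h
  have h1 := congrArg VRep.dim h
  rw [VRep.triv, VRep.ind_of, VRep.dim_of, map_zero, Nat.cast_eq_zero] at h1
  have h2 := Module.finrank_zero_iff.1 h1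
  let f : Representation.IndV φ (Representation.trivial k K k) →ₗ[k] k :=
    Representation.Coinvariants.lift _
      (TensorProduct.lift ((MonoidAlgebra.lift k k H 1).toLinearMap.smulRight LinearMap.id)) (by
      intro g
      apply TensorProduct.ext
      ext
      simp [Representation.tprod_apply])
  have h3 : f (Representation.IndV.mk φ (Representation.trivial k K k) 1 1) = 1 := by
    simp [f, Representation.IndV.mk]
  rw [Subsingleton.elim (Representation.IndV.mk φ (Representation.trivial k K k) 1 1) 0,
    map_zero] at h3
  exact zero_ne_one h3

end VRep

/-! ### The Kazhdan–Lusztig recursion -/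

/-- A polynomial `f` (given by its finitely supported family of coefficients in an abelian group)
is palindromic of degree `d` if `deg f = d` and `f(t) = t ^ d * f(1 / t)`. -/
def IsPalindromic {A : Type*} [Zero A] (f : ℕ → A) (d : ℕ) : Prop :=
  f d ≠ 0 ∧ (∀ i, d < i → f i = 0) ∧ ∀ i ≤ d, f i = f (d - i)

/-- Existence and uniqueness of the solution of a Kazhdan–Lusztig type recursion, with coefficients
written as functions on `ℕ`. -/
theorem existsUnique_kl {I : Type*} (rk : I → ℕ) (A : I → Type*) [∀ x, AddCommGroup (A x)]
    (J : I → Type*) [∀ x, Finite (J x)] (child : ∀ x, J x → I) (d : ∀ x, J x → ℕ)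
    (hd : ∀ x j, 0 < d x j) (hrk : ∀ x j, d x j + rk (child x j) = rk x)
    (ind : ∀ x j, A (child x j) →+ A x) (one : ∀ x, A x)
    (hone : ∀ x, rk x = 0 → one x ≠ 0)
    (htop : ∀ x, 0 < rk x → ∃ j₀, rk (child x j₀) = 0 ∧ (∀ j, rk (child x j) = 0 → j = j₀) ∧
      ind x j₀ (one (child x j₀)) ≠ 0) :
    ∃! c : ∀ x, ℕ → A x,
      (∀ x, rk x = 0 → c x = fun i => if i = 0 then one x else 0) ∧
      (∀ x, 0 < rk x → ∀ i, c x i ≠ 0 → 2 * i < rk x) ∧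
      (∀ x, IsPalindromic (fun i => c x i + ∑ᶠ j, if d x j ≤ i then
        ind x j (c (child x j) (i - d x j)) else 0) (rk x)) := by
  classical
  have hlt : ∀ x j, rk (child x j) < rk x := fun x j => by
    have h1 := hd x j
    have h2 := hrk x j
    omega
  let wf : WellFounded (fun a b : I => rk a < rk b) := (measure rk).wf
  let S : ∀ x, (∀ y, rk y < rk x → ℕ → A y) → ℕ → A x := fun x rec m =>
    ∑ᶠ j, if d x j ≤ m then ind x j (rec (child x j) (hlt x j) (m - d x j)) else 0
  let F : ∀ x, (∀ y, rk y < rk x → ℕ → A y) → ℕ → A x := fun x rec i =>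
    if rk x = 0 then (if i = 0 then one x else 0) else
      if 2 * i < rk x then S x rec (rk x - i) - S x rec i else 0
  let c : ∀ x, ℕ → A x := wf.fix F
  have hc : ∀ x, c x = F x (fun y _ => c y) := fun x => wf.fix_eq F x
  have hJ : ∀ x, rk x = 0 → IsEmpty (J x) := fun x hx => ⟨fun j => by
    have := hlt x j
    omega⟩
  have h0 : ∀ x, rk x = 0 → c x = fun i => if i = 0 then one x else 0 := by
    intro x hx
    rw [hc]
    funext i
    simp [F, hx]
  have h1 : ∀ x, 0 < rk x → ∀ i, c x i ≠ 0 → 2 * i < rk x := by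
    intro x hx i hi
    by_contra h
    apply hi
    rw [hc]
    simp [F, hx.ne', h]
  -- top coefficients and vanishing, for any family satisfying the first two conditions
  have key : ∀ c' : ∀ x, ℕ → A x, (∀ x, rk x = 0 → c' x = fun i => if i = 0 then one x else 0) →
      (∀ x, 0 < rk x → ∀ i, c' x i ≠ 0 → 2 * i < rk x) → ∀ x, 0 < rk x →
      ∀ i, rk x ≤ i → (i = rk x → S x (fun y _ => c' y) i ≠ 0) ∧
        (rk x < i → S x (fun y _ => c' y) i = 0) := by
    intro c' h0 h1 x hx i hi
    obtain ⟨j₀, hj1, hj2, hj3⟩ := htop x hx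
    constructor
    · rintro rfl
      have : S x (fun y _ => c' y) (rk x) = ind x j₀ (one (child x j₀)) := by
        simp only [S]
        rw [finsum_eq_single _ j₀]
        · have h2 := hrk x j₀
          rw [if_pos (by omega), h0 _ hj1]
          simp [show rk x - d x j₀ = 0 by omega]
        · intro j hj
          have h2 := hrk x j
          have h3 : rk (child x j) ≠ 0 := fun h => hj (hj2 j h)
          rw [if_pos (by omega)]
          by_contra h4
          have h5 : c' (child x j) (rk x - d x j) ≠ 0 := fun h => h4 (by rw [h, map_zero])
          have := h1 _ (by omega) _ h5
          omega
      rw [this]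
      exact hj3
    · intro hi
      simp only [S]
      apply finsum_eq_zero_of_forall_eq_zero
      intro j
      have h2 := hrk x j
      rw [if_pos (by omega)]
      by_contra h4
      have h5 : c' (child x j) (i - d x j) ≠ 0 := fun h => h4 (by rw [h, map_zero])
      by_cases h6 : rk (child x j) = 0
      · rw [h0 _ h6] at h5
        have : i - d x j ≠ 0 := by omega
        simp [this] at h5
      · have := h1 _ (by omega) _ h5
        omega
  refine ⟨c, ⟨h0, h1, ?_⟩, ?_⟩
  · intro x
    rcases Nat.eq_zero_or_pos (rk x) with hx | hx
    · have := hJ x hx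
      rw [hx, h0 x hx]
      refine ⟨?_, ?_, ?_⟩
      · simpa [finsum_of_isEmpty] using hone x hx
      · intro i hi
        simp [hi.ne', finsum_of_isEmpty]
      · intro i hi
        obtain rfl : i = 0 := by omega
        rfl
    · have hS : ∀ i, c x i = if 2 * i < rk x then S x (fun y _ => c y) (rk x - i) -
          S x (fun y _ => c y) i else 0 := by
        intro i
        conv_lhs => rw [hc]
        simp [F, hx.ne']
      change IsPalindromic (fun i => c x i + S x (fun y _ => c y) i) (rk x)
      refine ⟨?_, ?_, ?_⟩
      · have := (key c h0 h1 x hx (rk x) le_rfl).1 rfl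
        simpa [hS (rk x), show ¬ 2 * rk x < rk x by omega] using this
      · intro i hi
        have := (key c h0 h1 x hx i hi.le).2 hi
        simpa [hS i, show ¬ 2 * i < rk x by omega] using this
      · intro i hi
        simp only [hS]
        rcases lt_trichotomy (2 * i) (rk x) with h | h | h
        · rw [if_pos h, if_neg (by omega)]
          simp
        · simp only [show rk x - i = i by omega]
        · rw [if_neg (by omega), if_pos (by omega), show rk x - (rk x - i) = i by omega]
          simp
  · rintro c' ⟨h0', h1', h2'⟩
    have main : ∀ N, ∀ x, rk x = N → c' x = c x := by
      intro N
      induction N using Nat.strong_induction_on with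
      | _ N ih =>
        intro x hxN
        rcases Nat.eq_zero_or_pos (rk x) with hx | hx
        · rw [h0 x hx, h0' x hx]
        · have hSS : ∀ m, S x (fun y _ => c' y) m = S x (fun y _ => c y) m := by
            intro m
            simp only [S]
            congr 1
            funext j
            rw [ih _ (hxN ▸ hlt x j) (child x j) rfl]
          funext i
          by_cases hi : 2 * i < rk x
          · have h3 : c' x i + S x (fun y _ => c' y) i =
                c' x (rk x - i) + S x (fun y _ => c' y) (rk x - i) :=
              (h2' x).2.2 i (by omega)
            have h4 : c' x (rk x - i) = 0 := by
              by_contra h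
              have := h1' x hx _ h
              omega
            rw [h4, zero_add, hSS, hSS] at h3
            conv_rhs => rw [hc]
            simp only [F, hx.ne', hi, if_true, if_false]
            exact eq_sub_of_add_eq h3
          · have h4 : c' x i = 0 := by
              by_contra h
              exact hi (h1' x hx _ h)
            have h5 : c x i = 0 := by
              by_contra h
              exact hi (h1 x hx _ h)
            rw [h4, h5]
    funext x
    exact main _ x rfl

section Matroid

variable {α : Type v}

/-- The rank of a matroid, as a natural number. -/
def rank (M : Matroid α) : ℕ := M.eRank.toNat

/-- The rank of a set in a matroid, as a natural number. -/
def setRank (M : Matroid α) (X : Set α) : ℕ := (M.eRk X).toNat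

theorem contract_closure_mem {M : Matroid α} {F X : Set α} :
    (M ／ F).IsFlat X ↔ Disjoint X F ∧ M.closure (X ∪ F) \ F = X := by
  rw [Matroid.isFlat_iff_closure_eq, Matroid.contract_closure_eq]
  constructor
  · intro h
    refine ⟨?_, h⟩
    rw [← h]
    exact Set.disjoint_sdiff_left
  · exact fun h => h.2

/-- The flats of `M ／ F` correspond to the flats of `M` containing `F`. -/
theorem contract_isFlat_iff {M : Matroid α} {F X : Set α} (hF : M.IsFlat F) :
    (M ／ F).IsFlat X ↔ Disjoint X F ∧ M.IsFlat (X ∪ F) := by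
  rw [contract_closure_mem, and_congr_right_iff]
  intro hd
  rw [Matroid.isFlat_iff_closure_eq]
  constructor
  · intro h
    apply Set.Subset.antisymm
    · intro e he
      by_cases h1 : e ∈ F
      · exact Or.inr h1
      · left
        rw [← h]
        exact ⟨he, h1⟩
    · apply Matroid.subset_closure
      apply Set.union_subset _ hF.subset_ground
      rw [← h]
      exact Set.sdiff_subset.trans (M.closure_subset_ground _)
  · intro h
    rw [h, Set.union_sdiff_right, hd.sdiff_eq_left]

theorem contract_loopless {M : Matroid α} {F : Set α} (hF : M.IsFlat F) : (M ／ F).Loopless := by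
  rw [Matroid.loopless_iff, Matroid.contract_loops_eq, hF.closure, Set.sdiff_self]

theorem eRk_add_eRank_contract {M : Matroid α} {F : Set α} (hF : F ⊆ M.E) :
    M.eRk F + (M ／ F).eRank = M.eRank := by
  obtain ⟨I, hI⟩ := M.exists_isBasis F
  obtain ⟨B, hB, hIB⟩ := hI.indep.exists_isBase_superset
  have h1 : (M ／ F).IsBasis (B \ F) (M.E \ F) :=
    hB.isBasis_ground.contract_isBasis_of_isBasis' hI.isBasis'
      (hB.indep.subset (Set.union_subset Set.sdiff_subset hIB))
  have h2 : B ∩ F = I := (hI.eq_of_subset_indep (hB.indep.subset Set.inter_subset_left)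
    (Set.subset_inter hIB hI.subset) Set.inter_subset_right).symm
  have h3 : (M ／ F).IsBase (B \ F) := by
    rw [← Matroid.isBasis_ground_iff]
    exact h1
  rw [← h3.encard_eq_eRank, ← hB.encard_eq_eRank, ← hI.encard_eq_eRk, ← h2, add_comm]
  exact Set.encard_sdiff_add_encard_inter B F

theorem setRank_add_rank_contract [Finite α] {M : Matroid α} {F : Set α} (hF : F ⊆ M.E) :
    setRank M F + rank (M ／ F) = rank M := by
  have hfin : M.eRank ≠ ⊤ :=
    ne_top_of_le_ne_top (Set.encard_ne_top_iff.2 (Set.toFinite M.E)) M.eRank_le_encard_ground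
  have h := eRk_add_eRank_contract hF
  rw [← h] at hfin
  rw [rank, rank, ← h, ENat.toNat_add]
  · rfl
  · exact fun h => hfin (by rw [h, top_add])
  · exact fun h => hfin (by rw [h, add_top])

theorem setRank_pos [Finite α] {M : Matroid α} (hM : M.Loopless) {F : Set α} (hF : F ⊆ M.E)
    (hne : F.Nonempty) : 0 < setRank M F := by
  have hfin : M.eRk F ≠ ⊤ :=
    ne_top_of_le_ne_top (Set.encard_ne_top_iff.2 (Set.toFinite F)) (M.eRk_le_encard F)
  rw [setRank, Nat.pos_iff_ne_zero]
  intro h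
  rcases (ENat.toNat_eq_zero).1 h with h | h
  · rw [Matroid.eRk_eq_zero_iff, Matroid.loops_eq_empty] at h
    exact hne.ne_empty (Set.subset_empty_iff.1 h)
  · exact hfin h

theorem rank_eq_zero_iff [Finite α] {M : Matroid α} (hM : M.Loopless) :
    rank M = 0 ↔ M.E = ∅ := by
  constructor
  · intro h
    by_contra hne
    have h1 := setRank_pos hM (F := M.E) subset_rfl (Set.nonempty_iff_ne_empty.2 hne)
    rw [setRank, Matroid.eRk_ground] at h1
    exact h1.ne' h
  · intro h
    rw [rank, ← Matroid.eRk_ground, h, Matroid.eRk_empty]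
    rfl

end Matroid

/-! ### Ordinary Kazhdan–Lusztig polynomials -/

section Ordinary

open Polynomial

variable {α : Type v} [Finite α]

/-- Loopless matroids whose ground set is contained in `α`. -/
abbrev LooplessMatroid (α : Type v) : Type v := {M : Matroid α // M.Loopless}

/-- The flats of a matroid. -/
abbrev Flats (M : Matroid α) : Type v := {F : Set α // M.IsFlat F}

/-- The contraction of a loopless matroid by a flat. -/
def LooplessMatroid.contract (M : LooplessMatroid α) (F : Flats M.1) : LooplessMatroid α :=
  ⟨M.1 ／ F.1, contract_loopless F.2⟩

/-- The polynomial `∑ t ^ rk(F) * P_{M / F}(t)`, the sum being over all flats `F` of `M`. -/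
def zPoly (P : LooplessMatroid α → ℤ[X]) (M : LooplessMatroid α) : ℤ[X] :=
  ∑ᶠ F : Flats M.1, X ^ setRank M.1 F.1 * P (M.contract F)

/-- The conditions characterizing the assignment `M ↦ P_M(t)` of Kazhdan–Lusztig polynomials. -/
def IsKLAssignment (P : LooplessMatroid α → ℤ[X]) : Prop :=
  (∀ M, rank M.1 = 0 → P M = 1) ∧
  (∀ M, 0 < rank M.1 → 2 * (P M).natDegree < rank M.1) ∧
  (∀ M, IsPalindromic (zPoly P M).coeff (rank M.1))

theorem zPoly_coeff (P : LooplessMatroid α → ℤ[X]) (M : LooplessMatroid α) (i : ℕ) :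
    (zPoly P M).coeff i = (P M).coeff i +
      ∑ᶠ F : {F : Set α // M.1.IsFlat F ∧ F.Nonempty}, if setRank M.1 F.1 ≤ i then
        (P (M.contract ⟨F.1, F.2.1⟩)).coeff (i - setRank M.1 F.1) else 0 := by
  classical
  have hM := M.2
  have he : M.1.IsFlat ∅ := by
    rw [Matroid.isFlat_iff_closure_eq, Matroid.closure_empty, Matroid.loops_eq_empty]
  let g : Option {F : Set α // M.1.IsFlat F ∧ F.Nonempty} ≃ Flats M.1 :=
    { toFun := fun o => o.elim ⟨∅, he⟩ (fun F => ⟨F.1, F.2.1⟩)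
      invFun := fun F => if h : F.1.Nonempty then some ⟨F.1, F.2, h⟩ else none
      left_inv := by
        rintro (_ | F)
        · simp
        · simp [F.2.2]
      right_inv := by
        rintro ⟨F, hF⟩
        by_cases h : F.Nonempty
        · simp [h]
        · simp [Set.not_nonempty_iff_eq_empty.1 h] }
  have : Fintype {F : Set α // M.1.IsFlat F ∧ F.Nonempty} := Fintype.ofFinite _
  have h0 : M.contract ⟨∅, he⟩ = M := Subtype.ext (Matroid.contract_empty M.1)
  rw [zPoly, ← finsum_comp_equiv g, finsum_eq_sum_of_fintype, finsum_eq_sum_of_fintype,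
    Fintype.sum_option, coeff_add, finsetSum_coeff]
  have h1 : setRank M.1 ∅ = 0 := by simp [setRank]
  congr 1
  · change (X ^ setRank M.1 ∅ * P (M.contract ⟨∅, he⟩)).coeff i = _
    rw [h0, h1, pow_zero, one_mul]
  · refine Finset.sum_congr rfl fun F _ => ?_
    exact coeff_X_pow_mul' _ _ _

theorem exists_unique_ground (M : Matroid α) (hM : M.Loopless) (h0 : 0 < rank M) :
    ∃ F : {F : Set α // M.IsFlat F ∧ F.Nonempty}, rank (M ／ F.1) = 0 ∧
      ∀ F' : {F : Set α // M.IsFlat F ∧ F.Nonempty}, rank (M ／ F'.1) = 0 → F' = F := by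
  refine ⟨⟨M.E, M.ground_isFlat, ?_⟩, ?_, ?_⟩
  · rw [Set.nonempty_iff_ne_empty]
    intro h
    exact h0.ne' ((rank_eq_zero_iff hM).2 h)
  · rw [rank_eq_zero_iff (contract_loopless M.ground_isFlat)]
    exact Set.sdiff_self
  · rintro ⟨F, hF, hne⟩ h
    rw [rank_eq_zero_iff (contract_loopless hF)] at h
    exact Subtype.ext (Set.Subset.antisymm hF.subset_ground (Set.sdiff_eq_empty.1 h))

theorem existsUnique_isKLAssignment :
    ∃! P : LooplessMatroid α → ℤ[X], IsKLAssignment P := by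
  classical
  obtain ⟨c, ⟨h0, h1, h2⟩, huniq⟩ := existsUnique_kl
    (I := LooplessMatroid α) (fun M => rank M.1) (fun _ => ℤ)
    (fun M => {F : Set α // M.1.IsFlat F ∧ F.Nonempty})
    (fun M F => M.contract ⟨F.1, F.2.1⟩) (fun M F => setRank M.1 F.1)
    (fun M F => setRank_pos M.2 F.2.1.subset_ground F.2.2)
    (fun M F => setRank_add_rank_contract F.2.1.subset_ground)
    (fun _ _ => AddMonoidHom.id ℤ) (fun _ => 1) (fun _ _ => one_ne_zero)
    (fun M hM => by
      obtain ⟨F, hF, hF'⟩ := exists_unique_ground M.1 M.2 hM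
      exact ⟨F, hF, hF', one_ne_zero⟩)
  simp only [AddMonoidHom.id_apply] at h2 huniq
  let P : LooplessMatroid α → ℤ[X] := fun M =>
    ∑ i ∈ Finset.range (rank M.1 + 1), monomial i (c M i)
  have hP : ∀ M i, (P M).coeff i = c M i := by
    intro M i
    simp only [P, finsetSum_coeff, coeff_monomial, Finset.sum_ite_eq', Finset.mem_range]
    split_ifs with hi
    · rfl
    · by_contra h
      rcases Nat.eq_zero_or_pos (rank M.1) with hr | hr
      · rw [h0 M hr] at h
        have : i ≠ 0 := by omega
        simp [this] at h
      · have := h1 M hr i (Ne.symm h)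
        omega
  refine ⟨P, ⟨?_, ?_, ?_⟩, ?_⟩
  · intro M hM
    ext i
    rw [hP, h0 M hM, coeff_one]
  · intro M hM
    by_cases h : P M = 0
    · simpa [h] using hM
    · apply h1 M hM
      rw [← hP]
      exact leadingCoeff_ne_zero.2 h
  · intro M
    have : (zPoly P M).coeff = _ := funext fun i => zPoly_coeff P M i
    rw [this]
    simp only [hP]
    exact h2 M
  · rintro P' ⟨h0', h1', h2'⟩
    have := huniq (fun M i => (P' M).coeff i) ⟨?_, ?_, ?_⟩
    · funext M
      ext i
      rw [hP, ← this]
    · intro M hM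
      funext i
      rw [h0' M hM, coeff_one]
    · intro M hM i hi
      have h3 := h1' M hM
      have h4 := le_natDegree_of_ne_zero hi
      omega
    · intro M
      have h3 := h2' M
      have h4 : (zPoly P' M).coeff = _ := funext fun i => zPoly_coeff P' M i
      rw [h4] at h3
      exact h3

/-- The Kazhdan–Lusztig polynomial of a loopless matroid. -/
def klPolynomial (M : LooplessMatroid α) : ℤ[X] := existsUnique_isKLAssignment.choose M

/-- The `Z`-polynomial of a loopless matroid. -/
def zPolynomial (M : LooplessMatroid α) : ℤ[X] := zPoly klPolynomial M

end Ordinary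

/-! ### Equivariant Kazhdan–Lusztig polynomials -/

section Equivariant

/-- An action of a finite group `H` on a loopless matroid `M` with ground set contained in `α`:
the group acts on `α` and sends flats of `M` to flats of `M`. -/
structure MatroidAction (α : Type v) where
  /-- the group -/
  H : Type u
  [group : Group H]
  [finite : Finite H]
  /-- the action on elements -/
  [action : MulAction H α]
  /-- the matroid -/
  M : Matroid α
  loopless : M.Loopless
  smul_isFlat : ∀ (h : H) (F : Set α), M.IsFlat F → M.IsFlat (h • F)

attribute [instance] MatroidAction.group MatroidAction.finite MatroidAction.action

namespace MatroidAction

variable {α : Type v} (x : MatroidAction.{u, v} α)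

/-- The nonempty flats. -/
abbrev NonemptyFlats : Type v := {F : Set α // x.M.IsFlat F ∧ F.Nonempty}

/-- Two flats are related if they lie in the same orbit. -/
def orbitSetoid : Setoid x.NonemptyFlats where
  r F F' := ∃ h : x.H, h • F.1 = F'.1
  iseqv :=
    { refl := fun F => ⟨1, one_smul _ _⟩
      symm := fun ⟨h, e⟩ => ⟨h⁻¹, by rw [← e, inv_smul_smul]⟩
      trans := fun ⟨h, e⟩ ⟨h', e'⟩ => ⟨h' * h, by rw [mul_smul, e, e']⟩ }

/-- The set of orbits of nonempty flats. -/
abbrev FlatOrbits : Type v := Quotient x.orbitSetoid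

/-- The action of the stabilizer `H_F` of a flat `F` on the contraction `M ／ F`. -/
def contract (F : x.NonemptyFlats) : MatroidAction.{u, v} α where
  H := MulAction.stabilizer x.H F.1
  M := x.M ／ F.1
  loopless := contract_loopless F.2.1
  smul_isFlat := by
    rintro ⟨h, hh⟩ X hX
    rw [contract_isFlat_iff F.2.1] at hX ⊢
    have hh' : h • F.1 = F.1 := hh
    change Disjoint (h • X) F.1 ∧ x.M.IsFlat (h • X ∪ F.1)
    have h1 := x.smul_isFlat h _ hX.2
    rw [Set.smul_set_union, hh'] at h1
    refine ⟨?_, h1⟩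
    rw [← hh']
    exact Set.disjoint_smul_set.2 hX.1

end MatroidAction

variable (k : Type*) [Field k] {α : Type v} [Finite α]

/-- The polynomial `∑ t ^ rk(F) * Ind_{H_F}^H P_{M / F}^{H_F}(t)`, the sum being over orbits `[F]`
of flats. Polynomials with coefficients in `VRep k H` are finitely supported functions on `ℕ`.
The first summand is the term of the flat `∅`, for which `H_F = H` and `M / F = M`. -/
def equivariantZPoly (P : ∀ x : MatroidAction.{u, v} α, ℕ →₀ VRep k x.H)
    (x : MatroidAction.{u, v} α) : ℕ →₀ VRep k x.H :=
  P x + ∑ᶠ o : x.FlatOrbits,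
    Finsupp.mapDomain (fun i => i + setRank x.M o.out.1)
      (Finsupp.mapRange.addMonoidHom (VRep.ind (MulAction.stabilizer x.H o.out.1).subtype)
        (P (x.contract o.out)))

/-- The conditions characterizing the assignment of equivariant Kazhdan–Lusztig polynomials. -/
def IsEquivariantKLAssignment (P : ∀ x : MatroidAction.{u, v} α, ℕ →₀ VRep k x.H) : Prop :=
  (∀ x, rank x.M = 0 → P x = Finsupp.single 0 (VRep.triv k x.H)) ∧
  (∀ x, 0 < rank x.M → ∀ i ∈ (P x).support, 2 * i < rank x.M) ∧
  (∀ x, IsPalindromic (equivariantZPoly k P x) (rank x.M))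

theorem mapDomain_add_apply {A : Type*} [AddCommMonoid A] (f : ℕ →₀ A) (d i : ℕ) :
    Finsupp.mapDomain (fun j => j + d) f i = if d ≤ i then f (i - d) else 0 := by
  split_ifs with h
  · obtain ⟨j, rfl⟩ := Nat.exists_eq_add_of_le' h
    rw [Nat.add_sub_cancel]
    exact Finsupp.mapDomain_apply (add_left_injective d) f j
  · apply Finsupp.mapDomain_of_notMem_range
    rintro ⟨j, rfl⟩
    exact h (Nat.le_add_left d j)

theorem equivariantZPoly_apply (P : ∀ x : MatroidAction.{u, v} α, ℕ →₀ VRep k x.H)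
    (x : MatroidAction.{u, v} α) (i : ℕ) :
    equivariantZPoly k P x i = P x i + ∑ᶠ o : x.FlatOrbits,
      if setRank x.M o.out.1 ≤ i then
        VRep.ind (MulAction.stabilizer x.H o.out.1).subtype
          (P (x.contract o.out) (i - setRank x.M o.out.1)) else 0 := by
  have : Fintype x.FlatOrbits := Fintype.ofFinite _
  rw [equivariantZPoly, Finsupp.add_apply, finsum_eq_sum_of_fintype, finsum_eq_sum_of_fintype,
    Finsupp.finsetSum_apply]
  congr 1
  refine Finset.sum_congr rfl fun o _ => ?_
  exact mapDomain_add_apply _ _ _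

theorem existsUnique_isEquivariantKLAssignment :
    ∃! P : ∀ x : MatroidAction.{u, v} α, ℕ →₀ VRep k x.H, IsEquivariantKLAssignment k P := by
  classical
  obtain ⟨c, ⟨h0, h1, h2⟩, huniq⟩ := existsUnique_kl
    (I := MatroidAction.{u, v} α) (fun x => rank x.M) (fun x => VRep k x.H)
    (fun x => x.FlatOrbits)
    (fun x o => x.contract o.out) (fun x o => setRank x.M o.out.1)
    (fun x o => setRank_pos x.loopless o.out.2.1.subset_ground o.out.2.2)
    (fun x o => setRank_add_rank_contract o.out.2.1.subset_ground)
    (fun x o => VRep.ind (MulAction.stabilizer x.H o.out.1).subtype)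
    (fun x => VRep.triv k x.H) (fun _ _ => VRep.triv_ne_zero)
    (fun x hx => by
      obtain ⟨F, hF, hF'⟩ := exists_unique_ground x.M x.loopless hx
      have hout : (Quotient.mk x.orbitSetoid F).out = F := by
        obtain ⟨h, e⟩ := Quotient.exact (Quotient.out_eq (Quotient.mk x.orbitSetoid F))
        have h4 : F.1 = x.M.E := by
          rw [rank_eq_zero_iff (contract_loopless F.2.1)] at hF
          exact Set.Subset.antisymm F.2.1.subset_ground (Set.sdiff_eq_empty.1 hF)
        have h5 := (x.smul_isFlat h _ x.M.ground_isFlat).subset_ground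
        have h6 : x.M.E ⊆ (Quotient.mk x.orbitSetoid F).out.1 := by
          nth_rewrite 2 [← h4] at h5
          rw [← e] at h5
          exact Set.smul_set_subset_smul_set_iff.1 h5
        apply Subtype.ext
        rw [h4]
        exact Set.Subset.antisymm (Quotient.mk x.orbitSetoid F).out.2.1.subset_ground h6
      refine ⟨Quotient.mk x.orbitSetoid F, ?_, ?_, VRep.ind_triv_ne_zero _⟩
      · change rank (x.M ／ (Quotient.mk x.orbitSetoid F).out.1) = 0
        rw [hout]
        exact hF
      · intro o ho
        rw [← Quotient.out_eq o, hF' o.out ho])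
  let P : ∀ x : MatroidAction.{u, v} α, ℕ →₀ VRep k x.H := fun x =>
    Finsupp.onFinset (Finset.range (rank x.M + 1)) (c x) (fun i hi => by
      rw [Finset.mem_range]
      rcases Nat.eq_zero_or_pos (rank x.M) with hr | hr
      · rw [h0 x hr] at hi
        have : i = 0 := by
          by_contra h
          simp [h] at hi
        omega
      · have := h1 x hr i hi
        omega)
  have hP : ∀ x i, P x i = c x i := fun x i => rfl
  refine ⟨P, ⟨?_, ?_, ?_⟩, ?_⟩
  · intro x hx
    ext i
    rw [hP, h0 x hx, Finsupp.single_apply]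
    simp only [eq_comm]
  · intro x hx i hi
    exact h1 x hx i (Finsupp.mem_support_iff.1 hi)
  · intro x
    have : ⇑(equivariantZPoly k P x) = _ := funext fun i => equivariantZPoly_apply k P x i
    rw [this]
    exact h2 x
  · rintro P' ⟨h0', h1', h2'⟩
    have := huniq (fun x i => P' x i) ⟨?_, ?_, ?_⟩
    · funext x
      ext i
      rw [hP, ← this]
    · intro x hx
      funext i
      change P' x i = _
      rw [h0' x hx, Finsupp.single_apply]
      simp only [eq_comm]
    · intro x hx i hi
      exact h1' x hx i (Finsupp.mem_support_iff.2 hi)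
    · intro x
      have h3 := h2' x
      have h4 : ⇑(equivariantZPoly k P' x) = _ := funext fun i => equivariantZPoly_apply k P' x i
      rw [h4] at h3
      exact h3

/-- The equivariant Kazhdan–Lusztig polynomial of an action on a loopless matroid. -/
def equivariantKLPolynomial (x : MatroidAction.{u, v} α) : ℕ →₀ VRep k x.H :=
  (existsUnique_isEquivariantKLAssignment k).choose x

/-- The equivariant `Z`-polynomial of an action on a loopless matroid. -/
def equivariantZPolynomial (x : MatroidAction.{u, v} α) : ℕ →₀ VRep k x.H :=
  equivariantZPoly k (equivariantKLPolynomial k) x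

end Equivariant

/-! ### Quasi series-parallel matroids -/

section SeriesParallel

variable {α : Type v}

/-- Series-parallel matroids: those obtained from a single loop or a single coloop by a finite
sequence of parallel extensions (`M` is a parallel extension of `M ＼ {e}` if `e` lies in a circuit
of cardinality two of `M`) and series extensions (`M` is a series extension of `M ／ {e}` if `e` lies
in a cocircuit of cardinality two of `M`). -/
inductive IsSeriesParallel : Matroid α → Prop
  | loop (e : α) : IsSeriesParallel (Matroid.loopyOn {e})
  | coloop (e : α) : IsSeriesParallel (Matroid.freeOn {e})
  | parallel (M : Matroid α) (e f : α) (hef : e ≠ f) (hC : M.IsCircuit {e, f})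
      (h : IsSeriesParallel (M ＼ {e})) : IsSeriesParallel M
  | series (M : Matroid α) (e f : α) (hef : e ≠ f) (hC : M.IsCocircuit {e, f})
      (h : IsSeriesParallel (M ／ {e})) : IsSeriesParallel M

/-- The connected component of `e` in `M`: the element `e` itself and all elements lying in a
common circuit with `e`. -/
def component (M : Matroid α) (e : α) : Set α :=
  {f | f = e ∨ ∃ C, M.IsCircuit C ∧ e ∈ C ∧ f ∈ C}

/-- The connected components of a matroid. -/
def IsComponent (M : Matroid α) (C : Set α) : Prop := ∃ e ∈ M.E, C = component M e

/-- The number of connected components of a matroid. -/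
def numComponents (M : Matroid α) : ℕ := {C | IsComponent M C}.ncard

/-- A matroid is quasi series-parallel if all of its connected components are series-parallel. -/
def IsQuasiSeriesParallel (M : Matroid α) : Prop :=
  ∀ C, IsComponent M C → IsSeriesParallel (M ↾ C)

/-- A matroid is simple if it has no circuits of cardinality one or two. -/
def IsSimple (M : Matroid α) : Prop := ∀ C, M.IsCircuit C → 2 < C.encard

variable (M : Matroid α) (σ : Equiv.Perm α)

theorem mapEquiv_isCircuit {C : Set α} :
    (M.mapEquiv σ).IsCircuit C ↔ M.IsCircuit (σ.symm '' C) := by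
  rw [Matroid.isCircuit_iff, Matroid.isCircuit_iff, Matroid.mapEquiv_dep_iff, and_congr_right_iff]
  intro _
  constructor
  · intro h D hD hDC
    have h1 := @h (σ '' D) (by rw [Matroid.mapEquiv_dep_iff, Equiv.symm_image_image]; exact hD)
      (by rw [← Equiv.image_symm_image σ C]; exact Set.image_mono hDC)
    rw [← h1, Equiv.symm_image_image]
  · intro h D hD hDC
    have h1 := @h (σ.symm '' D) (by rwa [Matroid.mapEquiv_dep_iff] at hD) (Set.image_mono hDC)
    exact σ.symm.injective.image_injective h1

theorem mapEquiv_dual : (M.mapEquiv σ)✶ = M✶.mapEquiv σ := by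
  rw [Matroid.mapEquiv_eq_map, Matroid.map_dual, Matroid.mapEquiv_eq_map]

theorem mapEquiv_restrict (R : Set α) :
    (M.mapEquiv σ) ↾ R = (M ↾ (σ.symm '' R)).mapEquiv σ := by
  refine Matroid.ext_indep ?_ fun I _ => ?_
  · simp [Equiv.image_symm_image]
  · simp

theorem mapEquiv_delete (D : Set α) :
    (M.mapEquiv σ) ＼ D = (M ＼ (σ.symm '' D)).mapEquiv σ := by
  rw [Matroid.delete, mapEquiv_restrict, Matroid.delete, Matroid.mapEquiv_ground_eq,
    Set.image_sdiff σ.symm.injective, Equiv.symm_image_image]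

theorem mapEquiv_contract (D : Set α) :
    (M.mapEquiv σ) ／ D = (M ／ (σ.symm '' D)).mapEquiv σ := by
  rw [← Matroid.dual_delete_dual, mapEquiv_dual, mapEquiv_delete, mapEquiv_dual,
    Matroid.dual_delete_dual]

variable {M}

theorem IsSeriesParallel.mapEquiv (h : IsSeriesParallel M) :
    IsSeriesParallel (M.mapEquiv σ) := by
  induction h with
  | loop e =>
    rw [Matroid.mapEquiv_eq_map, Matroid.map_loopyOn, Set.image_singleton]
    exact .loop _
  | coloop e =>
    rw [Matroid.mapEquiv_eq_map, Matroid.map_freeOn, Set.image_singleton]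
    exact .coloop _
  | parallel M e f hef hC h ih =>
    refine .parallel _ (σ e) (σ f) (σ.injective.ne hef) ?_ ?_
    · rw [mapEquiv_isCircuit]
      simpa [Set.image_pair] using hC
    · rw [mapEquiv_delete]
      simpa using ih
  | series M e f hef hC h ih =>
    refine .series _ (σ e) (σ f) (σ.injective.ne hef) ?_ ?_
    · rw [Matroid.IsCocircuit, mapEquiv_dual, mapEquiv_isCircuit]
      simpa [Set.image_pair] using hC
    · rw [mapEquiv_contract]
      simpa using ih

variable (M)

theorem mapEquiv_component (e : α) :
    component (M.mapEquiv σ) e = σ '' component M (σ.symm e) := by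
  ext f
  rw [Equiv.image_eq_preimage_symm]
  simp only [component, Set.mem_ofPred_eq, Set.mem_preimage, EmbeddingLike.apply_eq_iff_eq,
    mapEquiv_isCircuit]
  apply or_congr_right
  constructor
  · rintro ⟨C, h1, h2, h3⟩
    exact ⟨_, h1, Set.mem_image_of_mem _ h2, Set.mem_image_of_mem _ h3⟩
  · rintro ⟨C, h1, h2, h3⟩
    refine ⟨σ '' C, by rwa [Equiv.symm_image_image], ⟨_, h2, ?_⟩, ⟨_, h3, ?_⟩⟩ <;> simp

theorem mapEquiv_isComponent {C : Set α} :
    IsComponent (M.mapEquiv σ) C ↔ IsComponent M (σ.symm '' C) := by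
  constructor
  · rintro ⟨e, he, rfl⟩
    refine ⟨σ.symm e, ?_, ?_⟩
    · rw [Matroid.mapEquiv_ground_eq, Equiv.image_eq_preimage_symm] at he
      exact he
    · rw [mapEquiv_component, Equiv.symm_image_image]
  · rintro ⟨e, he, h⟩
    refine ⟨σ e, ?_, ?_⟩
    · rw [Matroid.mapEquiv_ground_eq]
      exact Set.mem_image_of_mem _ he
    · rw [mapEquiv_component, Equiv.symm_apply_apply, ← h, Equiv.image_symm_image]

variable {M}

theorem IsQuasiSeriesParallel.mapEquiv (h : IsQuasiSeriesParallel M) :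
    IsQuasiSeriesParallel (M.mapEquiv σ) := by
  intro C hC
  rw [mapEquiv_isComponent] at hC
  rw [mapEquiv_restrict]
  exact (h _ hC).mapEquiv σ

theorem IsSimple.mapEquiv (h : IsSimple M) : IsSimple (M.mapEquiv σ) := by
  intro C hC
  rw [mapEquiv_isCircuit] at hC
  have := h _ hC
  rwa [σ.symm.injective.encard_image] at this

theorem rank_mapEquiv : rank (M.mapEquiv σ) = rank M := by
  rw [rank, Matroid.mapEquiv_eq_map, Matroid.eRank_map, rank]

theorem mapEquiv_one : M.mapEquiv 1 = M := by
  refine Matroid.ext_indep ?_ fun I _ => ?_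
  · simp
  · rw [Matroid.mapEquiv_indep_iff]
    exact iff_of_eq (congrArg _ (Set.image_id I))

theorem mapEquiv_mul (τ : Equiv.Perm α) : M.mapEquiv (σ * τ) = (M.mapEquiv τ).mapEquiv σ := by
  refine Matroid.ext_indep ?_ fun I _ => ?_
  · simp [Set.image_image]
  · simp only [Matroid.mapEquiv_indep_iff, Set.image_image]
    rfl

end SeriesParallel

/-! ### Dowling geometries -/

section Dowling

/-- A partial `G`-partition of `ι`: a subset `S` of `ι`, a partition of `S` into nonempty blocks
(given by the equivalence relation on `S` of lying in the same block), and a function `S → G`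
(given by a function on `ι` whose values outside `S` are disregarded). -/
structure PartialGPartition (ι : Type u) (G : Type v) where
  /-- the subset `S` -/
  support : Set ι
  /-- lying in the same block -/
  rel : ι → ι → Prop
  /-- the function to `G` -/
  label : ι → G
  rel_refl : ∀ i ∈ support, rel i i
  rel_symm : ∀ {i j}, rel i j → rel j i
  rel_trans : ∀ {i j l}, rel i j → rel j l → rel i l
  mem_of_rel : ∀ {i j}, rel i j → i ∈ support

namespace PartialGPartition

variable {ι : Type u} {G : Type v} [Group G]

/-- Equivalence: same subset, same blocks, and on each block the two functions differ by left
multiplication by an element of `G`. -/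
def Equivalent (p q : PartialGPartition ι G) : Prop :=
  p.support = q.support ∧ (∀ i j, p.rel i j ↔ q.rel i j) ∧
    ∀ i ∈ p.support, ∃ g : G, ∀ j, p.rel i j → p.label j = g * q.label j

/-- The refinement order: `q` is obtained from `p`, up to equivalence, by deleting blocks and
merging blocks. That is, the subset of `q` is contained in that of `p`, and each block of `p` that
meets the subset of `q` is contained in a block of `q`, with the two functions differing on it by
left multiplication by an element of `G`. -/
def Refines (p q : PartialGPartition ι G) : Prop :=
  q.support ⊆ p.support ∧
    ∀ i ∈ q.support, ∃ g : G, ∀ j, p.rel i j → q.rel i j ∧ p.label j = g * q.label j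

theorem Refines.refl (p : PartialGPartition ι G) : p.Refines p :=
  ⟨subset_rfl, fun _ _ => ⟨1, fun _ h => ⟨h, (one_mul _).symm⟩⟩⟩

theorem Refines.trans {p q r : PartialGPartition ι G} (h : p.Refines q) (h' : q.Refines r) :
    p.Refines r := by
  refine ⟨h'.1.trans h.1, fun i hi => ?_⟩
  obtain ⟨g, hg⟩ := h.2 i (h'.1 hi)
  obtain ⟨g', hg'⟩ := h'.2 i hi
  refine ⟨g * g', fun j hj => ?_⟩
  obtain ⟨h1, h2⟩ := hg j hj
  obtain ⟨h3, h4⟩ := hg' j h1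
  exact ⟨h3, by rw [h2, h4, mul_assoc]⟩

theorem equivalent_iff {p q : PartialGPartition ι G} :
    p.Equivalent q ↔ p.Refines q ∧ q.Refines p := by
  constructor
  · rintro ⟨h1, h2, h3⟩
    refine ⟨⟨h1.symm.subset, fun i hi => ?_⟩, ⟨h1.subset, fun i hi => ?_⟩⟩
    · obtain ⟨g, hg⟩ := h3 i (h1.symm ▸ hi)
      exact ⟨g, fun j hj => ⟨(h2 i j).1 hj, hg j hj⟩⟩
    · obtain ⟨g, hg⟩ := h3 i hi
      exact ⟨g⁻¹, fun j hj => ⟨(h2 i j).2 hj, by rw [hg j ((h2 i j).2 hj), inv_mul_cancel_left]⟩⟩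
  · rintro ⟨h1, h2⟩
    have hs := Set.Subset.antisymm h2.1 h1.1
    refine ⟨hs, fun i j => ⟨fun h => ?_, fun h => ?_⟩, fun i hi => ?_⟩
    · obtain ⟨g, hg⟩ := h1.2 i (h2.1 (p.mem_of_rel h))
      exact (hg j h).1
    · obtain ⟨g, hg⟩ := h2.2 i (h1.1 (q.mem_of_rel h))
      exact (hg j h).1
    · obtain ⟨g, hg⟩ := h1.2 i (hs ▸ hi)
      exact ⟨g, fun j hj => (hg j hj).2⟩

variable (ι G) in
/-- The setoid of equivalent partial `G`-partitions. -/
def setoid : Setoid (PartialGPartition ι G) where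
  r := Equivalent
  iseqv :=
    { refl := fun p => equivalent_iff.2 ⟨.refl p, .refl p⟩
      symm := fun h => equivalent_iff.2 (equivalent_iff.1 h).symm
      trans := fun h h' => equivalent_iff.2
        ⟨(equivalent_iff.1 h).1.trans (equivalent_iff.1 h').1,
          (equivalent_iff.1 h').2.trans (equivalent_iff.1 h).2⟩ }

end PartialGPartition

/-- The poset of equivalence classes of partial `G`-partitions of `ι`. -/
def DowlingLattice (ι : Type u) (G : Type v) [Group G] : Type (max u v) :=
  Quotient (PartialGPartition.setoid ι G)

variable {ι : Type u} {G : Type v} [Group G]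

/-- The equivalence class of a partial `G`-partition. -/
def DowlingLattice.mk (p : PartialGPartition ι G) : DowlingLattice ι G :=
  Quotient.mk (PartialGPartition.setoid ι G) p

theorem DowlingLattice.exists_mk (a : DowlingLattice ι G) : ∃ p, DowlingLattice.mk p = a :=
  Quotient.exists_rep a

instance : LE (DowlingLattice ι G) where
  le := Quotient.lift₂ PartialGPartition.Refines (by
    intro p q p' q' hp hq
    have hp' := PartialGPartition.equivalent_iff.1 hp
    have hq' := PartialGPartition.equivalent_iff.1 hq
    exact propext ⟨fun h => (hp'.2.trans h).trans hq'.1, fun h => (hp'.1.trans h).trans hq'.2⟩)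

theorem DowlingLattice.mk_le_mk {p q : PartialGPartition ι G} :
    DowlingLattice.mk p ≤ DowlingLattice.mk q ↔ p.Refines q := Iff.rfl

instance : PartialOrder (DowlingLattice ι G) where
  le_refl a := by
    obtain ⟨p, rfl⟩ := a.exists_mk
    exact .refl p
  le_trans a b c := by
    obtain ⟨p, rfl⟩ := a.exists_mk
    obtain ⟨q, rfl⟩ := b.exists_mk
    obtain ⟨r, rfl⟩ := c.exists_mk
    exact fun h h' => PartialGPartition.Refines.trans h h'
  le_antisymm a b := by
    obtain ⟨p, rfl⟩ := a.exists_mk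
    obtain ⟨q, rfl⟩ := b.exists_mk
    exact fun h h' => Quotient.sound (PartialGPartition.equivalent_iff.2 ⟨h, h'⟩)

/-- The partition into singletons. -/
def PartialGPartition.singletons (ι : Type u) (G : Type v) [Group G] : PartialGPartition ι G where
  support := Set.univ
  rel i j := i = j
  label _ := 1
  rel_refl _ _ := rfl
  rel_symm h := h.symm
  rel_trans h h' := h.trans h'
  mem_of_rel _ := Set.mem_univ _

instance : OrderBot (DowlingLattice ι G) where
  bot := DowlingLattice.mk (PartialGPartition.singletons ι G)
  bot_le a := by
    obtain ⟨p, rfl⟩ := a.exists_mk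
    refine DowlingLattice.mk_le_mk.2 ⟨Set.subset_univ _, fun i hi => ⟨(p.label i)⁻¹, ?_⟩⟩
    rintro j rfl
    exact ⟨p.rel_refl _ hi, (inv_mul_cancel _).symm⟩

instance [Finite ι] [Finite G] : Finite (PartialGPartition ι G) := by
  refine Finite.of_injective
    (fun p : PartialGPartition ι G => (p.support, p.rel, p.label)) ?_
  rintro ⟨_, _, _, _, _, _, _⟩ ⟨_, _, _, _, _, _, _⟩ h
  simp only [Prod.mk.injEq] at h
  obtain ⟨rfl, rfl, rfl⟩ := h
  rfl

instance [Finite ι] [Finite G] : Finite (DowlingLattice ι G) :=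
  inferInstanceAs (Finite (Quotient (PartialGPartition.setoid ι G)))

/-- The elements of the Dowling geometry: the atoms of the lattice of partial `G`-partitions. -/
abbrev DowlingPoint (ι : Type u) (G : Type v) [Group G] : Type (max u v) :=
  {a : DowlingLattice ι G // IsAtom a}

/-! The following facts establish that the sets of atoms below elements of the lattice are the flats
of a matroid. A potential is a function `y : ι → G ∪ {0}`; it is compatible with a partial
`G`-partition `p` if it vanishes outside the support of `p` and on each block of `p` it agrees with
the label of `p` up to left multiplication by an element of `G ∪ {0}`. -/

/-- Compatibility of a potential with a partial `G`-partition. -/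
def PartialGPartition.Sat (p : PartialGPartition ι G) (y : ι → WithZero G) : Prop :=
  (∀ i ∉ p.support, y i = 0) ∧
    ∀ i j, p.rel i j → y j = y i * ((p.label i)⁻¹ * p.label j : G)

theorem PartialGPartition.Refines.sat {p q : PartialGPartition ι G} (h : p.Refines q)
    {y : ι → WithZero G} (hy : q.Sat y) : p.Sat y := by
  refine ⟨fun i hi => hy.1 i fun h' => hi (h.1 h'), fun i j hij => ?_⟩
  by_cases hi : i ∈ q.support
  · obtain ⟨g, hg⟩ := h.2 i hi
    obtain ⟨h1, h2⟩ := hg j hij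
    obtain ⟨-, h3⟩ := hg i (p.rel_refl i (h.1 hi))
    rw [hy.2 i j h1, h2, h3]
    congr 2
    group
  · have hj : j ∉ q.support := by
      intro hj
      obtain ⟨g, hg⟩ := h.2 j hj
      exact hi (q.mem_of_rel (q.rel_symm (hg i (p.rel_symm hij)).1))
    rw [hy.1 i hi, hy.1 j hj, zero_mul]

theorem PartialGPartition.refines_of_sat {p q : PartialGPartition ι G}
    (h : ∀ y, q.Sat y → p.Sat y) : p.Refines q := by
  classical
  have key : ∀ i, q.Sat (fun j => if q.rel i j then (q.label j : WithZero G) else 0) := by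
    intro i
    refine ⟨fun j hj => if_neg fun h' => hj (q.mem_of_rel (q.rel_symm h')), fun j l hjl => ?_⟩
    beta_reduce
    by_cases hj : q.rel i j
    · rw [if_pos hj, if_pos (q.rel_trans hj hjl), ← WithZero.coe_mul, mul_inv_cancel_left]
    · rw [if_neg hj, if_neg fun h' => hj (q.rel_trans h' (q.rel_symm hjl)), zero_mul]
  constructor
  · intro i hi
    by_contra h'
    have h1 := (h _ (key i)).1 i h'
    simp [q.rel_refl i hi] at h1
  · intro i hi
    refine ⟨p.label i * (q.label i)⁻¹, fun j hj => ?_⟩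
    have h1 := (h _ (key i)).2 i j hj
    simp only [q.rel_refl i hi, if_true] at h1
    split_ifs at h1 with h2
    · refine ⟨h2, ?_⟩
      rw [← WithZero.coe_mul, WithZero.coe_inj] at h1
      rw [h1]
      group
    · simp at h1

/-- Compatibility of a potential with an element of the lattice. -/
def DowlingLattice.Sat (a : DowlingLattice ι G) (y : ι → WithZero G) : Prop :=
  ∃ p, DowlingLattice.mk p = a ∧ p.Sat y

theorem DowlingLattice.sat_mk {p : PartialGPartition ι G} {y : ι → WithZero G} :
    (DowlingLattice.mk p).Sat y ↔ p.Sat y := by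
  constructor
  · rintro ⟨q, h, hq⟩
    have : DowlingLattice.mk p ≤ DowlingLattice.mk q := h.ge
    exact PartialGPartition.Refines.sat this hq
  · exact fun h => ⟨p, rfl, h⟩

theorem DowlingLattice.le_iff_sat {a b : DowlingLattice ι G} :
    a ≤ b ↔ ∀ y, b.Sat y → a.Sat y := by
  obtain ⟨p, rfl⟩ := a.exists_mk
  obtain ⟨q, rfl⟩ := b.exists_mk
  simp only [DowlingLattice.sat_mk]
  exact ⟨fun h y hy => PartialGPartition.Refines.sat h hy, PartialGPartition.refines_of_sat⟩

/-- For every set of potentials there is a largest partial `G`-partition compatible with all of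
them. -/
theorem exists_largest_sat (Y : Set (ι → WithZero G)) :
    ∃ p : PartialGPartition ι G, ∀ a : DowlingLattice ι G,
      a ≤ DowlingLattice.mk p ↔ ∀ y ∈ Y, a.Sat y := by
  classical
  let S : Set ι := {i | ∃ y ∈ Y, y i ≠ 0}
  let R : ι → ι → Prop := fun i j => i ∈ S ∧ ∃ g : G, ∀ y ∈ Y, y j = y i * g
  have hsymm : ∀ {i j}, R i j → R j i := by
    rintro i j ⟨⟨y, hy, hi⟩, g, hg⟩
    refine ⟨⟨y, hy, ?_⟩, g⁻¹, fun y hy => ?_⟩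
    · rw [hg y hy]
      exact mul_ne_zero hi WithZero.coe_ne_zero
    · rw [hg y hy, mul_assoc, ← WithZero.coe_mul, mul_inv_cancel, WithZero.coe_one, mul_one]
  have htrans : ∀ {i j l}, R i j → R j l → R i l := by
    rintro i j l ⟨hi, g, hg⟩ ⟨-, g', hg'⟩
    exact ⟨hi, g * g', fun y hy => by rw [hg' y hy, hg y hy, WithZero.coe_mul, mul_assoc]⟩
  have hrefl : ∀ i ∈ S, R i i := fun i hi => ⟨hi, 1, fun y _ => by simp⟩
  let root : ι → ι := fun i => if h : ∃ j, R i j then h.choose else i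
  have hroot : ∀ i ∈ S, R (root i) i := by
    intro i hi
    have h : ∃ j, R i j := ⟨i, hrefl i hi⟩
    simp only [root, dif_pos h]
    exact hsymm h.choose_spec
  have hroot_eq : ∀ i j, R i j → root i = root j := by
    intro i j hij
    have h : R i = R j := by
      funext l
      exact propext ⟨fun h => htrans (hsymm hij) h, fun h => htrans hij h⟩
    have h1 : ∃ l, R i l := ⟨j, hij⟩
    have h2 : ∃ l, R j l := ⟨i, hsymm hij⟩
    simp only [root, dif_pos h1, dif_pos h2]
    congr 1
  let lab : ι → G := fun i => if h : ∃ g : G, ∀ y ∈ Y, y i = y (root i) * g then h.choose else 1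
  have hlab : ∀ i ∈ S, ∀ y ∈ Y, y i = y (root i) * lab i := by
    intro i hi
    have h : ∃ g : G, ∀ y ∈ Y, y i = y (root i) * g := (hroot i hi).2
    simp only [lab, dif_pos h]
    exact h.choose_spec
  let p : PartialGPartition ι G :=
    { support := S, rel := R, label := lab, rel_refl := hrefl, rel_symm := hsymm,
      rel_trans := htrans, mem_of_rel := fun h => h.1 }
  have hS : ∀ {i j}, R i j → j ∈ S := fun h => (hsymm h).1
  have hp : ∀ y ∈ Y, p.Sat y := by
    intro y hy
    refine ⟨fun i hi => ?_, fun i j hij => ?_⟩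
    · by_contra h
      exact hi ⟨y, hy, h⟩
    · change y j = y i * ((lab i)⁻¹ * lab j : G)
      rw [hlab j (hS hij) y hy, hlab i hij.1 y hy, hroot_eq i j hij, mul_assoc,
        ← WithZero.coe_mul, mul_inv_cancel_left]
  refine ⟨p, fun a => ?_⟩
  obtain ⟨q, rfl⟩ := a.exists_mk
  constructor
  · intro h y hy
    exact DowlingLattice.le_iff_sat.1 h y (DowlingLattice.sat_mk.2 (hp y hy))
  · intro h
    simp only [DowlingLattice.sat_mk] at h
    refine DowlingLattice.mk_le_mk.2 ⟨?_, fun i hi => ⟨q.label i * (lab i)⁻¹, fun j hj => ?_⟩⟩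
    · rintro i ⟨y, hy, hi⟩
      by_contra h'
      exact hi ((h y hy).1 i h')
    · have hij : R i j := ⟨hi, _, fun y hy => (h y hy).2 i j hj⟩
      refine ⟨hij, ?_⟩
      obtain ⟨y, hy, hyi⟩ := hi
      have h1 := (h y hy).2 i j hj
      rw [hlab j (hS hij) y hy, hlab i hij.1 y hy, hroot_eq i j hij, mul_assoc,
        ← WithZero.coe_mul] at h1
      have h2 : y (root j) ≠ 0 := by
        intro h2
        apply hyi
        rw [hlab i hij.1 y hy, hroot_eq i j hij, h2, zero_mul]
      have h3 := WithZero.coe_inj.1 (mul_left_cancel₀ h2 h1)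
      change q.label j = q.label i * (lab i)⁻¹ * lab j
      rw [h3]
      group

/-- Proportionality of two pairs of elements of `G ∪ {0}`. -/
def Proportional (w p : WithZero G × WithZero G) : Prop := ∃ g : G, p = (w.1 * g, w.2 * g)

theorem Proportional.refl (w : WithZero G × WithZero G) : Proportional w w := ⟨1, by simp⟩

theorem Proportional.symm {w p : WithZero G × WithZero G} (h : Proportional w p) : Proportional p w := by
  obtain ⟨g, rfl⟩ := h
  refine ⟨g⁻¹, ?_⟩
  simp only [mul_assoc, ← WithZero.coe_mul, mul_inv_cancel, WithZero.coe_one, mul_one]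

theorem Proportional.trans {w p r : WithZero G × WithZero G} (h : Proportional w p) (h' : Proportional p r) :
    Proportional w r := by
  obtain ⟨g, rfl⟩ := h
  obtain ⟨g', rfl⟩ := h'
  exact ⟨g * g', by simp only [WithZero.coe_mul, mul_assoc]⟩

theorem Proportional.unique {w : WithZero G × WithZero G} (hw : w ≠ 0) {g g' : G}
    (h : ((w.1 * g, w.2 * g) : WithZero G × WithZero G) = (w.1 * g', w.2 * g')) : g = g' := by
  obtain ⟨h1, h2⟩ := Prod.ext_iff.1 h
  simp only at h1 h2
  by_cases h0 : w.1 = 0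
  · by_cases h0' : w.2 = 0
    · exact absurd (Prod.ext h0 h0') hw
    · exact WithZero.coe_inj.1 (mul_left_cancel₀ h0' h2)
  · exact WithZero.coe_inj.1 (mul_left_cancel₀ h0 h1)

/-- Operations on pairs of potentials that preserve compatibility. -/
def Good (T : WithZero G × WithZero G → WithZero G) : Prop :=
  T 0 = 0 ∧ ∀ (p : WithZero G × WithZero G) (g : G), T (p.1 * g, p.2 * g) = T p * g

theorem exists_good_single {w : WithZero G × WithZero G} (hw : w ≠ 0) :
    ∃ T : WithZero G × WithZero G → WithZero G, Good T ∧
      (∀ g : G, T (w.1 * g, w.2 * g) = g) ∧ ∀ p, ¬ Proportional w p → T p = 0 := by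
  classical
  let T : WithZero G × WithZero G → WithZero G := fun p =>
    if h : Proportional w p then (h.choose : WithZero G) else 0
  have h1 : ∀ g : G, T (w.1 * g, w.2 * g) = g := by
    intro g
    have h : Proportional w (w.1 * g, w.2 * g) := ⟨g, rfl⟩
    simp only [T, dif_pos h]
    exact congrArg _ (Proportional.unique hw h.choose_spec).symm
  have h2 : ∀ p, ¬ Proportional w p → T p = 0 := fun p hp => dif_neg hp
  refine ⟨T, ⟨h2 _ ?_, fun p g => ?_⟩, h1, h2⟩
  · rintro h
    obtain ⟨g, hg⟩ := h.symm
    apply hw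
    rw [hg]
    simp
  · by_cases hp : Proportional w p
    · obtain ⟨g', rfl⟩ := hp
      have h3 := h1 (g' * g)
      rw [WithZero.coe_mul, ← mul_assoc, ← mul_assoc] at h3
      rw [h1 g']
      exact h3
    · rw [h2 p hp, h2 _ (fun h => hp (h.trans (Proportional.symm ⟨g, rfl⟩))), zero_mul]

theorem exists_good_double {w w' : WithZero G × WithZero G} (hw : w ≠ 0) (hw' : w' ≠ 0)
    (hne : ¬ Proportional w w') : ∃ T : WithZero G × WithZero G → WithZero G, Good T ∧
      (∀ g : G, T (w.1 * g, w.2 * g) = g) ∧ (∀ g : G, T (w'.1 * g, w'.2 * g) = g) := by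
  classical
  obtain ⟨T, hT, h1, h2⟩ := exists_good_single hw
  obtain ⟨T', hT', h1', h2'⟩ := exists_good_single hw'
  refine ⟨fun p => if Proportional w p then T p else T' p, ⟨?_, fun p g => ?_⟩, fun g => ?_, fun g => ?_⟩
  · simp [hT.1, hT'.1]
  · have h3 : Proportional w (p.1 * g, p.2 * g) ↔ Proportional w p :=
      ⟨fun h => h.trans (Proportional.symm ⟨g, rfl⟩), fun h => h.trans ⟨g, rfl⟩⟩
    simp only [h3, hT.2, hT'.2]
    split_ifs <;> rfl
  · exact (if_pos ⟨g, rfl⟩).trans (h1 g)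
  · exact (if_neg fun h => hne (h.trans (Proportional.symm ⟨g, rfl⟩))).trans (h1' g)

theorem Proportional.inj {c d d' : WithZero G} {p : WithZero G × WithZero G} (hc : c ≠ 0)
    (h : Proportional (c, d) p) (h' : Proportional (c, d') p) : d = d' := by
  obtain ⟨g, rfl⟩ := h
  obtain ⟨g', h'⟩ := h'
  obtain ⟨h1, h2⟩ := Prod.ext_iff.1 h'
  simp only at h1 h2
  have h3 := mul_left_cancel₀ hc h1
  rw [h3] at h2
  exact mul_right_cancel₀ WithZero.coe_ne_zero h2

theorem Proportional.fst_ne_zero {w p : WithZero G × WithZero G} (h : Proportional w p) (hw : p.1 ≠ 0) :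
    w.1 ≠ 0 := by
  obtain ⟨g, rfl⟩ := h
  exact left_ne_zero_of_mul hw

theorem exists_good {a b a' b' c d d' : WithZero G} (ha : a ≠ a') (hd : d ≠ d')
    (_hb : b ≠ b') : ∃ T, Good T ∧ T (a, b) = T (a', b') ∧ T (c, d) ≠ T (c, d') := by
  have hww : ((c, d) : WithZero G × WithZero G) ≠ (c, d') := fun h => hd (Prod.ext_iff.1 h).2
  have single : ∀ w w' : WithZero G × WithZero G, w ≠ w' → w ≠ 0 → ¬ Proportional w (a, b) →
      ¬ Proportional w (a', b') → ∃ T, Good T ∧ T (a, b) = T (a', b') ∧ T w ≠ T w' := by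
    intro w w' hne hw h1 h2
    obtain ⟨T, hT, h3, h4⟩ := exists_good_single hw
    refine ⟨T, hT, by rw [h4 _ h1, h4 _ h2], fun h => ?_⟩
    have h5 : T w = 1 := by simpa using h3 1
    by_cases h6 : Proportional w w'
    · obtain ⟨g, hg⟩ := h6
      rw [hg, h3, h5] at h
      rw [← h] at hg
      apply hne
      simpa using hg.symm
    · rw [h5, h4 _ h6] at h
      exact one_ne_zero h
  by_cases hA : (c, d) ≠ (0 : WithZero G × WithZero G) ∧ ¬ Proportional (c, d) (a, b) ∧
      ¬ Proportional (c, d) (a', b')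
  · exact single _ _ hww hA.1 hA.2.1 hA.2.2
  by_cases hB : (c, d') ≠ (0 : WithZero G × WithZero G) ∧ ¬ Proportional (c, d') (a, b) ∧
      ¬ Proportional (c, d') (a', b')
  · obtain ⟨T, hT, h1, h2⟩ := single _ _ hww.symm hB.1 hB.2.1 hB.2.2
    exact ⟨T, hT, h1, h2.symm⟩
  have hA' : (c, d) = (0 : WithZero G × WithZero G) ∨ Proportional (c, d) (a, b) ∨
      Proportional (c, d) (a', b') := by tauto
  have hB' : (c, d') = (0 : WithZero G × WithZero G) ∨ Proportional (c, d') (a, b) ∨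
      Proportional (c, d') (a', b') := by tauto
  clear hA hB single
  -- a proportionality class that meets everything and has nonzero first entry is impossible
  have key : ∀ p : WithZero G × WithZero G, p.1 ≠ 0 →
      ((c, d) = (0 : WithZero G × WithZero G) ∨ Proportional (c, d) p) →
      ((c, d') = (0 : WithZero G × WithZero G) ∨ Proportional (c, d') p) → False := by
    intro p hp h1 h2
    have hc : c ≠ 0 := by
      rcases h1 with h1 | h1
      · rcases h2 with h2 | h2
        · exact absurd (h1.trans h2.symm) hww
        · exact h2.fst_ne_zero hp
      · exact h1.fst_ne_zero hp
    have h3 : Proportional (c, d) p := h1.resolve_left fun h => hc (Prod.ext_iff.1 h).1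
    have h4 : Proportional (c, d') p := h2.resolve_left fun h => hc (Prod.ext_iff.1 h).1
    exact hd (h3.inj hc h4)
  have hzero : ∀ w p : WithZero G × WithZero G, Proportional w p → p = 0 → w = 0 := by
    rintro w p h rfl
    obtain ⟨g, hg⟩ := h.symm
    rw [hg]
    simp
  have hU : (a, b) ≠ (0 : WithZero G × WithZero G) := by
    intro h
    have ha0 : a = 0 := (Prod.ext_iff.1 h).1
    refine key (a', b') (fun h' => ha (ha0.trans h'.symm)) ?_ ?_
    · rcases hA' with h1 | h1 | h1
      · exact Or.inl h1
      · exact Or.inl (hzero _ _ h1 h)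
      · exact Or.inr h1
    · rcases hB' with h1 | h1 | h1
      · exact Or.inl h1
      · exact Or.inl (hzero _ _ h1 h)
      · exact Or.inr h1
  have hV : (a', b') ≠ (0 : WithZero G × WithZero G) := by
    intro h
    have ha0 : a' = 0 := (Prod.ext_iff.1 h).1
    refine key (a, b) (fun h' => ha (Eq.trans h' ha0.symm)) ?_ ?_
    · rcases hA' with h1 | h1 | h1
      · exact Or.inl h1
      · exact Or.inr h1
      · exact Or.inl (hzero _ _ h1 h)
    · rcases hB' with h1 | h1 | h1
      · exact Or.inl h1
      · exact Or.inr h1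
      · exact Or.inl (hzero _ _ h1 h)
  have hUV : ¬ Proportional (a, b) (a', b') := by
    intro h
    have ha0 : a ≠ 0 := by
      intro h0
      obtain ⟨g, hg⟩ := h
      apply ha
      have h1 : a' = a * g := (Prod.ext_iff.1 hg).1
      rw [h1, h0, zero_mul]
    refine key (a, b) ha0 ?_ ?_
    · rcases hA' with h1 | h1 | h1
      · exact Or.inl h1
      · exact Or.inr h1
      · exact Or.inr (h1.trans h.symm)
    · rcases hB' with h1 | h1 | h1
      · exact Or.inl h1
      · exact Or.inr h1
      · exact Or.inr (h1.trans h.symm)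
  obtain ⟨T, hT, h1, h2⟩ := exists_good_double hU hV hUV
  refine ⟨T, hT, ?_, ?_⟩
  · have h3 := h1 1
    have h4 := h2 1
    simp only [WithZero.coe_one, mul_one] at h3 h4
    rw [h3, h4]
  · have hA'' : (c, d) = (0 : WithZero G × WithZero G) ∨ Proportional (a, b) (c, d) ∨
      Proportional (a', b') (c, d) := hA'.imp_right (Or.imp Proportional.symm Proportional.symm)
    have hB'' : (c, d') = (0 : WithZero G × WithZero G) ∨ Proportional (a, b) (c, d') ∨
      Proportional (a', b') (c, d') := hB'.imp_right (Or.imp Proportional.symm Proportional.symm)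
    intro h
    rcases hA'' with h3 | ⟨g, h3⟩ | ⟨g, h3⟩ <;> rcases hB'' with h4 | ⟨g', h4⟩ | ⟨g', h4⟩
    · exact hww (h3.trans h4.symm)
    · rw [h3, h4, hT.1, h1] at h
      exact WithZero.coe_ne_zero h.symm
    · rw [h3, h4, hT.1, h2] at h
      exact WithZero.coe_ne_zero h.symm
    · rw [h3, h4, hT.1, h1] at h
      exact WithZero.coe_ne_zero h
    · rw [h3, h4, h1, h1] at h
      exact hww (by rw [h3, h4, h])
    · rw [h3, h4, h1, h2] at h
      have h5 : a * g = a' * g' := (Prod.ext_iff.1 h3).1.symm.trans (Prod.ext_iff.1 h4).1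
      rw [← h] at h5
      exact ha (mul_right_cancel₀ WithZero.coe_ne_zero h5)
    · rw [h3, h4, hT.1, h2] at h
      exact WithZero.coe_ne_zero h
    · rw [h3, h4, h1, h2] at h
      have h5 : a' * g = a * g' := (Prod.ext_iff.1 h3).1.symm.trans (Prod.ext_iff.1 h4).1
      rw [← h] at h5
      exact ha (mul_right_cancel₀ WithZero.coe_ne_zero h5).symm
    · rw [h3, h4, h2, h2] at h
      exact hww (by rw [h3, h4, h])

/-- The partial `G`-partition with subset the complement of `i` and singleton blocks. -/
def PartialGPartition.joint (G : Type v) [Group G] (i : ι) : PartialGPartition ι G where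
  support := {i}ᶜ
  rel j l := j = l ∧ j ≠ i
  label _ := 1
  rel_refl _ h := ⟨rfl, h⟩
  rel_symm := by
    rintro j l ⟨rfl, h⟩
    exact ⟨rfl, h⟩
  rel_trans := by
    rintro j l m ⟨rfl, h⟩ ⟨rfl, -⟩
    exact ⟨rfl, h⟩
  mem_of_rel h := h.2

theorem PartialGPartition.joint_sat {i : ι} {y : ι → WithZero G} :
    (PartialGPartition.joint G i).Sat y ↔ y i = 0 := by
  constructor
  · exact fun h => h.1 i fun h' => h' rfl
  · intro h
    refine ⟨fun j hj => ?_, ?_⟩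
    · have : j = i := not_not.1 hj
      rw [this, h]
    · rintro j l ⟨rfl, -⟩
      simp [PartialGPartition.joint]

open Classical in
/-- The partial `G`-partition of the whole set with one block `{i, j}` labeled by `1` and `g`, all
other blocks being singletons. -/
def PartialGPartition.edge (i j : ι) (g : G) : PartialGPartition ι G where
  support := Set.univ
  rel l m := l = m ∨ (l = i ∧ m = j) ∨ (l = j ∧ m = i)
  label l := if l = j then g else 1
  rel_refl _ _ := Or.inl rfl
  rel_symm := by
    rintro l m (h | ⟨h, h'⟩ | ⟨h, h'⟩)
    · exact Or.inl h.symm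
    · exact Or.inr (Or.inr ⟨h', h⟩)
    · exact Or.inr (Or.inl ⟨h', h⟩)
  rel_trans := by
    rintro l m r (rfl | ⟨rfl, rfl⟩ | ⟨rfl, rfl⟩) (rfl | ⟨h, rfl⟩ | ⟨h, rfl⟩) <;> simp_all
  mem_of_rel _ := Set.mem_univ _

theorem PartialGPartition.edge_sat {i j : ι} (hij : i ≠ j) {g : G} {y : ι → WithZero G} :
    (PartialGPartition.edge i j g).Sat y ↔ y j = y i * g := by
  constructor
  · intro h
    have := h.2 i j (Or.inr (Or.inl ⟨rfl, rfl⟩))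
    simpa [PartialGPartition.edge, hij] using this
  · intro h
    refine ⟨fun l hl => absurd (Set.mem_univ _) hl, ?_⟩
    rintro l m (rfl | ⟨rfl, rfl⟩ | ⟨rfl, rfl⟩)
    · simp
    · simp [PartialGPartition.edge, hij, h]
    · simp [PartialGPartition.edge, hij, h]

theorem DowlingLattice.bot_sat (y : ι → WithZero G) : (⊥ : DowlingLattice ι G).Sat y := by
  refine DowlingLattice.sat_mk.2 ⟨fun l hl => absurd (Set.mem_univ _) hl, ?_⟩
  rintro i j rfl
  simp

theorem DowlingLattice.joint_ne_bot (i : ι) : mk (PartialGPartition.joint G i) ≠ ⊥ := by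
  intro h
  have h1 := DowlingLattice.bot_sat (G := G) (fun _ : ι => 1)
  rw [← h, DowlingLattice.sat_mk, PartialGPartition.joint_sat] at h1
  exact one_ne_zero h1

theorem DowlingLattice.edge_ne_bot {i j : ι} (hij : i ≠ j) (g : G) :
    mk (PartialGPartition.edge i j g) ≠ ⊥ := by
  classical
  intro h
  have h1 := DowlingLattice.bot_sat (G := G) (fun l : ι => if l = i then 1 else 0)
  rw [← h, DowlingLattice.sat_mk, PartialGPartition.edge_sat hij] at h1
  simp [hij.symm] at h1

/-- Every atom is one of the two evident kinds. -/
theorem DowlingPoint.cases (a : DowlingPoint ι G) :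
    (∃ i, a.1 = DowlingLattice.mk (PartialGPartition.joint G i)) ∨
      ∃ i j, i ≠ j ∧ ∃ g : G, a.1 = DowlingLattice.mk (PartialGPartition.edge i j g) := by
  obtain ⟨a, ha⟩ := a
  obtain ⟨p, rfl⟩ := a.exists_mk
  by_cases h : ∃ i, i ∉ p.support
  · obtain ⟨i, hi⟩ := h
    left
    refine ⟨i, ?_⟩
    have h1 : DowlingLattice.mk (PartialGPartition.joint G i) ≤ DowlingLattice.mk p := by
      rw [DowlingLattice.le_iff_sat]
      intro y hy
      rw [DowlingLattice.sat_mk] at hy ⊢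
      exact PartialGPartition.joint_sat.2 (hy.1 i hi)
    exact ((ha.le_iff.1 h1).resolve_left (DowlingLattice.joint_ne_bot i)).symm
  · push Not at h
    right
    by_cases h' : ∃ i j, i ≠ j ∧ p.rel i j
    · obtain ⟨i, j, hij, hr⟩ := h'
      refine ⟨i, j, hij, (p.label i)⁻¹ * p.label j, ?_⟩
      have h1 : DowlingLattice.mk (PartialGPartition.edge i j ((p.label i)⁻¹ * p.label j)) ≤
          DowlingLattice.mk p := by
        rw [DowlingLattice.le_iff_sat]
        intro y hy
        rw [DowlingLattice.sat_mk] at hy ⊢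
        exact (PartialGPartition.edge_sat hij).2 (hy.2 i j hr)
      exact ((ha.le_iff.1 h1).resolve_left (DowlingLattice.edge_ne_bot hij _)).symm
    · exfalso
      push Not at h'
      apply ha.1
      rw [← le_bot_iff, DowlingLattice.le_iff_sat]
      intro y _
      refine DowlingLattice.sat_mk.2 ⟨fun i hi => absurd (h i) hi, fun i j hij => ?_⟩
      by_cases hne : i = j
      · subst hne
        simp
      · exact absurd hij (h' i j hne)

/-- Compatibility with an atom is a single equation. -/
theorem DowlingPoint.exists_equation (a : DowlingPoint ι G) :
    ∃ u v : (ι → WithZero G) → WithZero G, (∀ y, a.1.Sat y ↔ u y = v y) ∧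
      ∀ T, Good T → ∀ x y, u (fun i => T (x i, y i)) = T (u x, u y) ∧
        v (fun i => T (x i, y i)) = T (v x, v y) := by
  rcases a.cases with ⟨i, h⟩ | ⟨i, j, hij, g, h⟩
  · refine ⟨fun y => y i, fun _ => 0, fun y => ?_, fun T hT x y => ⟨rfl, hT.1.symm⟩⟩
    rw [h, DowlingLattice.sat_mk, PartialGPartition.joint_sat]
  · refine ⟨fun y => y j, fun y => y i * g, fun y => ?_, fun T hT x y => ⟨rfl, ?_⟩⟩
    · rw [h, DowlingLattice.sat_mk, PartialGPartition.edge_sat hij]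
    · exact (hT.2 (x i, y i) g).symm

/-- The closure of a set of atoms: all atoms satisfied by the potentials compatible with the set. -/
def dowlingClosure (X : Set (DowlingPoint ι G)) : Set (DowlingPoint ι G) :=
  {a | ∀ y, (∀ b ∈ X, b.1.Sat y) → a.1.Sat y}

theorem dowlingClosure_exchange {X : Set (DowlingPoint ι G)} {e f : DowlingPoint ι G}
    (he : e ∉ dowlingClosure X) (hef : e ∈ dowlingClosure (insert f X)) :
    f ∈ dowlingClosure (insert e X) := by
  intro x hx
  by_contra hxf
  simp only [dowlingClosure, Set.mem_ofPred_eq, not_forall] at he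
  obtain ⟨y, hyX, hye⟩ := he
  have hxe : e.1.Sat x := hx e (Set.mem_insert _ _)
  have hxX : ∀ b ∈ X, b.1.Sat x := fun b hb => hx b (Set.mem_insert_of_mem _ hb)
  have hyf : ¬ f.1.Sat y := by
    intro h
    apply hye
    apply hef
    rintro b (rfl | hb)
    · exact h
    · exact hyX b hb
  obtain ⟨u, v, huv, huv'⟩ := e.exists_equation
  obtain ⟨u', w', huw, huw'⟩ := f.exists_equation
  rw [huv] at hxe hye
  rw [huw] at hxf hyf
  obtain ⟨T, hT, h1, h2⟩ := exists_good (c := u x) hxf hye hyf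
  have h3 : e.1.Sat (fun i => T (x i, y i)) := by
    apply hef
    rintro b (rfl | hb)
    · rw [huw, (huw' T hT x y).1, (huw' T hT x y).2, h1]
    · obtain ⟨s, t, hst, hst'⟩ := b.exists_equation
      rw [hst, (hst' T hT x y).1, (hst' T hT x y).2, (hst x).1 (hxX b hb), (hst y).1 (hyX b hb)]
  rw [huv, (huv' T hT x y).1, (huv' T hT x y).2, ← hxe] at h3
  exact h2 h3

/-- A closure operator with the exchange property is the closure operator of a matroid. -/
theorem exists_matroid_of_closure {α : Type*} [Finite α] (c : Set α → Set α)
    (hsub : ∀ X, X ⊆ c X) (hmono : ∀ X Y, X ⊆ Y → c X ⊆ c Y) (hidem : ∀ X, c (c X) ⊆ c X)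
    (hex : ∀ X e f, e ∉ c X → e ∈ c (insert f X) → f ∈ c (insert e X)) :
    ∃ M : Matroid α, M.E = Set.univ ∧ ∀ F, M.IsFlat F ↔ c F = F := by
  classical
  let Indep : Set α → Prop := fun I => ∀ e ∈ I, e ∉ c (I \ {e})
  have hcl : ∀ X Y, X ⊆ c Y → c X ⊆ c Y := fun X Y h => (hmono _ _ h).trans (hidem Y)
  have hsubset : ∀ ⦃I J : Set α⦄, Indep J → I ⊆ J → Indep I := fun I J hJ hIJ e he h =>
    hJ e (hIJ he) (hmono _ _ (Set.sdiff_subset_sdiff_left hIJ) h)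
  have hinsert : ∀ (I : Set α) (e : α), Indep I → e ∉ c I → Indep (insert e I) := by
    intro I e hI he x hx hxc
    have heI : e ∉ I := fun h => he (hsub I h)
    by_cases hxe : x = e
    · subst hxe
      rw [Set.insert_sdiff_self_of_notMem heI] at hxc
      exact he hxc
    · have hxI : x ∈ I := hx.resolve_left hxe
      have h1 : insert e I \ {x} = insert e (I \ {x}) :=
        Set.insert_sdiff_of_notMem _ (fun h : e = x => hxe h.symm)
      rw [h1] at hxc
      have h2 := hex _ _ _ (hI x hxI) hxc
      rw [Set.insert_sdiff_singleton, Set.insert_eq_of_mem hxI] at h2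
      exact he h2
  have hsteinitz : ∀ (n : ℕ) (I J : Set α), Indep J → J ⊆ c I → (J \ I).ncard = n →
      J.ncard ≤ I.ncard := by
    intro n
    induction n with
    | zero =>
      intro I J _ _ h
      rw [Set.ncard_eq_zero] at h
      exact Set.ncard_le_ncard (Set.sdiff_eq_empty.1 h)
    | succ n ih =>
      intro I J hJ hJI hn
      have hne : (J \ I).Nonempty := by
        rw [Set.nonempty_iff_ne_empty]
        intro h
        rw [h, Set.ncard_empty] at hn
        omega
      obtain ⟨x, hxJ, hxI⟩ := hne
      have h1 : ¬ I ⊆ c (J \ {x}) := fun h => hJ x hxJ (hcl _ _ h (hJI hxJ))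
      obtain ⟨y, hyI, hy⟩ := Set.not_subset.1 h1
      have hyJ : y ∉ J := by
        intro h
        apply hy
        apply hsub
        exact ⟨h, fun h' : y = x => hxI (h' ▸ hyI)⟩
      have h2 : Indep (insert y (J \ {x})) :=
        hinsert _ _ (hsubset hJ Set.sdiff_subset) hy
      have h3 := ih I (insert y (J \ {x})) h2
        (Set.insert_subset (hsub I hyI) (Set.sdiff_subset.trans hJI)) (by
        have : insert y (J \ {x}) \ I = (J \ I) \ {x} := by
          rw [Set.insert_sdiff_of_mem _ hyI, Set.sdiff_sdiff_comm]
        have h4 : ((J \ I) \ {x}).ncard + 1 = (J \ I).ncard :=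
          Set.ncard_sdiff_singleton_add_one ⟨hxJ, hxI⟩
        rw [this]
        omega)
      rw [Set.ncard_insert_of_notMem (fun h => hyJ h.1),
        Set.ncard_sdiff_singleton_add_one hxJ] at h3
      exact h3
  let M : Matroid α := (IndepMatroid.ofFinite (Set.toFinite Set.univ) Indep
    (fun e he => absurd he (Set.notMem_empty e)) hsubset (by
    intro I J hI hJ hlt
    by_contra h
    push Not at h
    have h1 : J ⊆ c I := by
      intro e he
      by_cases heI : e ∈ I
      · exact hsub I heI
      · by_contra hec
        exact h e he heI (hinsert I e hI hec)
    exact absurd (hsteinitz _ I J hJ h1 rfl) (by omega)) (fun I _ => Set.subset_univ I)).matroid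
  have hM : ∀ I, M.Indep I ↔ Indep I := fun I => Iff.rfl
  have hE : M.E = Set.univ := rfl
  have hcI : ∀ I, Indep I → M.closure I = c I := by
    intro I hI
    ext e
    rw [((hM I).2 hI).mem_closure_iff', hE, hM]
    constructor
    · rintro ⟨-, h⟩
      by_contra hec
      exact hec (hsub I (h (hinsert I e hI hec)))
    · intro he
      refine ⟨Set.mem_univ _, fun h => ?_⟩
      by_contra heI
      apply h e (Set.mem_insert _ _)
      rwa [Set.insert_sdiff_self_of_notMem heI]
  have hcX : ∀ X, M.closure X = c X := by
    intro X
    obtain ⟨I, hI⟩ := M.exists_isBasis X (Set.subset_univ X)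
    rw [← hI.closure_eq_closure, hcI I ((hM I).1 hI.indep)]
    apply Set.Subset.antisymm (hmono _ _ hI.subset)
    apply hcl
    rw [← hcI I ((hM I).1 hI.indep)]
    exact hI.subset_closure
  exact ⟨M, hE, fun F => by rw [Matroid.isFlat_iff_closure_eq, hcX]⟩

/-- There is exactly one matroid on the set of atoms whose flats are the sets of atoms below an
element of the lattice of partial `G`-partitions. -/
theorem existsUnique_dowlingGeometry (ι : Type u) (G : Type v) [Group G] [Finite ι] [Finite G] :
    ∃! M : Matroid (DowlingPoint ι G), M.E = Set.univ ∧
      ∀ F, M.IsFlat F ↔ ∃ p : DowlingLattice ι G, F = {a | a.1 ≤ p} := by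
  obtain ⟨M, hE, hM⟩ := exists_matroid_of_closure (dowlingClosure (ι := ι) (G := G))
    (fun X a ha y hy => hy a ha)
    (fun X Y h a ha y hy => ha y fun b hb => hy b (h hb))
    (fun X a ha y hy => ha y fun b hb => hb y hy)
    (fun X e f => dowlingClosure_exchange)
  have hF : ∀ F, M.IsFlat F ↔ ∃ p : DowlingLattice ι G, F = {a | a.1 ≤ p} := by
    intro F
    rw [hM]
    constructor
    · intro h
      obtain ⟨p, hp⟩ := exists_largest_sat {y : ι → WithZero G | ∀ b ∈ F, b.1.Sat y}
      refine ⟨DowlingLattice.mk p, ?_⟩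
      ext a
      rw [Set.mem_ofPred_eq, hp]
      conv_lhs => rw [← h]
      rfl
    · rintro ⟨p, rfl⟩
      apply Set.Subset.antisymm
      · intro a ha
        rw [Set.mem_ofPred_eq, DowlingLattice.le_iff_sat]
        exact fun y hy => ha y fun b hb => DowlingLattice.le_iff_sat.1 hb y hy
      · exact fun a ha y hy => hy a ha
  refine ⟨M, ⟨hE, hF⟩, ?_⟩
  rintro M' ⟨hE', hF'⟩
  apply Matroid.ext_closure
  intro X
  rw [Matroid.closure_def, Matroid.closure_def, hE, hE']
  simp only [hF, hF']

/-- The Dowling geometry: the matroid on the atoms of the lattice of partial `G`-partitions whose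
lattice of flats is the lattice of partial `G`-partitions. -/
def dowlingGeometry (ι : Type u) (G : Type v) [Group G] [Finite ι] [Finite G] :
    Matroid (DowlingPoint ι G) := (existsUnique_dowlingGeometry ι G).choose

theorem dowlingGeometry_spec [Finite ι] [Finite G] : (dowlingGeometry ι G).E = Set.univ ∧
    ∀ F, (dowlingGeometry ι G).IsFlat F ↔ ∃ p : DowlingLattice ι G, F = {a | a.1 ≤ p} :=
  (existsUnique_dowlingGeometry ι G).choose_spec.1

theorem dowlingGeometry_loopless [Finite ι] [Finite G] : (dowlingGeometry ι G).Loopless := by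
  rw [Matroid.loopless_iff, Matroid.loops, ← Matroid.isFlat_iff_closure_eq,
    dowlingGeometry_spec.2]
  refine ⟨⊥, ?_⟩
  ext a
  simp only [Set.mem_empty_iff_false, Set.mem_ofPred_eq, le_bot_iff, false_iff]
  exact a.2.1

/-! ### Symmetries of Dowling geometries -/

/-- The underlying set `G ^ ι × 𝔖_ι × Aut(G)` of the group `(G ≀ 𝔖_ι) ⋊ Aut(G)`. -/
@[ext]
structure DowlingSym (ι : Type u) (G : Type v) [Group G] where
  /-- the component in `G ^ ι` -/
  vec : ι → G
  /-- the component in `𝔖_ι` -/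
  perm : Equiv.Perm ι
  /-- the component in `Aut(G)` -/
  aut : MulAut G

namespace DowlingSym

instance : Mul (DowlingSym ι G) :=
  ⟨fun w w' => ⟨fun i => w.aut (w'.vec i) * w.vec (w'.perm i), w.perm * w'.perm, w.aut * w'.aut⟩⟩

instance : One (DowlingSym ι G) := ⟨⟨fun _ => 1, 1, 1⟩⟩

instance : Inv (DowlingSym ι G) :=
  ⟨fun w => ⟨fun i => w.aut⁻¹ (w.vec (w.perm⁻¹ i))⁻¹, w.perm⁻¹, w.aut⁻¹⟩⟩

theorem mul_vec (w w' : DowlingSym ι G) (i : ι) :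
    (w * w').vec i = w.aut (w'.vec i) * w.vec (w'.perm i) := rfl

theorem mul_perm (w w' : DowlingSym ι G) : (w * w').perm = w.perm * w'.perm := rfl

theorem mul_aut (w w' : DowlingSym ι G) : (w * w').aut = w.aut * w'.aut := rfl

theorem one_vec (i : ι) : (1 : DowlingSym ι G).vec i = 1 := rfl

theorem one_perm : (1 : DowlingSym ι G).perm = 1 := rfl

theorem one_aut : (1 : DowlingSym ι G).aut = 1 := rfl

theorem inv_vec (w : DowlingSym ι G) (i : ι) :
    w⁻¹.vec i = w.aut⁻¹ (w.vec (w.perm⁻¹ i))⁻¹ := rfl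

theorem inv_perm (w : DowlingSym ι G) : w⁻¹.perm = w.perm⁻¹ := rfl

theorem inv_aut (w : DowlingSym ι G) : w⁻¹.aut = w.aut⁻¹ := rfl

/-- The group `(G ≀ 𝔖_ι) ⋊ Aut(G)`. -/
instance : Group (DowlingSym ι G) :=
  Group.ofLeftAxioms
    (fun a b c => by
      refine DowlingSym.ext ?_ (mul_assoc _ _ _) (mul_assoc _ _ _)
      funext i
      simp [mul_vec, mul_aut, mul_perm, mul_assoc])
    (fun a => by
      refine DowlingSym.ext ?_ (one_mul _) (one_mul _)
      funext i
      simp [mul_vec, one_vec, one_aut])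
    (fun a => by
      refine DowlingSym.ext ?_ (inv_mul_cancel _) (inv_mul_cancel _)
      funext i
      simp [mul_vec, inv_vec, one_vec, inv_aut])

/-- The action on functions to `G`. -/
def actFun (w : DowlingSym ι G) (f : ι → G) : ι → G :=
  fun i => w.aut (f (w.perm⁻¹ i)) * w.vec (w.perm⁻¹ i)

theorem actFun_one (f : ι → G) : (1 : DowlingSym ι G).actFun f = f := by
  funext i
  simp [actFun, one_vec, one_aut, one_perm]

theorem actFun_mul (w w' : DowlingSym ι G) (f : ι → G) :
    (w * w').actFun f = w.actFun (w'.actFun f) := by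
  funext i
  simp [actFun, mul_vec, mul_aut, mul_perm, mul_assoc]

/-- The action on partial `G`-partitions. -/
def actPartition (w : DowlingSym ι G) (p : PartialGPartition ι G) : PartialGPartition ι G where
  support := {i | w.perm⁻¹ i ∈ p.support}
  rel i j := p.rel (w.perm⁻¹ i) (w.perm⁻¹ j)
  label := w.actFun p.label
  rel_refl i hi := p.rel_refl _ hi
  rel_symm h := p.rel_symm h
  rel_trans h h' := p.rel_trans h h'
  mem_of_rel h := p.mem_of_rel h

theorem actPartition_refines (w : DowlingSym ι G) {p q : PartialGPartition ι G}
    (h : p.Refines q) : (w.actPartition p).Refines (w.actPartition q) := by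
  refine ⟨fun i hi => h.1 hi, fun i hi => ?_⟩
  obtain ⟨g, hg⟩ := h.2 _ hi
  refine ⟨w.aut g, fun j hj => ⟨(hg _ hj).1, ?_⟩⟩
  change w.aut _ * _ = _ * (w.aut _ * _)
  rw [(hg _ hj).2, map_mul, mul_assoc]

instance : SMul (DowlingSym ι G) (DowlingLattice ι G) where
  smul w := Quotient.lift (fun p => DowlingLattice.mk (w.actPartition p)) (by
    intro p q h
    have h' := PartialGPartition.equivalent_iff.1 h
    exact le_antisymm (DowlingLattice.mk_le_mk.2 (w.actPartition_refines h'.1))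
      (DowlingLattice.mk_le_mk.2 (w.actPartition_refines h'.2)))

theorem smul_mk (w : DowlingSym ι G) (p : PartialGPartition ι G) :
    w • DowlingLattice.mk p = DowlingLattice.mk (w.actPartition p) := rfl

/-- The action on equivalence classes of partial `G`-partitions. -/
instance : MulAction (DowlingSym ι G) (DowlingLattice ι G) where
  one_smul a := by
    obtain ⟨p, rfl⟩ := a.exists_mk
    rw [smul_mk]
    congr 1
    simp only [actPartition, actFun_one]
    rfl
  mul_smul w w' a := by
    obtain ⟨p, rfl⟩ := a.exists_mk
    rw [smul_mk, smul_mk, smul_mk]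
    congr 1
    simp only [actPartition, actFun_mul]
    rfl

theorem smul_mono (w : DowlingSym ι G) {a b : DowlingLattice ι G} (h : a ≤ b) :
    w • a ≤ w • b := by
  obtain ⟨p, rfl⟩ := a.exists_mk
  obtain ⟨q, rfl⟩ := b.exists_mk
  exact w.actPartition_refines h

theorem smul_le_iff (w : DowlingSym ι G) {a b : DowlingLattice ι G} :
    w • a ≤ w • b ↔ a ≤ b := by
  refine ⟨fun h => ?_, w.smul_mono⟩
  have := w⁻¹.smul_mono h
  rwa [inv_smul_smul, inv_smul_smul] at this

/-- The order automorphism given by a symmetry. -/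
def orderIso (w : DowlingSym ι G) : DowlingLattice ι G ≃o DowlingLattice ι G where
  toEquiv := MulAction.toPerm w
  map_rel_iff' := w.smul_le_iff

/-- The action on the elements of the Dowling geometry. -/
instance : MulAction (DowlingSym ι G) (DowlingPoint ι G) where
  smul w a := ⟨w • a.1, (w.orderIso.isAtom_iff a.1).2 a.2⟩
  one_smul a := Subtype.ext (one_smul _ a.1)
  mul_smul w w' a := Subtype.ext (mul_smul w w' a.1)

theorem coe_smul (w : DowlingSym ι G) (a : DowlingPoint ι G) : (w • a).1 = w • a.1 := rfl

end DowlingSym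

/-- The automorphism group of a matroid: the permutations that send flats to flats in both
directions. -/
def matroidAut {α : Type*} (M : Matroid α) : Subgroup (Equiv.Perm α) where
  carrier := {π | ∀ F, M.IsFlat F ↔ M.IsFlat (π '' F)}
  one_mem' F := by simp
  mul_mem' {π τ} hπ hτ F := by
    rw [hτ F, hπ (τ '' F), Set.image_image]
    rfl
  inv_mem' {π} hπ F := by
    have h : π '' ((π⁻¹ : Equiv.Perm α) '' F) = F := by
      rw [Set.image_image]
      simp
    change _ ↔ M.IsFlat ((π⁻¹ : Equiv.Perm α) '' F)
    rw [hπ ((π⁻¹ : Equiv.Perm α) '' F), h]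

theorem isFlat_smul_iff [Finite ι] [Finite G] (w : DowlingSym ι G) (F : Set (DowlingPoint ι G)) :
    (dowlingGeometry ι G).IsFlat F ↔ (dowlingGeometry ι G).IsFlat (w • F) := by
  have key : ∀ (w : DowlingSym ι G) (F : Set (DowlingPoint ι G)),
      (dowlingGeometry ι G).IsFlat F → (dowlingGeometry ι G).IsFlat (w • F) := by
    intro w F hF
    rw [dowlingGeometry_spec.2] at hF ⊢
    obtain ⟨p, rfl⟩ := hF
    refine ⟨w • p, ?_⟩
    ext a
    rw [Set.mem_smul_set_iff_inv_smul_mem, Set.mem_ofPred_eq, Set.mem_ofPred_eq,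
      ← w.smul_le_iff, DowlingSym.coe_smul, smul_inv_smul]
  refine ⟨key w F, fun h => ?_⟩
  have := key w⁻¹ _ h
  rwa [inv_smul_smul] at this

/-- The homomorphism from `(G ≀ 𝔖_ι) ⋊ Aut(G)` to the automorphism group of the Dowling
geometry. -/
def dowlingSymHom (ι : Type u) (G : Type v) [Group G] [Finite ι] [Finite G] :
    DowlingSym ι G →* matroidAut (dowlingGeometry ι G) :=
  (MulAction.toPermHom (DowlingSym ι G) (DowlingPoint ι G)).codRestrict _ fun w F =>
    isFlat_smul_iff w F

/-- The group of automorphisms of the Dowling geometry generated by the permutations of `ι`, the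
right action of `G ^ ι` and the action of `Aut(G)`, that is, the image of `(G ≀ 𝔖_ι) ⋊ Aut(G)`. -/
def dowlingGamma (ι : Type u) (G : Type v) [Group G] [Finite ι] [Finite G] :
    Subgroup (matroidAut (dowlingGeometry ι G)) := (dowlingSymHom ι G).range

instance [Finite ι] [Finite G] : MulAction (dowlingGamma ι G) (DowlingPoint ι G) :=
  MulAction.compHom _ ((matroidAut (dowlingGeometry ι G)).subtype.comp (dowlingGamma ι G).subtype)

/-- The action of `Γ` on the Dowling geometry. -/
def dowlingAction (ι : Type u) (G : Type v) [Group G] [Finite ι] [Finite G] :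
    MatroidAction.{max u v, max u v} (DowlingPoint ι G) where
  H := dowlingGamma ι G
  M := dowlingGeometry ι G
  loopless := dowlingGeometry_loopless
  smul_isFlat h F hF := (h.1.2 F).1 hF

/-! ### Group-labeled matroids -/

section Labeled

variable (ι G)

/-- Matroids with ground set `ι`. -/
abbrev MatroidOn (ι : Type u) : Type u := {M : Matroid ι // M.E = Set.univ}

instance [Finite ι] : Finite (MatroidOn ι) := by
  refine Finite.of_injective (fun M : MatroidOn ι => {I | M.1.Indep I}) ?_
  intro M N h
  refine Subtype.ext (Matroid.ext_indep (M.2.trans N.2.symm) fun I _ => ?_)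
  exact Set.ext_iff.1 h I

/-- Two `G`-labelings of the same matroid are equivalent if on each connected component they differ
by left multiplication by an element of `G`. -/
def labelingSetoid : Setoid (MatroidOn ι × (ι → G)) where
  r x y := x.1 = y.1 ∧ ∀ C, IsComponent x.1.1 C → ∃ g : G, ∀ i ∈ C, x.2 i = g * y.2 i
  iseqv :=
    { refl := fun x => ⟨rfl, fun _ _ => ⟨1, fun _ _ => (one_mul _).symm⟩⟩
      symm := by
        rintro ⟨M, f⟩ ⟨N, f'⟩ ⟨h, h'⟩
        refine ⟨h.symm, fun C hC => ?_⟩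
        obtain ⟨g, hg⟩ := h' C (by rwa [h])
        exact ⟨g⁻¹, fun i hi => eq_inv_mul_of_mul_eq (hg i hi).symm⟩
      trans := by
        rintro ⟨M, f⟩ ⟨N, f'⟩ ⟨L, f''⟩ ⟨h1, h2⟩ ⟨h3, h4⟩
        refine ⟨h1.trans h3, fun C hC => ?_⟩
        obtain ⟨g, hg⟩ := h2 C hC
        obtain ⟨g', hg'⟩ := h4 C (by rwa [← h1])
        exact ⟨g * g', fun i hi => by
          rw [hg i hi, mul_assoc]
          exact congrArg _ (hg' i hi)⟩ }

/-- Equivalence classes of `G`-labeled matroids on `ι`. -/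
def LabeledMatroid : Type (max u v) := Quotient (labelingSetoid ι G)

instance [Finite ι] [Finite G] : Finite (LabeledMatroid ι G) :=
  inferInstanceAs (Finite (Quotient (labelingSetoid ι G)))

variable {ι G}

namespace LabeledMatroid

/-- The equivalence class of a labeled matroid. -/
def mk (M : MatroidOn ι) (f : ι → G) : LabeledMatroid ι G := Quotient.mk (labelingSetoid ι G) (M, f)

theorem exists_mk (x : LabeledMatroid ι G) : ∃ M f, mk M f = x := by
  obtain ⟨⟨M, f⟩, h⟩ := Quotient.exists_rep x
  exact ⟨M, f, h⟩

theorem mk_eq_mk {M : MatroidOn ι} {f f' : ι → G}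
    (h : ∀ C, IsComponent M.1 C → ∃ g : G, ∀ i ∈ C, f i = g * f' i) : mk M f = mk M f' :=
  Quotient.sound ⟨rfl, h⟩

/-- The underlying matroid. -/
def matroid (x : LabeledMatroid ι G) : Matroid ι :=
  Quotient.lift (fun y : MatroidOn ι × (ι → G) => y.1.1) (fun y z (h : y.1 = z.1 ∧ _) => congrArg Subtype.val h.1) x

theorem matroid_mk (M : MatroidOn ι) (f : ι → G) : (mk M f).matroid = M.1 := rfl

end LabeledMatroid

/-- Permutations of `ι` act on matroids on `ι`. -/
def MatroidOn.map (σ : Equiv.Perm ι) (M : MatroidOn ι) : MatroidOn ι :=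
  ⟨M.1.mapEquiv σ, by rw [Matroid.mapEquiv_ground_eq, M.2, Set.image_univ, σ.range_eq_univ]⟩

instance : SMul (DowlingSym ι G) (LabeledMatroid ι G) where
  smul w := Quotient.lift (fun x => LabeledMatroid.mk (x.1.map w.perm) (w.actFun x.2)) (by
    rintro ⟨M, f⟩ ⟨N, f'⟩ ⟨h, h'⟩
    obtain rfl : M = N := h
    refine LabeledMatroid.mk_eq_mk fun C hC => ?_
    obtain ⟨g, hg⟩ := h' _ ((mapEquiv_isComponent _ _).1 hC)
    refine ⟨w.aut g, fun i hi => ?_⟩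
    have h1 : f (w.perm⁻¹ i) = g * f' (w.perm⁻¹ i) := hg _ (Set.mem_image_of_mem _ hi)
    simp only [DowlingSym.actFun]
    rw [h1, map_mul, mul_assoc])

theorem LabeledMatroid.smul_mk (w : DowlingSym ι G) (M : MatroidOn ι) (f : ι → G) :
    w • LabeledMatroid.mk M f = LabeledMatroid.mk (M.map w.perm) (w.actFun f) := rfl

/-- The action of `(G ≀ 𝔖_ι) ⋊ Aut(G)` on equivalence classes of `G`-labeled matroids. -/
instance : MulAction (DowlingSym ι G) (LabeledMatroid ι G) where
  one_smul x := by
    obtain ⟨M, f, rfl⟩ := x.exists_mk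
    rw [LabeledMatroid.smul_mk, DowlingSym.actFun_one]
    congr 1
    exact Subtype.ext mapEquiv_one
  mul_smul w w' x := by
    obtain ⟨M, f, rfl⟩ := x.exists_mk
    rw [LabeledMatroid.smul_mk, DowlingSym.actFun_mul, LabeledMatroid.smul_mk,
      LabeledMatroid.smul_mk]
    congr 1
    exact Subtype.ext (mapEquiv_mul _ _)

theorem PartialGPartition.mk_eq_bot {p : PartialGPartition ι G} (h : ∀ i, i ∈ p.support)
    (h' : ∀ i j, p.rel i j → i = j) : DowlingLattice.mk p = ⊥ := by
  rw [← le_bot_iff, DowlingLattice.le_iff_sat]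
  intro y _
  refine DowlingLattice.sat_mk.2 ⟨fun i hi => absurd (h i) hi, fun i j hij => ?_⟩
  obtain rfl := h' i j hij
  simp

theorem PartialGPartition.isAtom_joint (i : ι) :
    IsAtom (DowlingLattice.mk (PartialGPartition.joint G i)) := by
  refine ⟨DowlingLattice.joint_ne_bot i, fun b hb => ?_⟩
  obtain ⟨p, rfl⟩ := b.exists_mk
  have h : p.Refines (PartialGPartition.joint G i) := hb.le
  by_cases hi : i ∈ p.support
  · apply PartialGPartition.mk_eq_bot
    · intro j
      by_cases hj : j = i
      · rwa [hj]
      · exact h.1 hj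
    · intro j l hjl
      by_cases hj : j = i
      · by_cases hl : l = i
        · rw [hj, hl]
        · obtain ⟨g, hg⟩ := h.2 l hl
          exact (hg j (p.rel_symm hjl)).1.1.symm
      · obtain ⟨g, hg⟩ := h.2 j hj
        exact (hg l hjl).1.1
  · exfalso
    refine hb.not_ge ?_
    rw [DowlingLattice.le_iff_sat]
    intro y hy
    rw [DowlingLattice.sat_mk] at hy ⊢
    exact PartialGPartition.joint_sat.2 (hy.1 i hi)

theorem PartialGPartition.isAtom_edge {i j : ι} (hij : i ≠ j) (g : G) :
    IsAtom (DowlingLattice.mk (PartialGPartition.edge i j g)) := by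
  refine ⟨DowlingLattice.edge_ne_bot hij g, fun b hb => ?_⟩
  obtain ⟨p, rfl⟩ := b.exists_mk
  have h : p.Refines (PartialGPartition.edge i j g) := hb.le
  by_cases hr : p.rel i j
  · exfalso
    refine hb.not_ge ?_
    rw [DowlingLattice.le_iff_sat]
    intro y hy
    rw [DowlingLattice.sat_mk] at hy ⊢
    rw [PartialGPartition.edge_sat hij, hy.2 i j hr]
    obtain ⟨c, hc⟩ := h.2 i (Set.mem_univ _)
    have h1 := (hc i (p.rel_refl i (p.mem_of_rel hr))).2
    have h2 := (hc j hr).2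
    simp only [PartialGPartition.edge, hij, if_true, if_false, mul_one] at h1 h2
    rw [h1, h2, inv_mul_cancel_left]
  · apply PartialGPartition.mk_eq_bot
    · exact fun l => h.1 (Set.mem_univ _)
    · intro l m hlm
      obtain ⟨c, hc⟩ := h.2 l (Set.mem_univ _)
      rcases (hc m hlm).1 with h1 | ⟨rfl, rfl⟩ | ⟨rfl, rfl⟩
      · exact h1
      · exact absurd hlm hr
      · exact absurd (p.rel_symm hlm) hr

/-- A symmetry that fixes all elements of the Dowling geometry fixes all equivalence classes of
`G`-labeled matroids. -/
theorem LabeledMatroid.smul_eq_self {w : DowlingSym ι G}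
    (hw : ∀ a : DowlingPoint ι G, w • a = a) (x : LabeledMatroid ι G) : w • x = x := by
  have hp : w.perm = 1 := by
    ext i
    have h := congrArg Subtype.val (hw ⟨_, PartialGPartition.isAtom_joint i⟩)
    have h1 : (w.actPartition (PartialGPartition.joint G i)).Equivalent
      (PartialGPartition.joint G i) := Quotient.exact h
    by_contra hne
    have h2 : w.perm i ∈ (PartialGPartition.joint G i).support := hne
    rw [← h1.1] at h2
    have h3 : w.perm⁻¹ (w.perm i) ∈ (PartialGPartition.joint G i).support := h2
    rw [show w.perm⁻¹ (w.perm i) = i from w.perm.symm_apply_apply i] at h3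
    exact h3 rfl
  have hg : ∀ i j, i ≠ j → ∀ a, w.aut a * w.vec j = w.vec i * a := by
    intro i j hij a
    have h := congrArg Subtype.val (hw ⟨_, PartialGPartition.isAtom_edge hij a⟩)
    have h1 : (w.actPartition (PartialGPartition.edge i j a)).Equivalent
      (PartialGPartition.edge i j a) := Quotient.exact h
    obtain ⟨c, hc⟩ := h1.2.2 i (Set.mem_univ _)
    have h2 := hc i (by
      simp [DowlingSym.actPartition, hp, PartialGPartition.edge])
    have h3 := hc j (by
      simp [DowlingSym.actPartition, hp, PartialGPartition.edge])
    simp [DowlingSym.actPartition, DowlingSym.actFun, hp, PartialGPartition.edge, hij] at h2 h3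
    rw [h3, h2]
  obtain ⟨M, f, rfl⟩ := x.exists_mk
  have hM : M.map w.perm = M := by
    rw [hp]
    exact Subtype.ext mapEquiv_one
  rw [LabeledMatroid.smul_mk, hM]
  refine LabeledMatroid.mk_eq_mk ?_
  rintro C ⟨e, -, rfl⟩
  refine ⟨w.aut (f e) * w.vec e * (f e)⁻¹, fun i _ => ?_⟩
  simp only [DowlingSym.actFun, hp, inv_one, Equiv.Perm.one_apply]
  by_cases hi : i = e
  · rw [hi, inv_mul_cancel_right]
  · have h1 := hg i e hi 1
    rw [map_one, one_mul, mul_one] at h1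
    rw [hg i e hi (f e), mul_inv_cancel_right, ← hg i e hi (f i), h1]

variable [Finite ι] [Finite G]

theorem LabeledMatroid.smul_congr {w w' : DowlingSym ι G}
    (h : dowlingSymHom ι G w = dowlingSymHom ι G w') (x : LabeledMatroid ι G) :
    w • x = w' • x := by
  have h1 : ∀ a : DowlingPoint ι G, w • a = w' • a := fun a =>
    Equiv.congr_fun (congrArg Subtype.val h) a
  have h2 := LabeledMatroid.smul_eq_self (w := w'⁻¹ * w)
    (fun a => by rw [mul_smul, h1, inv_smul_smul]) x
  rw [mul_smul] at h2
  exact inv_smul_eq_iff.1 h2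

instance : SMul (dowlingGamma ι G) (LabeledMatroid ι G) where
  smul γ x := γ.2.choose • x

/-- The action of `Γ` on equivalence classes of `G`-labeled matroids is the one through which the
action of `(G ≀ 𝔖_ι) ⋊ Aut(G)` factors. -/
theorem LabeledMatroid.gamma_smul (γ : dowlingGamma ι G) (w : DowlingSym ι G)
    (h : dowlingSymHom ι G w = γ.1) (x : LabeledMatroid ι G) : γ • x = w • x :=
  LabeledMatroid.smul_congr (γ.2.choose_spec.trans h.symm) x

instance : MulAction (dowlingGamma ι G) (LabeledMatroid ι G) where
  one_smul x := by
    rw [LabeledMatroid.gamma_smul 1 1 (map_one _), one_smul]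
  mul_smul γ γ' x := by
    obtain ⟨w, hw⟩ := γ.2
    obtain ⟨w', hw'⟩ := γ'.2
    rw [LabeledMatroid.gamma_smul (γ * γ') (w * w') (by rw [map_mul, hw, hw']; rfl),
      LabeledMatroid.gamma_smul γ' w' hw', LabeledMatroid.gamma_smul γ w hw, mul_smul]

theorem LabeledMatroid.exists_matroid_smul (γ : dowlingGamma ι G) (x : LabeledMatroid ι G) :
    ∃ σ : Equiv.Perm ι, (γ • x).matroid = x.matroid.mapEquiv σ := by
  obtain ⟨w, hw⟩ := γ.2
  obtain ⟨M, f, rfl⟩ := x.exists_mk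
  exact ⟨w.perm, by rw [LabeledMatroid.gamma_smul γ w hw]; rfl⟩

variable (ι G)

/-- The set, with its action of `Γ`, of equivalence classes of `G`-labeled quasi series-parallel
matroids on `ι` of rank `r`. -/
def labeledQSP (r : ℤ) : SubMulAction (dowlingGamma ι G) (LabeledMatroid ι G) where
  carrier := {x | IsQuasiSeriesParallel x.matroid ∧ (rank x.matroid : ℤ) = r}
  smul_mem' γ x hx := by
    obtain ⟨σ, hσ⟩ := LabeledMatroid.exists_matroid_smul γ x
    rw [Set.mem_ofPred_eq, hσ, rank_mapEquiv]
    exact ⟨hx.1.mapEquiv σ, hx.2⟩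

/-- The set, with its action of `Γ`, of equivalence classes of `G`-labeled simple quasi
series-parallel matroids on `ι` of rank `r`. -/
def labeledSimpleQSP (r : ℤ) : SubMulAction (dowlingGamma ι G) (LabeledMatroid ι G) where
  carrier := {x | IsSimple x.matroid ∧ IsQuasiSeriesParallel x.matroid ∧
    (rank x.matroid : ℤ) = r}
  smul_mem' γ x hx := by
    obtain ⟨σ, hσ⟩ := LabeledMatroid.exists_matroid_smul γ x
    rw [Set.mem_ofPred_eq, hσ, rank_mapEquiv]
    exact ⟨hx.1.mapEquiv σ, hx.2.1.mapEquiv σ, hx.2.2⟩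

end Labeled

end Dowling

section PermutationRepresentation

/-- The class of the permutation representation on a finite set with an action of a group. -/
def VRep.perm (k : Type*) [Field k] (H : Type*) [Group H] (X : Type*) [MulAction H X] [Finite X] :
    VRep k H := VRep.of (Representation.ofMulAction k H X)

end PermutationRepresentation

end

end DowlingKL

/-! A labeled matroid `x` determines an element `x.flat` of the Dowling lattice: its support is the
set of nonloops, its blocks are the parallel classes, and its function is the labeling (well defined
up to equivalence because parallel elements lie in one component). For `a` in the lattice,
`exactQSPSet a r` and `aboveQSPSet a r` collect the classes of labeled quasi series-parallel
matroids of rank `r` whose flat is `a`, respectively at least `a`. What is proved is a statement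
about every contraction: if the contraction of the Dowling geometry by the flat of `a` has rank `d`,
these two sets with `r = d - i` give the coefficients of `t^i` in its Kazhdan–Lusztig polynomial and
its `Z`-polynomial. For `a = ⊥` a matroid has flat `⊥` exactly when it is simple
(`LabeledMatroid.flat_eq_bot_iff`), and this is the theorem.

By uniqueness of the recursion (`eq_of_reflection`) three facts suffice. Recursion: the matroids
above `a` are sorted by their exact flat `b`. Passing from `a` to `b` lowers the rank of the
contraction by the rank of the corresponding flat, which is exactly the power of `t` in the
definition of `Z`; so the matroid rank `r` is the same in all terms. Palindromy: a matroid with flat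
at least `a` amounts to a matroid on the set of blocks of `a`, blown up by parallel elements and
loops (`le_flat_iff`, `PartialGPartition.exists_compatible`). There are `d` blocks
(`PartialGPartition.rank_contract_below`), so dualizing on the blocks exchanges rank `r` and `d - r`
(`exists_duality_equiv`). Labels survive because a matroid and its dual have the same components,
and quasi series-parallel matroids are closed under duality and minors and under adding loops and
parallel elements. All this is read off from the description by reductions,
`isQuasiSeriesParallel_iff`. Degree bound: if the flat is exactly `a`, the matroid on the blocks is
simple, and a nonempty simple quasi series-parallel matroid has fewer elements than twice its rank
(`IsSPReducible.ncard_lt_two_mul_rank`). With `r = d - i` this says `2 * i < d`.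

Equivariantly, all these bijections commute with the symmetries fixing `a`. The matroids strictly
above `a` form a permutation representation which is the sum, over orbits of flats, of
representations induced from stabilizers (`VRep.perm_eq_sum_ind`). Numerically, a matroid on `n`
elements with `c` components has `q ^ (n - c)` classes of labelings (`card_labelings`).

For Bonin's theorem, joints are told apart from the other points by lines: every line with at least
three points through a joint has at least four, while some line through any other point has exactly
three. So an automorphism permutes the joints, hence acts on the edges `i j` by maps `φ i j` of `G`;
three-point lines force `φ i l (g * h) = φ i j g * φ j l h`, and such a family is a twisted
automorphism of `G` (`exists_mulAut_of_family`). -/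

namespace DowlingKL

/-! ### Permutation representations: disjoint unions and induction. -/

section PermutationRepresentations

variable {k : Type*} [Field k] {H : Type*} [Group H]

/-- A representation with a basis permuted by the group is a permutation representation. -/
theorem VRep.of_eq_perm {V X : Type*} [AddCommGroup V] [Module k V] [Module.Finite k V]
    [MulAction H X] [Finite X] (ρ : Representation k H V) (b : Module.Basis X k V)
    (hb : ∀ h x, ρ h (b x) = b (h • x)) : VRep.of ρ = VRep.perm k H X := by
  refine VRep.of_congr (.mk (b.repr.trans (MonoidAlgebra.coeffLinearEquiv k).symm) fun g => ?_)
  refine b.ext fun x => ?_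
  have h1 : ∀ y, (b.repr.trans (MonoidAlgebra.coeffLinearEquiv k).symm) (b y) =
      MonoidAlgebra.single y 1 := by
    intro y
    simp
  change (b.repr.trans (MonoidAlgebra.coeffLinearEquiv k).symm) (ρ g (b x)) =
    Representation.ofMulAction k H X g ((b.repr.trans (MonoidAlgebra.coeffLinearEquiv k).symm) (b x))
  rw [hb, h1, h1, Representation.ofMulAction_single]

/-- The standard basis of a permutation representation. -/
noncomputable def permBasis (k : Type*) [Field k] (X : Type*) :
    Module.Basis X k (MonoidAlgebra k X) :=
  Module.Basis.ofRepr (MonoidAlgebra.coeffLinearEquiv k)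

theorem permBasis_apply (X : Type*) (x : X) :
    permBasis k X x = MonoidAlgebra.single x 1 := rfl

theorem VRep.perm_congr {X Y : Type*} [MulAction H X] [Finite X] [MulAction H Y] [Finite Y]
    (e : X ≃ Y) (he : ∀ (h : H) x, e (h • x) = h • e x) : VRep.perm k H X = VRep.perm k H Y := by
  refine VRep.of_eq_perm _ ((permBasis k X).reindex e) fun h y => ?_
  obtain ⟨x, rfl⟩ := e.surjective y
  simp [permBasis_apply, ← he]

theorem VRep.perm_eq_add {X Y Z : Type*} [MulAction H X] [Finite X] [MulAction H Y] [Finite Y]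
    [MulAction H Z] [Finite Z] (e : X ⊕ Y ≃ Z) (hl : ∀ (h : H) x, e (.inl (h • x)) = h • e (.inl x))
    (hr : ∀ (h : H) y, e (.inr (h • y)) = h • e (.inr y)) :
    VRep.perm k H Z = VRep.perm k H X + VRep.perm k H Y := by
  rw [VRep.perm.eq_1 k H X, VRep.perm.eq_1 k H Y, ← VRep.of_eq_add (τ := (Representation.ofMulAction k H X).prod
    (Representation.ofMulAction k H Y)) (Representation.Equiv.refl _)]
  refine (VRep.of_eq_perm _ (((permBasis k X).prod (permBasis k Y)).reindex e) fun h z => ?_).symm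
  obtain ⟨x | x, rfl⟩ := e.surjective z
  · rw [← hl]
    simp [permBasis_apply]
  · rw [← hr]
    simp [permBasis_apply]

/-- An empty set is the disjoint union of two copies of itself, so its class equals its own double.
-/
theorem VRep.perm_of_isEmpty (X : Type*) [MulAction H X] [IsEmpty X] :
    VRep.perm k H X = 0 := by
  have h := VRep.perm_eq_add (k := k) (H := H) (X := X) (Y := X) (Z := X) (Equiv.equivOfIsEmpty _ _)
    (fun _ x => isEmptyElim x) (fun _ x => isEmptyElim x)
  exact left_eq_add.1 h

theorem VRep.perm_of_unique (X : Type*) [MulAction H X] [Unique X] :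
    VRep.perm k H X = VRep.triv k H := by
  refine (VRep.of_eq_perm _ (Module.Basis.singleton X k) fun h x => ?_).symm
  simp

/-- The induced module consists of the coinvariants of `k[H] ⊗ V` under the diagonal action of `K`;
this is the defining relation on pure tensors. -/
theorem IndV_mk_smul {K : Type*} [Group K] (φ : K →* H) {V : Type*} [AddCommGroup V] [Module k V]
    (ρ : Representation k K V) (g : K) (h : H) (v : V) :
    Representation.IndV.mk φ ρ (φ g * h) (ρ g v) = Representation.IndV.mk φ ρ h v := by
  have := Representation.Coinvariants.mk_self_apply
    (Representation.tprod ((Representation.leftRegular k H).comp φ) ρ) g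
    (TensorProduct.tmul k (MonoidAlgebra.single h (1 : k)) v)
  refine Eq.trans ?_ this
  simp [Representation.tprod_apply]

/-- Induction of a permutation representation. -/
theorem VRep.ind_perm [Finite H] {K : Type*} [Group K] (φ : K →* H) {X Z : Type*} [MulAction K X]
    [Finite X] [MulAction H Z] [Finite Z] (i : X → Z) (hi : ∀ (g : K) x, i (g • x) = φ g • i x)
    (hsurj : ∀ z, ∃ (h : H) (x : X), h • i x = z)
    (hinj : ∀ (h h' : H) (x x' : X), h • i x = h' • i x' → ∃ g : K, h' = h * φ g ∧ x = g • x') :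
    VRep.ind φ (VRep.perm k K X) = VRep.perm k H Z := by
  choose a x hax using hsurj
  rw [VRep.perm, VRep.ind_of]
  let ρ := Representation.ofMulAction k K X
  -- The coinvariants use left translation of `K` on `H`, so `H` itself acts by right translation by
  -- inverses. Sending `h ⊗ y` to `h⁻¹ • i y` is therefore both well defined and equivariant.
  let F : Representation.IndV φ ρ →ₗ[k] MonoidAlgebra k Z :=
    Representation.Coinvariants.lift _
      (TensorProduct.lift ((permBasis k H).constr k fun h =>
        (permBasis k X).constr k fun y => permBasis k Z (h⁻¹ • i y))) (by
      intro g
      refine TensorProduct.ext ((permBasis k H).ext fun h => (permBasis k X).ext fun y => ?_)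
      have h1 : Representation.leftRegular k H (φ g) (permBasis k H h) = permBasis k H (φ g * h) := by
        simp [permBasis_apply]
      have h2 : ρ g (permBasis k X y) = permBasis k X (g • y) := by
        simp [permBasis_apply, ρ]
      change TensorProduct.lift _ (TensorProduct.map (Representation.leftRegular k H (φ g)) (ρ g)
        (TensorProduct.tmul k (permBasis k H h) (permBasis k X y))) =
        TensorProduct.lift _ (TensorProduct.tmul k (permBasis k H h) (permBasis k X y))
      rw [TensorProduct.map_tmul, h1, h2, TensorProduct.lift.tmul, TensorProduct.lift.tmul]
      simp only [Module.Basis.constr_basis]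
      rw [hi, mul_inv_rev, mul_smul, inv_smul_smul])
  have hF : ∀ h y, F (Representation.IndV.mk φ ρ h (permBasis k X y)) =
      permBasis k Z (h⁻¹ • i y) := by
    intro h y
    change (permBasis k H).constr k (fun h =>
        (permBasis k X).constr k fun y => permBasis k Z (h⁻¹ • i y)) (permBasis k H h)
        (permBasis k X y) = _
    rw [Module.Basis.constr_basis, Module.Basis.constr_basis]
  -- The inverse map uses the chosen presentation `z = a z • i (x z)`.
  let F' : MonoidAlgebra k Z →ₗ[k] Representation.IndV φ ρ :=
    (permBasis k Z).constr k fun z => Representation.IndV.mk φ ρ (a z)⁻¹ (permBasis k X (x z))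
  have hF' : ∀ z, F' (permBasis k Z z) =
      Representation.IndV.mk φ ρ (a z)⁻¹ (permBasis k X (x z)) :=
    fun z => Module.Basis.constr_basis _ _ _ _
  let e : Representation.IndV φ ρ ≃ₗ[k] MonoidAlgebra k Z := LinearEquiv.ofLinearMap F F' (by
      refine (permBasis k Z).ext fun z => ?_
      rw [LinearMap.comp_apply, hF', hF, inv_inv, hax]
      rfl) (by
      refine Representation.IndV.hom_ext _ _ fun h => (permBasis k X).ext fun y => ?_
      rw [LinearMap.comp_apply, LinearMap.comp_apply, hF, hF']
      -- Two presentations of one point differ by an element of `K`, which is precisely the relation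
      -- `IndV_mk_smul` of the coinvariants.
      obtain ⟨g, hg, hg'⟩ := hinj _ _ _ _ (hax (h⁻¹ • i y))
      have h2 : permBasis k X (x (h⁻¹ • i y)) = ρ g (permBasis k X y) := by
        rw [hg']
        simp [permBasis_apply, ρ]
      have h3 : (a (h⁻¹ • i y))⁻¹ = φ g * h := by
        rw [inv_eq_iff_mul_eq_one, ← mul_assoc, ← hg, inv_mul_cancel]
      rw [h2, h3, IndV_mk_smul]
      rfl)
  refine VRep.of_eq_perm _ ((permBasis k Z).map e.symm) fun h z => ?_
  rw [Module.Basis.map_apply, Module.Basis.map_apply, LinearEquiv.eq_symm_apply]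
  change F (Representation.ind φ ρ h (F' _)) = _
  rw [hF', Representation.ind_mk, hF, mul_inv_rev, inv_inv, inv_inv, mul_smul, hax]

variable {Ω : Type*} [MulAction H Ω] [Finite Ω]

/-- A permutation representation decomposed along a finite family of disjoint stable subsets. -/
theorem VRep.perm_eq_sum {J : Type*} [Fintype J] (X : SubMulAction H Ω) (Z : J → SubMulAction H Ω)
    (hX : ∀ ω, ω ∈ X ↔ ∃ j, ω ∈ Z j) (hZ : ∀ ω j j', ω ∈ Z j → ω ∈ Z j' → j = j') :
    VRep.perm k H X = ∑ j, VRep.perm k H (Z j) := by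
  classical
  suffices ∀ (s : Finset J) (X : SubMulAction H Ω), (∀ ω, ω ∈ X ↔ ∃ j ∈ s, ω ∈ Z j) →
      VRep.perm k H X = ∑ j ∈ s, VRep.perm k H (Z j) from this _ X (by simpa using hX)
  intro s
  induction s using Finset.induction_on with
  | empty =>
    intro X hX
    have : IsEmpty X := ⟨fun ω => by simpa using (hX ω.1).1 ω.2⟩
    rw [VRep.perm_of_isEmpty, Finset.sum_empty]
  | insert j s hj ih =>
    intro X hX
    let Y : SubMulAction H Ω :=
      { carrier := {ω | ∃ j ∈ s, ω ∈ Z j}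
        smul_mem' := fun h ω ⟨j, hj, hω⟩ => ⟨j, hj, (Z j).smul_mem h hω⟩ }
    rw [Finset.sum_insert hj, ← ih Y fun ω => Iff.rfl]
    have hl : ∀ ω : Z j, ω.1 ∈ X := fun ω => (hX _).2 ⟨j, Finset.mem_insert_self _ _, ω.2⟩
    have hr : ∀ ω : Y, ω.1 ∈ X := fun ω => by
      obtain ⟨i, hi, hω⟩ := ω.2
      exact (hX _).2 ⟨i, Finset.mem_insert_of_mem hi, hω⟩
    refine VRep.perm_eq_add (Equiv.ofBijective
      (Sum.elim (fun ω => ⟨ω.1, hl ω⟩) (fun ω => ⟨ω.1, hr ω⟩)) ⟨?_, ?_⟩)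
      (fun _ _ => rfl) (fun _ _ => rfl)
    · have hne : ∀ (ω : Z j) (ω' : Y), ω.1 ≠ ω'.1 := by
        rintro ⟨ω, hω⟩ ⟨ω', i, hi, hω'⟩ h
        obtain rfl : ω = ω' := h
        exact hj (hZ _ _ _ hω hω' ▸ hi)
      rintro (ω | ω) (ω' | ω') h
      · exact congrArg _ (Subtype.ext (Subtype.ext_iff.1 h :))
      · exact absurd (congrArg Subtype.val h) (hne ω ω')
      · exact absurd (congrArg Subtype.val h) (hne ω' ω).symm
      · exact congrArg _ (Subtype.ext (Subtype.ext_iff.1 h :))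
    · rintro ⟨ω, hω⟩
      obtain ⟨i, hi, hω'⟩ := (hX _).1 hω
      rcases Finset.mem_insert.1 hi with rfl | hi
      · exact ⟨.inl ⟨ω, hω'⟩, rfl⟩
      · exact ⟨.inr ⟨ω, i, hi, hω'⟩, rfl⟩

/-- A permutation representation decomposed as a sum of induced representations. -/
theorem VRep.perm_eq_sum_ind [Finite H] {J : Type*} [Fintype J] (X : SubMulAction H Ω)
    (K : J → Subgroup H) (Y : ∀ j, SubMulAction (K j) Ω) (hY : ∀ j, ∀ ω ∈ Y j, ω ∈ X)
    (hX : ∀ ω ∈ X, ∃ (j : J) (h : H), ∃ ω' ∈ Y j, h • ω' = ω)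
    (huniq : ∀ j j', ∀ ω ∈ Y j, ∀ ω' ∈ Y j', ∀ h : H, h • ω = ω' → j = j')
    (hK : ∀ j, ∀ ω ∈ Y j, ∀ ω' ∈ Y j, ∀ h : H, h • ω = ω' → h ∈ K j) :
    VRep.perm k H X = ∑ j, VRep.ind (K j).subtype (VRep.perm k (K j) (Y j)) := by
  -- The stable subset swept out by `Y j`. By `huniq` these are disjoint for different `j`, and by
  -- `hK` each of them is induced from `K j`.
  let Z : J → SubMulAction H Ω := fun j =>
    { carrier := {ω | ∃ h : H, ∃ ω' ∈ Y j, h • ω' = ω}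
      smul_mem' := fun g ω ⟨h, ω', hω', e⟩ => ⟨g * h, ω', hω', by rw [mul_smul, e]⟩ }
  rw [VRep.perm_eq_sum X Z]
  · refine Finset.sum_congr rfl fun j _ => (VRep.ind_perm (K j).subtype
      (fun ω : Y j => (⟨ω.1, 1, ω.1, ω.2, one_smul _ _⟩ : Z j)) (fun _ _ => rfl) ?_ ?_).symm
    · rintro ⟨_, h, ω, hω, rfl⟩
      exact ⟨h, ⟨ω, hω⟩, rfl⟩
    · rintro h h' ⟨ω, hω⟩ ⟨ω', hω'⟩ e
      have e' : h • ω = h' • ω' := congrArg Subtype.val e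
      have e2 : (h⁻¹ * h') • ω' = ω := by rw [mul_smul, ← e', inv_smul_smul]
      exact ⟨⟨h⁻¹ * h', hK j _ hω' _ hω _ e2⟩, by simp, Subtype.ext e2.symm⟩
  · intro ω
    constructor
    · intro hω
      obtain ⟨j, h, ω', h1, h2⟩ := hX ω hω
      exact ⟨j, h, ω', h1, h2⟩
    · rintro ⟨j, h, ω', h1, rfl⟩
      exact X.smul_mem h (hY j _ h1)
  · rintro ω j j' ⟨h, ω', h1, h2⟩ ⟨h', ω'', h3, h4⟩
    exact huniq j j' _ h1 _ h3 (h'⁻¹ * h) (by rw [mul_smul, h2, ← h4, inv_smul_smul])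

end PermutationRepresentations


/-! ### Connected components, separators and duality. -/

section Connectivity

open Set

variable {α : Type*} {M : Matroid α} {e f g : α}

theorem self_mem_component (M : Matroid α) (e : α) : e ∈ component M e := Or.inl rfl

theorem mem_component_symm (h : f ∈ component M e) : e ∈ component M f := by
  rcases h with rfl | ⟨C, hC, he, hf⟩
  · exact Or.inl rfl
  · exact Or.inr ⟨C, hC, hf, he⟩

theorem component_subset_ground (he : e ∈ M.E) : component M e ⊆ M.E := by
  rintro f (rfl | ⟨C, hC, -, hf⟩)
  · exact he
  · exact hC.subset_ground hf

/-- Two circuits that meet contain any two of their elements in a common circuit. -/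
theorem exists_isCircuit_of_inter_nonempty [Finite α] {C₁ C₂ : Set α} (h₁ : M.IsCircuit C₁)
    (h₂ : M.IsCircuit C₂) (he : e ∈ C₁) (hg : g ∈ C₂) (h : (C₁ ∩ C₂).Nonempty) :
    ∃ C, M.IsCircuit C ∧ e ∈ C ∧ g ∈ C := by
  induction hn : (C₁ ∪ C₂).ncard using Nat.strong_induction_on generalizing C₁ C₂ with
  | _ n ih =>
    subst hn
    by_contra hcon
    have heC₂ : e ∉ C₂ := fun h => hcon ⟨C₂, h₂, h, hg⟩
    have hgC₁ : g ∉ C₁ := fun h => hcon ⟨C₁, h₁, he, h⟩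
    obtain ⟨f, hf₁, hf₂⟩ := h
    have hlt : ∀ C ⊆ (C₁ ∪ C₂) \ {f}, C.ncard < (C₁ ∪ C₂).ncard := fun C hC =>
      Set.ncard_lt_ncard (hC.trans_ssubset
        (Set.sdiff_singleton_ssubset.2 (Or.inl hf₁))) (Set.toFinite _)
    -- In a counterexample with `C₁ ∪ C₂` as small as possible, eliminate `f` in two ways, keeping
    -- `e` in `C₃` and `g` in `C₄`. Minimality forces `C₃ ∪ C₂` and `C₁ ∪ C₄` to be all of `C₁ ∪
    -- C₂`, so `C₃` and `C₄` meet. Their union misses `f`, hence is smaller, a contradiction.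
    obtain ⟨C₃, h3s, h₃, he₃⟩ := h₁.strong_elimination h₂ hf₁ hf₂ he heC₂
    obtain ⟨C₄, h4s, h₄, hg₄⟩ := h₂.strong_elimination h₁ hf₂ hf₁ hg hgC₁
    rw [Set.union_comm] at h4s
    have hnot : ∀ {C D D' : Set α}, M.IsCircuit C → M.IsCircuit D → C ⊆ (D ∪ D') \ {f} → f ∈ D →
        (C ∩ D').Nonempty := by
      intro C D D' hC hD hs hf
      by_contra hemp
      have : C ⊆ D := fun x hx => (hs hx).1.resolve_right fun h => hemp ⟨x, hx, h⟩
      have h5 := hC.eq_of_subset_isCircuit hD this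
      exact (hs (h5 ▸ hf)).2 rfl
    have h32 := hnot h₃ h₁ h3s hf₁
    have h41 := hnot (D := C₂) (D' := C₁) h₄ h₂ (by rwa [Set.union_comm]) hf₂
    have hu : ∀ C ⊆ (C₁ ∪ C₂) \ {f}, ∀ D ⊆ C₁ ∪ C₂, C ∪ D ⊆ C₁ ∪ C₂ := fun C hC D hD =>
      Set.union_subset (hC.trans Set.sdiff_subset) hD
    have e32 : C₃ ∪ C₂ = C₁ ∪ C₂ := by
      by_contra hne
      exact hcon (ih _ (Set.ncard_lt_ncard ((hu _ h3s _ Set.subset_union_right).ssubset_of_ne hne)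
        (Set.toFinite _)) h₃ h₂ he₃ hg h32 rfl)
    have e41 : C₁ ∪ C₄ = C₁ ∪ C₂ := by
      by_contra hne
      refine hcon (ih _ (Set.ncard_lt_ncard (LE.le.ssubset_of_ne ?_ hne)
        (Set.toFinite _)) h₁ h₄ he hg₄ (by rwa [Set.inter_comm]) rfl)
      rw [Set.union_comm]
      exact hu _ h4s _ Set.subset_union_left
    have h34 : (C₃ ∩ C₄).Nonempty := by
      have : ¬ C₃ ⊆ C₁ := fun h => (h3s ((h₃.eq_of_subset_isCircuit h₁ h).symm ▸ hf₁ : f ∈ C₃)).2 rfl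
      obtain ⟨x, hx3, hx1⟩ := Set.not_subset.1 this
      have hx : x ∈ C₁ ∪ C₄ := e41 ▸ (h3s hx3).1
      exact ⟨x, hx3, hx.resolve_left hx1⟩
    exact hcon (ih _ (hlt _ (Set.union_subset h3s h4s)) h₃ h₄ he₃ hg₄ h34 rfl)

theorem mem_component_trans [Finite α] (h : f ∈ component M e) (h' : g ∈ component M f) :
    g ∈ component M e := by
  rcases h with rfl | ⟨C, hC, he, hf⟩
  · exact h'
  · rcases h' with rfl | ⟨C', hC', hf', hg⟩
    · exact Or.inr ⟨C, hC, he, hf⟩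
    · exact Or.inr (exists_isCircuit_of_inter_nonempty hC hC' he hg ⟨f, hf, hf'⟩)

theorem component_eq_of_mem [Finite α] (h : f ∈ component M e) : component M f = component M e :=
  Set.Subset.antisymm (fun _ h' => mem_component_trans h h')
    (fun _ h' => mem_component_trans (mem_component_symm h) h')

/-- A set such that every circuit is contained in it or disjoint from it. -/
def IsSeparator (M : Matroid α) (S : Set α) : Prop :=
  ∀ C, M.IsCircuit C → (C ∩ S).Nonempty → C ⊆ S

theorem isSeparator_component [Finite α] (M : Matroid α) (e : α) : IsSeparator M (component M e) := by
  rintro C hC ⟨f, hfC, hf⟩ g hg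
  exact mem_component_trans hf (Or.inr ⟨C, hC, hfC, hg⟩)

/-- A circuit inside the set would lie entirely on one side of the separator. -/
theorem IsSeparator.indep_iff {S I : Set α} (hS : IsSeparator M S) :
    M.Indep I ↔ M.Indep (I ∩ S) ∧ M.Indep (I \ S) := by
  refine ⟨fun h => ⟨h.subset Set.inter_subset_left, h.subset Set.sdiff_subset⟩, fun ⟨h1, h2⟩ => ?_⟩
  have hE : I ⊆ M.E := by
    rw [← Set.inter_union_sdiff I S]
    exact Set.union_subset h1.subset_ground h2.subset_ground
  rw [Matroid.indep_iff_forall_subset_not_isCircuit hE]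
  intro C hCI hC
  by_cases h : (C ∩ S).Nonempty
  · exact hC.not_indep (h1.subset (Set.subset_inter hCI (hS C hC h)))
  · exact hC.not_indep (h2.subset fun x hx => ⟨hCI hx, fun hxS => h ⟨x, hx, hxS⟩⟩)

/-- If a cocircuit `K` met both sides, its two pieces would be coindependent, so avoided by bases
`B₁` and `B₂`. Splicing `B₁` inside `S` with `B₂` outside `S` gives a base that avoids `K`, a
contradiction. -/
theorem IsSeparator.dual {S : Set α} (hS : IsSeparator M S) : IsSeparator M✶ S := by
  intro K hK hne
  by_contra hns
  have hE : K ⊆ M.E := hK.subset_ground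
  have h1 : M✶.Indep (K ∩ S) := hK.ssubset_indep
    (Set.inter_subset_left.ssubset_of_ne fun h => hns (Set.inter_eq_left.1 h))
  have h2 : M✶.Indep (K \ S) := hK.ssubset_indep
    (Set.sdiff_subset.ssubset_of_ne fun h => by
      obtain ⟨x, hx⟩ := hne
      exact (h.symm ▸ hx.1 : x ∈ K \ S).2 hx.2)
  rw [Matroid.dual_indep_iff_exists'] at h1 h2
  obtain ⟨B₁, hB₁, hd₁⟩ := h1.2
  obtain ⟨B₂, hB₂, hd₂⟩ := h2.2
  apply hK.not_indep
  rw [Matroid.dual_indep_iff_exists']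
  have hIi : ((B₁ ∩ S) ∪ (B₂ \ S)) ∩ S = B₁ ∩ S := by
    ext x
    simp only [Set.mem_inter_iff, Set.mem_union, Set.mem_sdiff]
    tauto
  have hId : ((B₁ ∩ S) ∪ (B₂ \ S)) \ S = B₂ \ S := by
    ext x
    simp only [Set.mem_inter_iff, Set.mem_union, Set.mem_sdiff]
    tauto
  have hI : M.Indep ((B₁ ∩ S) ∪ (B₂ \ S)) := by
    rw [hS.indep_iff, hIi, hId]
    exact ⟨hB₁.indep.subset Set.inter_subset_left, hB₂.indep.subset Set.sdiff_subset⟩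
  refine ⟨hE, (B₁ ∩ S) ∪ (B₂ \ S), ?_, ?_⟩
  · rw [Matroid.isBase_iff_maximal_indep, maximal_iff_forall_insert (fun _ _ h h' => h.subset h')]
    refine ⟨hI, fun x hx hins => ?_⟩
    rw [hS.indep_iff] at hins
    by_cases hxS : x ∈ S
    · have hxB : x ∉ B₁ := fun h => hx (Or.inl ⟨h, hxS⟩)
      refine hxB (hB₁.mem_of_insert_indep ?_)
      rw [hS.indep_iff, Set.insert_sdiff_of_mem _ hxS]
      refine ⟨hins.1.subset ?_, hB₁.indep.subset Set.sdiff_subset⟩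
      rintro y ⟨rfl | hy, hyS⟩
      · exact ⟨Or.inl rfl, hyS⟩
      · exact ⟨Or.inr (Or.inl ⟨hy, hyS⟩), hyS⟩
    · have hxB : x ∉ B₂ := fun h => hx (Or.inr ⟨h, hxS⟩)
      refine hxB (hB₂.mem_of_insert_indep ?_)
      rw [hS.indep_iff, Set.insert_inter_of_notMem hxS]
      refine ⟨hB₂.indep.subset Set.inter_subset_left, hins.2.subset ?_⟩
      rintro y ⟨rfl | hy, hyS⟩
      · exact ⟨Or.inl rfl, hyS⟩
      · exact ⟨Or.inr (Or.inr ⟨hy, hyS⟩), hyS⟩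
  · rw [Set.disjoint_left] at hd₁ hd₂ ⊢
    rintro x hx (h | h)
    · exact hd₁ ⟨hx, h.2⟩ h.1
    · exact hd₂ ⟨hx, h.2⟩ h.1

/-- A component of `M` is a separator of `M✶`, so it contains the component of `M✶`; exchange the
two for the converse. This is why equivalence of labelings is insensitive to dualizing. -/
theorem component_dual [Finite α] (M : Matroid α) (e : α) : component M✶ e = component M e := by
  have key : ∀ M : Matroid α, component M✶ e ⊆ component M e := by
    rintro M f (rfl | ⟨K, hK, he, hf⟩)
    · exact self_mem_component M f
    · exact (isSeparator_component M e).dual K hK ⟨e, he, self_mem_component M e⟩ hf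
  refine (key M).antisymm ?_
  have := key M✶
  rwa [Matroid.dual_dual] at this

/-- For a separator, every base of `M` meets `S` in a base of `M ↾ S`. For a general set the dual of
a restriction is instead a contraction of the dual. -/
theorem IsSeparator.restrict_dual {S : Set α} (hS : IsSeparator M S) (hSE : S ⊆ M.E) :
    (M ↾ S)✶ = M✶ ↾ S := by
  refine Matroid.ext_indep rfl fun I hI => ?_
  have hIS : I ⊆ S := hI
  rw [Matroid.restrict_indep_iff, and_iff_left hIS, Matroid.dual_indep_iff_exists',
    Matroid.dual_indep_iff_exists']
  constructor
  · rintro ⟨-, B, hB, hd⟩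
    have hB' : M.Indep B := (Matroid.restrict_indep_iff.1 hB.indep).1
    obtain ⟨B', hB', hBB'⟩ := hB'.exists_isBase_superset
    refine ⟨hIS.trans hSE, B', hB', ?_⟩
    have : B' ∩ S ⊆ B := by
      rw [hB.eq_of_subset_indep (Matroid.restrict_indep_iff.2
        ⟨hB'.indep.subset Set.inter_subset_left, Set.inter_subset_right⟩)
        (Set.subset_inter hBB' hB.subset_ground)]
    rw [Set.disjoint_left] at hd ⊢
    exact fun x hx hxB => hd hx (this ⟨hxB, hIS hx⟩)
  · rintro ⟨-, B, hB, hd⟩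
    refine ⟨hIS, B ∩ S, ?_, hd.mono_right Set.inter_subset_left⟩
    rw [Matroid.isBase_iff_maximal_indep, maximal_iff_forall_insert (fun _ _ h h' => h.subset h')]
    refine ⟨Matroid.restrict_indep_iff.2
        ⟨hB.indep.subset Set.inter_subset_left, Set.inter_subset_right⟩, fun x hx hins => ?_⟩
    rw [Matroid.restrict_indep_iff] at hins
    have hxS : x ∈ S := hins.2 (Set.mem_insert _ _)
    refine hx ⟨hB.mem_of_insert_indep ?_, hxS⟩
    rw [hS.indep_iff, Set.insert_sdiff_of_mem _ hxS]
    refine ⟨hins.1.subset ?_, hB.indep.subset Set.sdiff_subset⟩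
    rintro y ⟨rfl | hy, hyS⟩
    · exact Or.inl rfl
    · exact Or.inr ⟨hy, hyS⟩

end Connectivity


/-! ### Replacing elements by parallel ones. -/

section Parallel

variable {α : Type*} {M : Matroid α} {e f : α}

/-- Replacing the elements of a set by parallel ones does not change its closure. -/
theorem closure_image_eq {t : α → α} {I : Set α} (hIE : I ⊆ M.E) (htE : t '' I ⊆ M.E)
    (ht : ∀ i ∈ I, M.closure {t i} = M.closure {i}) : M.closure (t '' I) = M.closure I := by
  apply Set.Subset.antisymm <;> apply Matroid.closure_subset_closure_of_subset_closure
  · rintro _ ⟨i, hi, rfl⟩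
    refine M.closure_subset_closure (Set.singleton_subset_iff.2 hi) ?_
    rw [← ht i hi]
    exact M.mem_closure_of_mem' rfl (htE (Set.mem_image_of_mem t hi))
  · intro i hi
    refine M.closure_subset_closure (Set.singleton_subset_iff.2 (Set.mem_image_of_mem t hi)) ?_
    rw [ht i hi]
    exact M.mem_closure_of_mem' rfl (hIE hi)

theorem eRk_image_eq {t : α → α} {I : Set α} (hIE : I ⊆ M.E) (htE : t '' I ⊆ M.E)
    (ht : ∀ i ∈ I, M.closure {t i} = M.closure {i}) : M.eRk (t '' I) = M.eRk I := by
  rw [← M.eRk_closure_eq, closure_image_eq hIE htE ht, M.eRk_closure_eq]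

/-- Replacing the elements of a set by parallel ones preserves independence. -/
theorem indep_image_iff [Finite α] {t : α → α} {I : Set α} (hIE : I ⊆ M.E) (htE : t '' I ⊆ M.E)
    (ht : ∀ i ∈ I, M.closure {t i} = M.closure {i}) (hinj : Set.InjOn t I) :
    M.Indep (t '' I) ↔ M.Indep I := by
  rw [Matroid.indep_iff_eRk_eq_encard_of_finite (Set.toFinite _),
    Matroid.indep_iff_eRk_eq_encard_of_finite (Set.toFinite _), eRk_image_eq hIE htE ht,
    hinj.encard_image]

-- The swap does not change the span of any single element, so `indep_image_iff` applies. It later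
-- turns a deletion of `f` into a deletion of `e`, and moves a circuit from `e` to `f`.
open Classical in
theorem mapEquiv_swap_eq_self [Finite α] (he : e ∈ M.E) (hf : f ∈ M.E)
    (h : M.closure {e} = M.closure {f}) : M.mapEquiv (Equiv.swap e f) = M := by
  have hE : ∀ x ∈ M.E, Equiv.swap e f x ∈ M.E := by
    intro x hx
    rw [Equiv.swap_apply_def]
    split_ifs <;> assumption
  refine Matroid.ext_indep ?_ fun I hI => ?_
  · apply Set.Subset.antisymm
    · rintro _ ⟨x, hx, rfl⟩
      exact hE x hx
    · intro x hx
      exact ⟨_, hE x hx, Equiv.swap_apply_self _ _ _⟩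
  · rw [Matroid.mapEquiv_indep_iff, Equiv.symm_swap]
    have hIE : I ⊆ M.E := by
      intro x hx
      obtain ⟨y, hy, rfl⟩ := hI hx
      exact hE y hy
    refine indep_image_iff hIE ?_ (fun i _ => ?_) (Equiv.injective _).injOn
    · rintro _ ⟨x, hx, rfl⟩
      exact hE x (hIE hx)
    · rw [Equiv.swap_apply_def]
      split_ifs with h1 h2
      · rw [h1, h]
      · rw [h2, h]
      · rfl

end Parallel

/-! ### Reduction to the empty matroid: duality, minors and gluing. -/

/-- Matroids that can be reduced to the empty matroid by repeatedly deleting loops and elements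
parallel to another one, and contracting coloops and elements in series with another one. -/
inductive IsSPReducible {α : Type*} : Matroid α → Prop
  | empty : IsSPReducible (Matroid.emptyOn α)
  -- The set `X` merges two cases: `X = ∅` makes `e` a loop, while `X = {f}` makes `e` a loop or
  -- parallel to `f`.
  | parallel (M : Matroid α) (e : α) (X : Set α) (hX : X.Subsingleton) (he : e ∉ X)
      (h : e ∈ M.closure X) (hM : IsSPReducible (M ＼ {e})) : IsSPReducible M
  | series (M : Matroid α) (e : α) (X : Set α) (hX : X.Subsingleton) (he : e ∉ X)
      (h : e ∈ M✶.closure X) (hM : IsSPReducible (M ／ {e})) : IsSPReducible M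

namespace IsSPReducible

open Set

variable {α : Type*} {M : Matroid α}

/-- The two kinds of reduction are each other's duals, so no argument beyond bookkeeping is needed.
-/
theorem dual (hM : IsSPReducible M) : IsSPReducible M✶ := by
  induction hM with
  | empty =>
    rw [Matroid.emptyOn_dual_eq]
    exact .empty
  | parallel M e X hX he h hM ih =>
    refine .series _ e X hX he (by rwa [Matroid.dual_dual]) ?_
    rwa [← Matroid.dual_delete]
  | series M e X hX he h hM ih =>
    refine .parallel _ e X hX he h ?_
    rwa [← Matroid.dual_contract]

theorem of_dual (hM : IsSPReducible M✶) : IsSPReducible M := by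
  simpa using hM.dual

theorem mapEquiv (hM : IsSPReducible M) (σ : Equiv.Perm α) : IsSPReducible (M.mapEquiv σ) := by
  have hcl : ∀ (M : Matroid α) X e, e ∈ M.closure X → σ e ∈ (M.mapEquiv σ).closure (σ '' X) := by
    intro M X e he
    rw [Matroid.mapEquiv_eq_map, Matroid.map_closure_eq, Set.preimage_image_eq _ σ.injective]
    exact Set.mem_image_of_mem _ he
  induction hM with
  | empty =>
    rw [Matroid.mapEquiv_eq_map, Matroid.map_emptyOn]
    exact .empty
  | parallel M e X hX he h hM ih =>
    refine .parallel _ (σ e) (σ '' X) (hX.image σ) (by simpa using he) (hcl M X e h) ?_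
    rw [mapEquiv_delete]
    simpa using ih
  | series M e X hX he h hM ih =>
    refine .series _ (σ e) (σ '' X) (hX.image σ) (by simpa using he) ?_ ?_
    · rw [mapEquiv_dual]
      exact hcl _ X e h
    · rw [mapEquiv_contract]
      simpa using ih

/-- A loop remains a loop after another element is deleted or contracted, so it can still be removed
first; for the loop itself, deletion and contraction agree. -/
theorem minors_of_isLoop {e : α} (h : M.IsLoop e) (hM : IsSPReducible (M ＼ {e}))
    (ih : ∀ x, IsSPReducible (M ＼ {e} ＼ {x}) ∧ IsSPReducible (M ＼ {e} ／ {x})) (x : α) :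
    IsSPReducible (M ＼ {x}) ∧ IsSPReducible (M ／ {x}) := by
  by_cases hx : x = e
  · subst hx
    rw [Matroid.contract_eq_delete_of_subset_loops (Set.singleton_subset_iff.2 h)]
    exact ⟨hM, hM⟩
  · constructor
    · refine .parallel _ e ∅ Set.subsingleton_empty (Set.notMem_empty e) ?_ ?_
      · change (M ＼ {x}).IsLoop e
        rw [Matroid.delete_isLoop_iff]
        exact ⟨h, fun h => hx h.symm⟩
      · rw [Matroid.delete_comm]
        exact (ih x).1
    · refine .parallel _ e ∅ Set.subsingleton_empty (Set.notMem_empty e) ?_ ?_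
      · change (M ／ {x}).IsLoop e
        rw [Matroid.contract_isLoop_iff_mem_closure]
        exact ⟨h.mem_closure _, fun h => hx h.symm⟩
      · rw [Matroid.contract_delete_comm _ (by simpa using hx)]
        exact (ih x).2

/-- Away from the pair, `e` stays in the span of `f` in the minor and can be removed first.
Contracting one of the pair turns the other into a loop, and deleting `f` is deleting `e` up to a
swap. -/
theorem minors_of_parallel [Finite α] {e : α} {X : Set α} (hX : X.Subsingleton) (he : e ∉ X)
    (h : e ∈ M.closure X) (hM : IsSPReducible (M ＼ {e}))
    (ih : ∀ x, IsSPReducible (M ＼ {e} ＼ {x}) ∧ IsSPReducible (M ＼ {e} ／ {x})) (x : α) :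
    IsSPReducible (M ＼ {x}) ∧ IsSPReducible (M ／ {x}) := by
  classical
  by_cases hl : M.IsLoop e
  · exact minors_of_isLoop hl hM ih x
  obtain rfl | ⟨f, rfl⟩ := hX.eq_empty_or_singleton
  · exact absurd h hl
  have hef : e ≠ f := he
  have heE : e ∈ M.E := Matroid.mem_ground_of_mem_closure h
  have hnl : M.IsNonloop e := Matroid.isNonloop_of_not_isLoop heE hl
  have hcl : M.closure {e} = M.closure {f} := hnl.closure_eq_of_mem_closure h
  have hnf : M.IsNonloop f := hnl.isNonloop_of_mem_closure h
  by_cases hx : x = e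
  · subst hx
    refine ⟨hM, .parallel _ f ∅ Set.subsingleton_empty (Set.notMem_empty f) ?_ ?_⟩
    · change (M ／ {x}).IsLoop f
      rw [Matroid.contract_isLoop_iff_mem_closure, hcl]
      exact ⟨M.mem_closure_of_mem' rfl hnf.mem_ground, hef.symm⟩
    -- After one of two parallel elements is contracted the other is a loop, so deleting and
    -- contracting it agree; both sides equal the contraction of both elements.
    · have h1 : M ／ {x} ＼ {f} = M ＼ {x} ／ {f} := by
        rw [← Matroid.contract_delete_comm _ (by simpa using hef.symm)]
        have h2 : M ／ {x} ＼ {f} = M ／ {x} ／ {f} := by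
          refine (Matroid.contract_eq_delete_of_subset_loops ?_).symm
          rw [Matroid.contract_loops_eq, hcl, Set.singleton_subset_iff]
          exact ⟨M.mem_closure_of_mem' rfl hnf.mem_ground, hef.symm⟩
        have h3 : M ／ {f} ＼ {x} = M ／ {f} ／ {x} := by
          refine (Matroid.contract_eq_delete_of_subset_loops ?_).symm
          rw [Matroid.contract_loops_eq, ← hcl, Set.singleton_subset_iff]
          exact ⟨M.mem_closure_of_mem' rfl heE, hef⟩
        rw [h2, h3, Matroid.contract_comm]
      rw [h1]
      exact (ih f).2
  by_cases hxf : x = f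
  · subst hxf
    constructor
    -- The swap is an automorphism of `M` carrying the deletion of one parallel element to that of
    -- the other.
    · have h1 := mapEquiv_delete M (Equiv.swap e x) {x}
      rw [mapEquiv_swap_eq_self heE hnf.mem_ground hcl] at h1
      rw [h1]
      apply IsSPReducible.mapEquiv
      simpa using hM
    · refine .parallel _ e ∅ Set.subsingleton_empty (Set.notMem_empty e) ?_ ?_
      · change (M ／ {x}).IsLoop e
        rw [Matroid.contract_isLoop_iff_mem_closure]
        exact ⟨h, hef⟩
      · rw [Matroid.contract_delete_comm _ (by simpa using hx)]
        exact (ih x).2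
  · constructor
    · refine .parallel _ e {f} Set.subsingleton_singleton he ?_ ?_
      · rw [Matroid.delete_closure_eq_of_disjoint _ (by simpa using Ne.symm hxf)]
        exact ⟨h, fun h => hx h.symm⟩
      · rw [Matroid.delete_comm]
        exact (ih x).1
    · refine .parallel _ e {f} Set.subsingleton_singleton he ?_ ?_
      · rw [Matroid.contract_closure_eq]
        exact ⟨M.closure_subset_closure Set.subset_union_left h, fun h => hx h.symm⟩
      · rw [Matroid.contract_delete_comm _ (by simpa using hx)]
        exact (ih x).2

/-- Only the parallel case needs an argument; the series case is the same argument in the dual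
matroid, with deletion and contraction exchanged. -/
theorem minors [Finite α] (hM : IsSPReducible M) (x : α) :
    IsSPReducible (M ＼ {x}) ∧ IsSPReducible (M ／ {x}) := by
  induction hM generalizing x with
  | empty =>
    rw [Matroid.deleteElem_eq_self (by simp), Matroid.contractElem_eq_self (by simp)]
    exact ⟨.empty, .empty⟩
  | parallel M e X hX he h hM ih => exact minors_of_parallel hX he h hM ih x
  | series M e X hX he h hM ih =>
    have h1 := minors_of_parallel (M := M✶) hX he h (by
      rw [← Matroid.dual_contract]
      exact hM.dual) (fun x => by
      rw [← Matroid.dual_contract, ← Matroid.dual_contract, ← Matroid.dual_delete]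
      exact ⟨(ih x).2.dual, (ih x).1.dual⟩) x
    rw [← Matroid.dual_contract, ← Matroid.dual_delete] at h1
    exact ⟨h1.2.of_dual, h1.1.of_dual⟩

theorem delete [Finite α] (hM : IsSPReducible M) (D : Set α) : IsSPReducible (M ＼ D) := by
  induction D, Set.toFinite D using Set.Finite.induction_on with
  | empty => simpa using hM
  | @insert a s _ _ ih =>
    rw [← Set.union_singleton, ← Matroid.delete_delete]
    exact (ih.minors a).1

theorem restrict [Finite α] (hM : IsSPReducible M) {R : Set α} (hR : R ⊆ M.E) :
    IsSPReducible (M ↾ R) := by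
  rw [← Matroid.delete_compl hR]
  exact hM.delete _

/-- Reducibility only depends on a set of elements to which all others are parallel. -/
theorem of_restrict [Finite α] {T : Set α} (hTE : T ⊆ M.E)
    (hT : ∀ e ∈ M.E, e ∉ T → ∃ X ⊆ T, X.Subsingleton ∧ e ∈ M.closure X)
    (h : IsSPReducible (M ↾ T)) : IsSPReducible M := by
  induction hn : (M.E \ T).ncard generalizing M with
  | zero =>
    rw [Set.ncard_eq_zero, Set.sdiff_eq_empty] at hn
    rwa [hTE.antisymm hn, Matroid.restrict_ground_eq_self] at h
  | succ n ih =>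
    have hne : (M.E \ T).Nonempty := by
      rw [Set.nonempty_iff_ne_empty]
      intro h
      rw [h, Set.ncard_empty] at hn
      omega
    obtain ⟨e, heE, heT⟩ := hne
    obtain ⟨X, hXT, hX, heX⟩ := hT e heE heT
    have hTe : T ⊆ (M ＼ {e}).E := Set.subset_sdiff_singleton hTE heT
    refine .parallel M e X hX (fun h => heT (hXT h)) heX (ih hTe ?_ ?_ ?_)
    · rintro f ⟨hfE, hfe⟩ hfT
      obtain ⟨Y, hYT, hY, hfY⟩ := hT f hfE hfT
      refine ⟨Y, hYT, hY, ?_⟩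
      rw [Matroid.delete_closure_eq_of_disjoint]
      · exact ⟨hfY, hfe⟩
      · rw [Set.disjoint_singleton_right]
        exact fun h => heT (hYT h)
    · rwa [Matroid.delete, Matroid.restrict_restrict_eq _ (show T ⊆ M.E \ {e} from hTe)]
    · rw [Matroid.delete_ground, Set.sdiff_sdiff_comm]
      have := Set.ncard_sdiff_singleton_add_one (s := M.E \ T) ⟨heE, heT⟩
      omega

/-- The reductions of the part on `S` can be carried out inside `M` without touching the complement;
once `S` is used up, the complement is what remains. This assembles a matroid from its components.
-/
theorem of_isSeparator [Finite α] {N : Matroid α} (hN : IsSPReducible N) {S : Set α}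
    (hS : IsSeparator M S) (hSE : S ⊆ M.E) (hNS : N = M ↾ S)
    (h : IsSPReducible (M ↾ (M.E \ S))) : IsSPReducible M := by
  have hcl : ∀ (M : Matroid α) S X e, S ⊆ M.E → e ∈ (M ↾ S).closure X →
      e ∈ S ∧ e ∈ M.closure X := by
    intro M S X e hSE he
    rw [Matroid.restrict_closure_eq', Set.sdiff_eq_empty.2 hSE, Set.union_empty] at he
    exact ⟨he.2, M.closure_subset_closure Set.inter_subset_left he.1⟩
  have hdel : ∀ (M : Matroid α) S e, IsSeparator M S → IsSeparator (M ＼ {e}) (S \ {e}) := by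
    rintro M S e hS C hC ⟨x, hxC, hx⟩
    rw [Matroid.delete_isCircuit_iff, Set.disjoint_singleton_right] at hC
    exact Set.subset_sdiff_singleton (hS C hC.1 ⟨x, hxC, hx.1⟩) hC.2
  have hco : ∀ (M : Matroid α) S, IsSeparator M S → IsSeparator M (M.E \ S) := by
    rintro M S hS C hC ⟨x, hxC, hx⟩ y hy
    exact ⟨hC.subset_ground hy, fun hyS => hx.2 (hS C hC ⟨y, hy, hyS⟩ hxC)⟩
  have hsd : ∀ (E S : Set α) e, e ∈ S → (E \ {e}) \ (S \ {e}) = E \ S := by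
    intro E S e he
    ext x
    simp only [Set.mem_sdiff, Set.mem_singleton_iff]
    by_cases hx : x = e
    · subst hx
      tauto
    · tauto
  induction hN generalizing M S with
  | empty =>
    have : S = ∅ := congrArg Matroid.E hNS.symm
    rwa [this, Set.sdiff_empty, Matroid.restrict_ground_eq_self] at h
  | parallel N e X hX he hc hN ih =>
    subst hNS
    obtain ⟨heS, hc⟩ := hcl _ _ _ _ hSE hc
    refine .parallel M e X hX he hc (ih (hdel M S e hS) (Set.sdiff_subset_sdiff_left hSE) ?_ ?_)
    · rw [Matroid.delete, Matroid.delete, Matroid.restrict_ground_eq,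
        Matroid.restrict_restrict_eq _ Set.sdiff_subset,
        Matroid.restrict_restrict_eq _ (Set.sdiff_subset_sdiff_left hSE)]
    · rw [Matroid.delete_ground, hsd _ _ _ heS, Matroid.delete, Matroid.restrict_restrict_eq _
        (Set.subset_sdiff_singleton Set.sdiff_subset fun h => h.2 heS)]
      exact h
  | series N e X hX he hc hN ih =>
    subst hNS
    rw [hS.restrict_dual hSE] at hc
    obtain ⟨heS, hc⟩ := hcl M✶ _ _ _ hSE hc
    have hsep : IsSeparator (M ／ {e}) (S \ {e}) := by
      have := (hdel M✶ S e hS.dual).dual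
      rwa [Matroid.dual_delete_dual] at this
    refine .series M e X hX he hc (ih hsep (Set.sdiff_subset_sdiff_left hSE) ?_ ?_)
    · exact Matroid.restrict_contract_eq_contract_restrict _ (Set.singleton_subset_iff.2 heS)
    · have h1 := hco _ _ hsep
      rw [Matroid.contract_ground, hsd _ _ _ heS] at h1 ⊢
      -- Contracting inside `S` leaves the complement unchanged: dually it is a deletion, and
      -- restriction to a separator commutes with duality.
      have h2 : (M ／ {e}) ↾ (M.E \ S) = M ↾ (M.E \ S) := by
        have hsub : M.E \ S ⊆ M.E \ {e} :=
          Set.subset_sdiff_singleton Set.sdiff_subset fun h => h.2 heS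
        rw [← Matroid.dual_inj, h1.restrict_dual hsub, (hco M S hS).restrict_dual Set.sdiff_subset,
          Matroid.dual_contract, Matroid.delete, Matroid.dual_ground, Matroid.restrict_restrict_eq _ hsub]
      rwa [h2]

end IsSPReducible


/-! ### Quasi series-parallel matroids as reducible matroids, and the bound on simple ones. -/

section QuasiSeriesParallel

open Set

variable {α : Type*} {M : Matroid α}

theorem component_restrict_of_isSeparator {S : Set α} (hS : IsSeparator M S) (hSE : S ⊆ M.E)
    {e : α} (he : e ∈ S) : component (M ↾ S) e = component M e := by
  ext f
  constructor
  · rintro (rfl | ⟨C, hC, h1, h2⟩)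
    · exact self_mem_component M f
    · exact Or.inr ⟨C, ((Matroid.restrict_isCircuit_iff hSE).1 hC).1, h1, h2⟩
  · rintro (rfl | ⟨C, hC, h1, h2⟩)
    · exact self_mem_component _ f
    · exact Or.inr ⟨C, hC.isCircuit_restrict_of_subset (hS C hC ⟨e, h1, he⟩), h1, h2⟩

theorem component_eq_singleton_of_isLoop {e : α} (he : M.IsLoop e) : component M e = {e} := by
  ext f
  constructor
  · rintro (rfl | ⟨C, hC, h1, h2⟩)
    · rfl
    · rwa [he.eq_of_isCircuit_mem hC h1] at h2
  · rintro rfl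
    exact self_mem_component M f

theorem IsSeriesParallel.isSPReducible (h : IsSeriesParallel M) : IsSPReducible M := by
  induction h with
  | loop e =>
    refine .parallel _ e ∅ Set.subsingleton_empty (Set.notMem_empty e) ?_ ?_
    · change (Matroid.loopyOn {e}).IsLoop e
      simp
    · convert IsSPReducible.empty
      rw [← Matroid.ground_eq_empty_iff]
      simp
  | coloop e =>
    refine .series _ e ∅ Set.subsingleton_empty (Set.notMem_empty e) ?_ ?_
    · change (Matroid.freeOn {e})✶.IsLoop e
      simp
    · convert IsSPReducible.empty
      rw [← Matroid.ground_eq_empty_iff]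
      simp
  | parallel M e f hef hC h ih =>
    refine .parallel M e {f} Set.subsingleton_singleton hef ?_ ih
    have := hC.mem_closure_sdiff_singleton_of_mem (Set.mem_insert e _)
    rwa [Set.pair_sdiff_left hef] at this
  | series M e f hef hC h ih =>
    refine .series M e {f} Set.subsingleton_singleton hef ?_ ih
    have := hC.isCircuit.mem_closure_sdiff_singleton_of_mem (Set.mem_insert e _)
    rwa [Set.pair_sdiff_left hef] at this

/-- In a connected matroid with an element that is a loop or parallel to another, either there are
no other elements or deleting the element gives a connected matroid. -/
theorem connected_delete_of_parallel [Finite α] {e : α} {X : Set α} (hX : X.Subsingleton)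
    (he : e ∉ X) (h : e ∈ M.closure X) (hconn : ∀ x ∈ M.E, ∀ y ∈ M.E, y ∈ component M x) :
    M = Matroid.loopyOn {e} ∨ ∃ f, e ≠ f ∧ M.IsCircuit {e, f} ∧ (M ＼ {e}).E.Nonempty ∧
      ∀ x ∈ (M ＼ {e}).E, ∀ y ∈ (M ＼ {e}).E, y ∈ component (M ＼ {e}) x := by
  classical
  have heE : e ∈ M.E := Matroid.mem_ground_of_mem_closure h
  by_cases hl : M.IsLoop e
  · left
    rw [Matroid.eq_loopyOn_iff_loops_eq]
    have hE : M.E = {e} := by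
      refine Set.Subset.antisymm (fun x hx => ?_) (Set.singleton_subset_iff.2 heE)
      have := hconn e heE x hx
      rwa [component_eq_singleton_of_isLoop hl] at this
    refine ⟨Set.Subset.antisymm ?_ (Set.singleton_subset_iff.2 hl), hE⟩
    rw [← hE]
    exact M.loops_subset_ground
  · right
    obtain rfl | ⟨f, rfl⟩ := hX.eq_empty_or_singleton
    · exact absurd h hl
    have hef : e ≠ f := he
    have hnl : M.IsNonloop e := Matroid.isNonloop_of_not_isLoop heE hl
    have hcl : M.closure {e} = M.closure {f} := hnl.closure_eq_of_mem_closure h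
    have hnf : M.IsNonloop f := hnl.isNonloop_of_mem_closure h
    have hC : M.IsCircuit {e, f} := (hnl.closure_eq_closure_iff_isCircuit_of_ne hef).1 hcl
    refine ⟨f, hef, hC, ⟨f, hnf.mem_ground, hef.symm⟩, ?_⟩
    rintro x ⟨hxE, hxe⟩ y ⟨hyE, hye⟩
    rcases hconn x hxE y hyE with rfl | ⟨C, hC', hxC, hyC⟩
    · exact self_mem_component _ _
    by_cases heC : e ∈ C
    · by_cases hfC : f ∈ C
      · have h1 : {e, f} = C := hC.eq_of_subset_isCircuit hC' (Set.pair_subset heC hfC)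
        rw [← h1] at hxC hyC
        have hxf : x = f := hxC.resolve_left hxe
        have hyf : y = f := hyC.resolve_left hye
        rw [hxf, hyf]
        exact self_mem_component _ _
      -- The circuit through `x` and `y` uses `e` but not `f`. Replacing `e` by the parallel element
      -- `f` gives a circuit that survives the deletion.
      · have h1 : M.IsCircuit (Equiv.swap e f '' C) := by
          have := mapEquiv_isCircuit M (Equiv.swap e f) (C := Equiv.swap e f '' C)
          rw [mapEquiv_swap_eq_self heE hnf.mem_ground hcl, Equiv.symm_image_image] at this
          exact this.2 hC'
        have h2 : ∀ z ∈ C, z ≠ e → z ∈ Equiv.swap e f '' C := by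
          intro z hz hze
          refine ⟨z, hz, Equiv.swap_apply_of_ne_of_ne hze fun h => hfC (h ▸ hz)⟩
        refine Or.inr ⟨_, ?_, h2 x hxC hxe, h2 y hyC hye⟩
        rw [Matroid.delete_isCircuit_iff, Set.disjoint_singleton_right]
        refine ⟨h1, ?_⟩
        rintro ⟨z, hz, hze⟩
        rw [Equiv.swap_apply_eq_iff, Equiv.swap_apply_left] at hze
        exact hfC (hze ▸ hz)
    · refine Or.inr ⟨C, ?_, hxC, hyC⟩
      rw [Matroid.delete_isCircuit_iff, Set.disjoint_singleton_right]
      exact ⟨hC', heC⟩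

/-- Connectedness survives each reduction, by `connected_delete_of_parallel` and its dual. Read
backwards, the reduction is a sequence of extensions starting from a single loop or coloop. -/
theorem IsSPReducible.isSeriesParallel [Finite α] (h : IsSPReducible M) (hne : M.E.Nonempty)
    (hconn : ∀ x ∈ M.E, ∀ y ∈ M.E, y ∈ component M x) : IsSeriesParallel M := by
  induction h with
  | empty => exact absurd rfl hne.ne_empty
  | parallel M e X hX he h hM ih =>
    rcases connected_delete_of_parallel hX he h hconn with h1 | ⟨f, hef, hC, h2, h3⟩
    · rw [h1]
      exact .loop e
    · exact .parallel M e f hef hC (ih h2 h3)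
  | series M e X hX he h hM ih =>
    rcases connected_delete_of_parallel (M := M✶) hX he h (by simpa only [component_dual]) with
      h1 | ⟨f, hef, hC, h2, h3⟩
    · rw [← Matroid.dual_inj] at h1
      rw [Matroid.dual_dual, Matroid.loopyOn_dual_eq] at h1
      rw [h1]
      exact .coloop e
    · refine .series M e f hef hC (ih h2 ?_)
      rw [← Matroid.dual_contract] at h3
      simp only [component_dual] at h3
      exact h3

/-- A matroid is quasi series-parallel if and only if it can be reduced to the empty matroid. -/
theorem isQuasiSeriesParallel_iff [Finite α] : IsQuasiSeriesParallel M ↔ IsSPReducible M := by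
  constructor
  · intro h
    induction hn : M.E.ncard using Nat.strong_induction_on generalizing M with
    | _ n ih =>
      subst hn
      rcases M.E.eq_empty_or_nonempty with hE | ⟨e, he⟩
      · rw [Matroid.ground_eq_empty_iff] at hE
        rw [hE]
        exact .empty
      · have hsub := component_subset_ground he
        have hsep := isSeparator_component M e
        have hsep' : IsSeparator M (M.E \ component M e) := by
          rintro C hC ⟨x, hxC, hx⟩ y hy
          exact ⟨hC.subset_ground hy, fun hyS => hx.2 (hsep C hC ⟨y, hy, hyS⟩ hxC)⟩
        -- Split off the component of `e`; the components of what is left are components of `M`, so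
        -- induction on the number of elements applies.
        refine (h _ ⟨e, he, rfl⟩).isSPReducible.of_isSeparator hsep hsub rfl (ih _ ?_ ?_ rfl)
        · refine Set.ncard_lt_ncard (Set.sdiff_subset.ssubset_of_ne fun h => ?_) (Set.toFinite _)
          exact (h.symm ▸ he : e ∈ M.E \ component M e).2 (self_mem_component M e)
        · rintro C ⟨f, hf, rfl⟩
          have hf' : f ∈ M.E \ component M e := hf
          have hsubf := component_subset_ground (M := M ↾ (M.E \ component M e)) hf
          rw [Matroid.restrict_restrict_eq _ (show _ ⊆ M.E \ component M e from hsubf),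
            component_restrict_of_isSeparator hsep' Set.sdiff_subset hf']
          exact h _ ⟨f, hf'.1, rfl⟩
  · rintro h C ⟨e, he, rfl⟩
    have hsub := component_subset_ground he
    refine (h.restrict hsub).isSeriesParallel ⟨e, self_mem_component M e⟩ ?_
    intro x hx y hy
    rw [component_restrict_of_isSeparator (isSeparator_component M e) hsub hx,
      component_eq_of_mem hx]
    exact hy

theorem encard_eq_rank_of_indep_ground [Finite α] (h : M.Indep M.E) : M.E.ncard = rank M := by
  rw [rank, ← M.eRk_ground, h.eRk_eq_encard, Set.ncard]

/-- A circuit inside `insert e X` would have at most two elements. Consequently no parallel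
reduction ever applies to a simple matroid. -/
theorem IsSimple.not_mem_closure (hM : IsSimple M) {e : α} {X : Set α} (hX : X.Subsingleton)
    (he : e ∉ X) : e ∉ M.closure X := by
  intro h
  obtain ⟨C, hC, h1, -⟩ := Matroid.exists_isCircuit_of_mem_closure h he
  have h2 := hM C h1
  have h3 : C.encard ≤ (insert e X).encard := Set.encard_le_encard hC
  have h4 : (insert e X).encard ≤ 2 := by
    refine (Set.encard_insert_le X e).trans ?_
    have := Set.encard_le_one_iff_subsingleton.2 hX
    exact (add_le_add_left this 1).trans (by norm_num)
  exact absurd (h2.trans_le (h3.trans h4)) (lt_irrefl _)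

theorem IsSimple.delete (hM : IsSimple M) (D : Set α) : IsSimple (M ＼ D) :=
  fun C hC => hM C hC.of_delete

theorem rank_contractElem [Finite α] {e : α} (he : M.IsNonloop e) :
    rank (M ／ {e}) + 1 = rank M := by
  rw [← setRank_add_rank_contract (Set.singleton_subset_iff.2 he.mem_ground), add_comm, setRank,
    he.eRk_eq]
  rfl

theorem rank_delete_le [Finite α] (D : Set α) : rank (M ＼ D) ≤ rank M := by
  rw [rank, rank, Matroid.delete_eq_restrict, Matroid.eRank_restrict]
  exact ENat.toNat_le_toNat (M.eRk_le_eRank _) (ne_top_of_le_ne_top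
    (Set.encard_ne_top_iff.2 (Set.toFinite M.E)) M.eRank_le_encard_ground)

/-- A nonempty simple quasi series-parallel matroid has fewer than twice as many elements as its
rank. -/
theorem IsSPReducible.ncard_lt_two_mul_rank [Finite α] (h : IsSPReducible M) (hs : IsSimple M)
    (hne : M.E.Nonempty) : M.E.ncard < 2 * rank M := by
  induction hn : M.E.ncard using Nat.strong_induction_on generalizing M with
  | _ n ih =>
    subst hn
    cases h with
    | empty => exact absurd rfl hne.ne_empty
    | parallel _ e X hX he h hM => exact absurd h (hs.not_mem_closure hX he)
    | series _ e X hX he h hM =>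
      have heE : e ∈ M.E := Matroid.mem_ground_of_mem_closure (M := M✶) h
      have hnl : M.IsNonloop e :=
        Matroid.isNonloop_of_not_isLoop heE (hs.not_mem_closure Set.subsingleton_empty
          (Set.notMem_empty e))
      have hrk := rank_contractElem hnl
      have hcard := Set.ncard_sdiff_singleton_add_one (s := M.E) heE
      -- Removing a coloop lowers size and rank by one each and keeps the matroid simple.
      by_cases hl : M✶.IsLoop e
      · rw [Matroid.contract_eq_delete_of_subset_coloops (Set.singleton_subset_iff.2 hl)] at hM hrk
        rcases (M ＼ {e}).E.eq_empty_or_nonempty with hE | hE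
        · rw [show M.E \ {e} = ∅ from hE, Set.ncard_empty] at hcard
          omega
        · have := ih _ (by rw [Matroid.delete_ground]; omega) hM (hs.delete _) hE rfl
          rw [Matroid.delete_ground] at this
          omega
      · obtain rfl | ⟨f, rfl⟩ := hX.eq_empty_or_singleton
        · exact absurd h hl
        have hef : e ≠ f := he
        have hnl' : M✶.IsNonloop e := Matroid.isNonloop_of_not_isLoop heE hl
        have hC : M.IsCocircuit {e, f} := (hnl'.closure_eq_closure_iff_isCircuit_of_ne hef).1
          (hnl'.closure_eq_of_mem_closure h)
        have hfE : f ∈ M.E := hC.subset_ground (Set.mem_insert_of_mem _ rfl)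
        have hcard' := Set.ncard_sdiff_singleton_add_one (s := M.E \ {e}) ⟨hfE, hef.symm⟩
        rcases (M ／ {e} ＼ {f}).E.eq_empty_or_nonempty with hE | hE
        -- Only `e` and `f` exist. Circuits of a simple matroid have more than two elements, so
        -- there are none: the matroid is free of rank two.
        · rw [show (M.E \ {e}) \ {f} = ∅ from hE, Set.ncard_empty] at hcard'
          have hind : M.Indep M.E := by
            rw [Matroid.indep_iff_forall_subset_not_isCircuit]
            intro C hC' hC
            have h1 := hs C hC
            have h2 := Set.encard_le_encard hC'
            rw [← (Set.toFinite M.E).cast_ncard_eq] at h2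
            have h3 := h1.trans_le h2
            have h4 : 2 < M.E.ncard := by exact_mod_cast h3
            omega
          have := encard_eq_rank_of_indep_ground hind
          omega
        -- Contracting `e` may create a two-element circuit, so the series partner `f` is deleted as
        -- well: two elements are lost for at least one unit of rank. A circuit of the minor lifts
        -- to a circuit `D` of `M` that avoids `f`; it cannot meet the cocircuit `{e, f}` in `e`
        -- alone, so it avoids `e` too and is a circuit of `M`.
        · have hsimple : IsSimple (M ／ {e} ＼ {f}) := by
            intro C hC'
            rw [Matroid.delete_isCircuit_iff, Set.disjoint_singleton_right] at hC'
            obtain ⟨D, hD, hCD, hDC⟩ := hC'.1.exists_subset_isCircuit_of_contract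
            have hfD : f ∉ D := fun h => (hDC h).elim hC'.2 fun h => hef h.symm
            have heD : e ∉ D := by
              intro heD
              refine hD.inter_isCocircuit_ne_singleton hC (e := e) ?_
              ext x
              simp only [Set.mem_inter_iff, Set.mem_insert_iff, Set.mem_singleton_iff]
              constructor
              · rintro ⟨hx, rfl | rfl⟩
                · rfl
                · exact absurd hx hfD
              · rintro rfl
                exact ⟨heD, Or.inl rfl⟩
            have : C = D := hCD.antisymm fun x hx =>
              (hDC hx).resolve_right fun h => heD ((Set.mem_singleton_iff.1 h) ▸ hx)
            rw [this]
            exact hs D hD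
          have := ih _ (by rw [Matroid.delete_ground, Matroid.contract_ground]; omega)
            (hM.delete _) hsimple hE rfl
          have hle := rank_delete_le (M := M ／ {e}) {f}
          rw [Matroid.delete_ground, Matroid.contract_ground] at this
          omega

end QuasiSeriesParallel


noncomputable section

/-! ### The element of the Dowling lattice attached to a labeled matroid. -/

section Flat

variable {ι : Type u} {G : Type v} [Group G]

theorem isLoop_iff_of_closure_eq {M : Matroid ι} {i j : ι} (hi : i ∈ M.E) (hj : j ∈ M.E)
    (h : M.closure {i} = M.closure {j}) : M.IsLoop i ↔ M.IsLoop j := by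
  rw [Matroid.isLoop_iff_closure_eq_loops hi, Matroid.isLoop_iff_closure_eq_loops hj, h]

theorem isNonloop_iff_of_closure_eq {M : Matroid ι} {i j : ι} (hi : i ∈ M.E) (hj : j ∈ M.E)
    (h : M.closure {i} = M.closure {j}) : M.IsNonloop i ↔ M.IsNonloop j := by
  rw [← Matroid.not_isLoop_iff hi, ← Matroid.not_isLoop_iff hj, isLoop_iff_of_closure_eq hi hj h]

theorem mem_component_of_closure_eq {M : Matroid ι} {i j : ι} (hi : M.IsNonloop i)
    (h : M.closure {i} = M.closure {j}) : j ∈ component M i := by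
  by_cases hij : i = j
  · exact Or.inl hij.symm
  · exact Or.inr ⟨{i, j}, (hi.closure_eq_closure_iff_isCircuit_of_ne hij).1 h,
      Set.mem_insert _ _, Set.mem_insert_of_mem _ rfl⟩

theorem MatroidOn.mem_ground (M : MatroidOn ι) (i : ι) : i ∈ M.1.E := M.2.symm ▸ Set.mem_univ i

/-- The partial `G`-partition of a `G`-labeled matroid whose blocks are the parallel classes. -/
def parallelPartition (M : MatroidOn ι) (f : ι → G) : PartialGPartition ι G where
  support := {i | M.1.IsNonloop i}
  rel i j := M.1.IsNonloop i ∧ M.1.closure {i} = M.1.closure {j}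
  label := f
  rel_refl _ hi := ⟨hi, rfl⟩
  rel_symm {i j} h :=
    ⟨(isNonloop_iff_of_closure_eq (M.mem_ground i) (M.mem_ground j) h.2).1 h.1, h.2.symm⟩
  rel_trans h h' := ⟨h.1, h.2.trans h'.2⟩
  mem_of_rel h := h.1

namespace LabeledMatroid

/-- The element of the Dowling lattice given by the nonloops, the parallel classes and the
labels of a labeled matroid. -/
def flat : LabeledMatroid ι G → DowlingLattice ι G :=
  Quotient.lift (fun x : MatroidOn ι × (ι → G) => DowlingLattice.mk (parallelPartition x.1 x.2)) (by
    rintro ⟨M, f⟩ ⟨N, f'⟩ ⟨h, h'⟩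
    obtain rfl : M = N := h
    refine Quotient.sound ⟨rfl, fun i j => Iff.rfl, fun i (hi : M.1.IsNonloop i) => ?_⟩
    obtain ⟨g, hg⟩ := h' _ ⟨i, hi.mem_ground, rfl⟩
    exact ⟨g, fun j hj => hg j (mem_component_of_closure_eq hi hj.2)⟩)

theorem flat_mk (M : MatroidOn ι) (f : ι → G) :
    (mk M f).flat = DowlingLattice.mk (parallelPartition M f) := rfl

theorem exact {M N : MatroidOn ι} {f f' : ι → G} (h : mk M f = mk N f') :
    M = N ∧ ∀ C, IsComponent M.1 C → ∃ g : G, ∀ i ∈ C, f i = g * f' i :=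
  Quotient.exact h

end LabeledMatroid

theorem mapEquiv_closure_singleton (M : Matroid ι) (σ : Equiv.Perm ι) (i : ι) :
    (M.mapEquiv σ).closure {i} = σ '' M.closure {σ⁻¹ i} := by
  rw [Matroid.mapEquiv_eq_map, Matroid.map_closure_eq]
  congr 2
  ext j
  simp [Equiv.eq_symm_apply]

theorem mapEquiv_isNonloop (M : Matroid ι) (σ : Equiv.Perm ι) (i : ι) :
    (M.mapEquiv σ).IsNonloop i ↔ M.IsNonloop (σ⁻¹ i) := by
  rw [← Matroid.indep_singleton, ← Matroid.indep_singleton, Matroid.mapEquiv_indep_iff,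
    Set.image_singleton]
  rfl

theorem parallelPartition_act (w : DowlingSym ι G) (M : MatroidOn ι) (f : ι → G) :
    parallelPartition (M.map w.perm) (w.actFun f) = w.actPartition (parallelPartition M f) := by
  have h1 : ∀ i, (M.map w.perm).1.IsNonloop i ↔ M.1.IsNonloop (w.perm⁻¹ i) :=
    mapEquiv_isNonloop M.1 w.perm
  have h2 : ∀ i, (M.map w.perm).1.closure {i} = w.perm '' M.1.closure {w.perm⁻¹ i} :=
    mapEquiv_closure_singleton M.1 w.perm
  simp only [parallelPartition, DowlingSym.actPartition, h1, h2,
    Set.image_eq_image w.perm.injective]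
  rfl

theorem LabeledMatroid.flat_smul (w : DowlingSym ι G) (x : LabeledMatroid ι G) :
    (w • x).flat = w • x.flat := by
  obtain ⟨M, f, rfl⟩ := x.exists_mk
  rw [LabeledMatroid.smul_mk, flat_mk, flat_mk, DowlingSym.smul_mk, parallelPartition_act]

/-- A labeled matroid is compatible with a partial `G`-partition if the elements outside of the
support are loops, elements of the same block are parallel (or loops), and the labels agree on
blocks. -/
def PartialGPartition.Compatible (p : PartialGPartition ι G) (M : Matroid ι) (f : ι → G) : Prop :=
  (∀ i ∉ p.support, M.IsLoop i) ∧ ∀ i j, p.rel i j →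
    M.closure {i} = M.closure {j} ∧ (p.label i)⁻¹ * p.label j = (f i)⁻¹ * f j

/-- This turns the order relation into a description of actual matroids. A representative has to be
chosen on the right: the flat ignores loops, whereas `Compatible` compares labels on all blocks of
`p`, including blocks that consist of loops. -/
theorem le_flat_iff {p : PartialGPartition ι G} {x : LabeledMatroid ι G} :
    DowlingLattice.mk p ≤ x.flat ↔ ∃ M f, LabeledMatroid.mk M f = x ∧ p.Compatible M.1 f := by
  classical
  constructor
  · intro h
    obtain ⟨M, f, rfl⟩ := x.exists_mk
    rw [LabeledMatroid.flat_mk, DowlingLattice.mk_le_mk] at h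
    have key : ∀ i, M.1.IsNonloop i → ∀ j, p.rel i j → M.1.closure {i} = M.1.closure {j} ∧
        (p.label i)⁻¹ * p.label j = (f i)⁻¹ * f j := by
      intro i hi j hij
      obtain ⟨g, hg⟩ := h.2 i hi
      have h1 := hg j hij
      have h2 := hg i (p.rel_refl i (p.mem_of_rel hij))
      refine ⟨h1.1.2, ?_⟩
      rw [h1.2, h2.2]
      change (g * f i)⁻¹ * (g * f j) = _
      group
    -- A loop is a component by itself, so its label may be changed freely within the class; it is
    -- set to the label of `p`.
    refine ⟨M, fun i => if M.1.IsLoop i then p.label i else f i,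
      LabeledMatroid.mk_eq_mk ?_, ?_, ?_⟩
    · rintro C ⟨e, he, rfl⟩
      by_cases hl : M.1.IsLoop e
      · rw [component_eq_singleton_of_isLoop hl]
        exact ⟨p.label e * (f e)⁻¹, by simp [hl]⟩
      · refine ⟨1, fun i hi => ?_⟩
        have : ¬ M.1.IsLoop i := by
          intro hi'
          have := mem_component_symm hi
          rw [component_eq_singleton_of_isLoop hi'] at this
          exact hl (Set.mem_singleton_iff.1 this ▸ hi')
        simp [this]
    · intro i hi
      by_contra hl
      exact hi (h.1 (Matroid.isNonloop_of_not_isLoop (M.mem_ground i) hl))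
    · intro i j hij
      by_cases hi : M.1.IsLoop i
      · have hj : M.1.IsLoop j := by
          by_contra hl
          have h1 := key j (Matroid.isNonloop_of_not_isLoop (M.mem_ground j) hl) i (p.rel_symm hij)
          exact hl ((isLoop_iff_of_closure_eq (M.mem_ground _) (M.mem_ground _) h1.1).2 hi)
        rw [hi.closure, hj.closure]
        simp [hi, hj]
      · have h1 := key i (Matroid.isNonloop_of_not_isLoop (M.mem_ground i) hi) j hij
        have hj : ¬ M.1.IsLoop j := fun hl =>
          hi ((isLoop_iff_of_closure_eq (M.mem_ground _) (M.mem_ground _) h1.1).2 hl)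
        refine ⟨h1.1, ?_⟩
        simp only [hi, hj, if_false]
        exact h1.2
  · rintro ⟨M, f, rfl, h⟩
    rw [LabeledMatroid.flat_mk, DowlingLattice.mk_le_mk]
    constructor
    · intro i (hi : M.1.IsNonloop i)
      by_contra h'
      exact (h.1 i h').not_isNonloop hi
    · intro i (hi : M.1.IsNonloop i)
      refine ⟨p.label i * (f i)⁻¹, fun j hij => ⟨⟨hi, (h.2 i j hij).1⟩, ?_⟩⟩
      change p.label j = p.label i * (f i)⁻¹ * f j
      rw [mul_assoc, ← (h.2 i j hij).2, mul_inv_cancel_left]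

theorem PartialGPartition.Compatible.congr {p q : PartialGPartition ι G} (h : p.Equivalent q)
    {M : Matroid ι} {f : ι → G} (hp : p.Compatible M f) : q.Compatible M f := by
  refine ⟨fun i hi => hp.1 i (h.1 ▸ hi), fun i j hij => ?_⟩
  have hij' := (h.2.1 i j).2 hij
  refine ⟨(hp.2 i j hij').1, ?_⟩
  rw [← (hp.2 i j hij').2]
  obtain ⟨g, hg⟩ := h.2.2 i (p.mem_of_rel hij')
  rw [hg j hij', hg i (p.rel_refl i (p.mem_of_rel hij'))]
  group

theorem PartialGPartition.Compatible.act {p : PartialGPartition ι G} {M : MatroidOn ι} {f : ι → G}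
    (h : p.Compatible M.1 f) (w : DowlingSym ι G) :
    (w.actPartition p).Compatible (M.map w.perm).1 (w.actFun f) := by
  constructor
  · intro i hi
    rw [← Matroid.not_isNonloop_iff (MatroidOn.mem_ground _ i)]
    change ¬ (M.1.mapEquiv w.perm).IsNonloop i
    rw [mapEquiv_isNonloop]
    exact (h.1 _ hi).not_isNonloop
  · intro i j hij
    obtain ⟨h1, h2⟩ := h.2 _ _ hij
    constructor
    · change (M.1.mapEquiv w.perm).closure {i} = (M.1.mapEquiv w.perm).closure {j}
      rw [mapEquiv_closure_singleton, mapEquiv_closure_singleton, h1]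
    · simp only [DowlingSym.actPartition, DowlingSym.actFun, mul_inv_rev]
      have h3 := congrArg w.aut h2
      rw [map_mul, map_mul, map_inv, map_inv] at h3
      calc _ = (w.vec (w.perm⁻¹ i))⁻¹ * ((w.aut (p.label (w.perm⁻¹ i)))⁻¹ *
            w.aut (p.label (w.perm⁻¹ j))) * w.vec (w.perm⁻¹ j) := by group
        _ = _ := by
          rw [h3]
          group

end Flat

/-! ### Matroids on the set of blocks, realized on transversals. -/

section Transversal

variable {ι : Type u} {G : Type v} [Group G]

/-- A set containing exactly one element of each block. -/
def PartialGPartition.IsTransversal (p : PartialGPartition ι G) (T : Set ι) : Prop :=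
  T ⊆ p.support ∧ (∀ i ∈ p.support, ∃ j ∈ T, p.rel i j) ∧ ∀ i ∈ T, ∀ j ∈ T, p.rel i j → i = j

/-- The number of blocks of a partial `G`-partition. -/
def PartialGPartition.numBlocks (p : PartialGPartition ι G) : ℕ :=
  ((fun i => {j | p.rel i j}) '' p.support).ncard

namespace PartialGPartition

variable {p q : PartialGPartition ι G} {T T' : Set ι}

omit [Group G] in
theorem setOf_rel_eq {i j : ι} (h : p.rel i j) : {l | p.rel i l} = {l | p.rel j l} :=
  Set.ext fun _ => ⟨fun h' => p.rel_trans (p.rel_symm h) h', fun h' => p.rel_trans h h'⟩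

omit [Group G] in
theorem IsTransversal.ncard_eq (hT : p.IsTransversal T) : T.ncard = p.numBlocks := by
  have h1 : (fun i => {j | p.rel i j}) '' p.support = (fun i => {j | p.rel i j}) '' T := by
    apply Set.Subset.antisymm
    · rintro _ ⟨i, hi, rfl⟩
      obtain ⟨j, hj, hij⟩ := hT.2.1 i hi
      exact ⟨j, hj, (setOf_rel_eq hij).symm⟩
    · exact Set.image_mono hT.1
  rw [numBlocks, h1, Set.InjOn.ncard_image]
  intro i hi j hj hij
  have h2 : j ∈ {l | p.rel j l} := p.rel_refl j (hT.1 hj)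
  rw [← show {l | p.rel i l} = {l | p.rel j l} from hij] at h2
  exact hT.2.2 i hi j hj h2

theorem IsTransversal.congr (h : p.Equivalent q) (hT : p.IsTransversal T) : q.IsTransversal T := by
  simpa only [IsTransversal, h.1, h.2.1] using hT

theorem IsTransversal.act (hT : p.IsTransversal T) (w : DowlingSym ι G) :
    (w.actPartition p).IsTransversal (w.perm '' T) := by
  refine ⟨?_, fun i hi => ?_, ?_⟩
  · rintro _ ⟨i, hi, rfl⟩
    change w.perm⁻¹ (w.perm i) ∈ p.support
    rw [show w.perm⁻¹ (w.perm i) = i from w.perm.symm_apply_apply i]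
    exact hT.1 hi
  · obtain ⟨j, hj, hij⟩ := hT.2.1 _ hi
    refine ⟨_, Set.mem_image_of_mem _ hj, ?_⟩
    change p.rel _ (w.perm⁻¹ (w.perm j))
    rwa [show w.perm⁻¹ (w.perm j) = j from w.perm.symm_apply_apply j]
  · rintro _ ⟨i, hi, rfl⟩ _ ⟨j, hj, rfl⟩ h
    change p.rel (w.perm⁻¹ (w.perm i)) (w.perm⁻¹ (w.perm j)) at h
    rw [show w.perm⁻¹ (w.perm i) = i from w.perm.symm_apply_apply i,
      show w.perm⁻¹ (w.perm j) = j from w.perm.symm_apply_apply j] at h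
    rw [hT.2.2 i hi j hj h]

omit [Group G] in
theorem exists_isTransversal (p : PartialGPartition ι G) : ∃ T, p.IsTransversal T := by
  classical
  let r : ι → ι := fun i => if h : {j | p.rel i j}.Nonempty then h.some else i
  have hr : ∀ i ∈ p.support, p.rel i (r i) := by
    intro i hi
    have h : {j | p.rel i j}.Nonempty := ⟨i, p.rel_refl i hi⟩
    simp only [r, dif_pos h]
    exact h.some_mem
  -- The representative is chosen from the block as a set, so elements of one block get the same
  -- one.
  have hr' : ∀ i j, p.rel i j → r i = r j := by
    intro i j hij
    have h : ∀ s s' : Set ι, s = s' → ∀ (h : s.Nonempty) (h' : s'.Nonempty), h.some = h'.some := by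
      rintro s _ rfl h h'
      rfl
    have h1 : {l | p.rel i l}.Nonempty := ⟨j, hij⟩
    have h2 : {l | p.rel j l}.Nonempty := ⟨i, p.rel_symm hij⟩
    simp only [r, dif_pos h1, dif_pos h2]
    exact h _ _ (setOf_rel_eq hij) _ _
  refine ⟨r '' p.support, ?_, fun i hi => ⟨r i, Set.mem_image_of_mem r hi, hr i hi⟩, ?_⟩
  · rintro _ ⟨i, hi, rfl⟩
    exact p.mem_of_rel (p.rel_symm (hr i hi))
  · rintro _ ⟨i, hi, rfl⟩ _ ⟨j, hj, rfl⟩ h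
    exact hr' _ _ (p.rel_trans (hr i hi) (p.rel_trans h (p.rel_symm (hr j hj))))

omit [Group G] in
theorem IsTransversal.exists_retraction (hT : p.IsTransversal T) :
    ∃ t : ι → ι, ∀ i ∈ p.support, t i ∈ T ∧ p.rel i (t i) := by
  classical
  choose t ht ht' using hT.2.1
  exact ⟨fun i => if h : i ∈ p.support then t i h else i, fun i hi => by
    simp only [dif_pos hi]
    exact ⟨ht i hi, ht' i hi⟩⟩

variable {M M' : Matroid ι} {f f' : ι → G} {t : ι → ι}

omit [Group G] in
theorem IsTransversal.injOn (hT : p.IsTransversal T)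
    (ht : ∀ i ∈ p.support, t i ∈ T' ∧ p.rel i (t i)) : Set.InjOn t T := by
  intro i hi j hj hij
  refine hT.2.2 i hi j hj ?_
  have h1 := (ht i (hT.1 hi)).2
  rw [hij] at h1
  exact p.rel_trans h1 (p.rel_symm (ht j (hT.1 hj)).2)

omit [Group G] in
theorem IsTransversal.image_eq (hT : p.IsTransversal T) (hT' : p.IsTransversal T')
    (ht : ∀ i ∈ p.support, t i ∈ T' ∧ p.rel i (t i)) : t '' T = T' := by
  apply Set.Subset.antisymm
  · rintro _ ⟨i, hi, rfl⟩
    exact (ht i (hT.1 hi)).1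
  · intro i hi
    obtain ⟨j, hj, hij⟩ := hT.2.1 i (hT'.1 hi)
    obtain ⟨h1, h2⟩ := ht j (hT.1 hj)
    exact ⟨j, hj, (hT'.2.2 i hi _ h1 (p.rel_trans hij h2)).symm⟩

omit [Group G] in
theorem IsTransversal.retraction_eq (hT : p.IsTransversal T)
    (ht : ∀ i ∈ p.support, t i ∈ T ∧ p.rel i (t i)) {i : ι} (hi : i ∈ T) : t i = i :=
  (hT.2.2 i hi _ (ht i (hT.1 hi)).1 (ht i (hT.1 hi)).2).symm

/-- Moving each element along its block is a replacement by parallel elements, so it identifies the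
restrictions to any two transversals. -/
theorem Compatible.restrict_map [Finite ι] (hM : p.Compatible M f) (hE : M.E = Set.univ)
    (hT : p.IsTransversal T) (hT' : p.IsTransversal T')
    (ht : ∀ i ∈ p.support, t i ∈ T' ∧ p.rel i (t i)) (hinj : Set.InjOn t (M ↾ T).E) :
    (M ↾ T).map t hinj = M ↾ T' := by
  refine Matroid.ext_indep (hT.image_eq hT' ht) fun I _ => ?_
  have key : ∀ J ⊆ T, (M.Indep (t '' J) ↔ M.Indep J) := fun J hJ =>
    indep_image_iff (hE ▸ Set.subset_univ _) (hE ▸ Set.subset_univ _)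
      (fun i hi => (hM.2 _ _ (ht i (hT.1 (hJ hi))).2).1.symm) ((hT.injOn ht).mono hJ)
  rw [Matroid.map_indep_iff, Matroid.restrict_indep_iff]
  constructor
  · rintro ⟨J, hJ, rfl⟩
    rw [Matroid.restrict_indep_iff] at hJ
    refine ⟨(key J hJ.2).2 hJ.1, ?_⟩
    rw [← hT.image_eq hT' ht]
    exact Set.image_mono hJ.2
  · rintro ⟨h1, h2⟩
    rw [← hT.image_eq hT' ht] at h2
    obtain ⟨J, hJ, rfl⟩ := Set.subset_image_iff.1 h2
    exact ⟨J, Matroid.restrict_indep_iff.2 ⟨(key J hJ).1 h1, hJ⟩, rfl⟩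

/-- The dual of the restriction to a transversal does not depend on the transversal. -/
theorem Compatible.restrict_eq_dual [Finite ι] (hM : p.Compatible M f) (hE : M.E = Set.univ)
    (hM' : p.Compatible M' f') (hE' : M'.E = Set.univ)
    (hT : p.IsTransversal T) (hT' : p.IsTransversal T') (h : M' ↾ T = (M ↾ T)✶) :
    M' ↾ T' = (M ↾ T')✶ := by
  obtain ⟨t, ht⟩ := hT'.exists_retraction
  have h1 : Set.InjOn t (M ↾ T).E := hT.injOn ht
  have h2 : Set.InjOn t (M' ↾ T).E := hT.injOn ht
  rw [← hM.restrict_map hE hT hT' ht h1, ← hM'.restrict_map hE' hT hT' ht h2, Matroid.map_dual]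
  simp only [h]

/-- An independent set contains no loops and at most one element of each block, and it may be slid
along the blocks into `T`. Hence a compatible matroid is determined by its restriction to a
transversal. -/
theorem Compatible.indep_iff [Finite ι] (hM : p.Compatible M f) (hE : M.E = Set.univ)
    (ht : ∀ i ∈ p.support, t i ∈ T ∧ p.rel i (t i)) {I : Set ι} :
    M.Indep I ↔ I ⊆ p.support ∧ Set.InjOn t I ∧ (M ↾ T).Indep (t '' I) := by
  have key : I ⊆ p.support → Set.InjOn t I → (M.Indep (t '' I) ↔ M.Indep I) := fun h h' =>
    indep_image_iff (hE ▸ Set.subset_univ _) (hE ▸ Set.subset_univ _)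
      (fun i hi => (hM.2 _ _ (ht i (h hi)).2).1.symm) h'
  constructor
  · intro hI
    have h1 : I ⊆ p.support := fun i hi => by
      by_contra h
      exact (hM.1 i h).not_isNonloop (hI.isNonloop_of_mem hi)
    have h2 : Set.InjOn t I := by
      intro i hi j hj hij
      by_contra hne
      have h3 := (ht i (h1 hi)).2
      rw [hij] at h3
      have h4 := (hM.2 _ _ (p.rel_trans h3 (p.rel_symm (ht j (h1 hj)).2))).1
      have h5 := ((hI.isNonloop_of_mem hi).closure_eq_closure_iff_isCircuit_of_ne hne).1 h4
      exact h5.not_indep (hI.subset (Set.pair_subset hi hj))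
    refine ⟨h1, h2, Matroid.restrict_indep_iff.2 ⟨(key h1 h2).2 hI, ?_⟩⟩
    rintro _ ⟨i, hi, rfl⟩
    exact (ht i (h1 hi)).1
  · rintro ⟨h1, h2, h3⟩
    exact (key h1 h2).1 (Matroid.restrict_indep_iff.1 h3).1

theorem Compatible.eq_of_restrict_eq [Finite ι] (hM : p.Compatible M f) (hE : M.E = Set.univ)
    (hM' : p.Compatible M' f') (hE' : M'.E = Set.univ) (hT : p.IsTransversal T)
    (h : M ↾ T = M' ↾ T) : M = M' := by
  obtain ⟨t, ht⟩ := hT.exists_retraction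
  refine Matroid.ext_indep (hE.trans hE'.symm) fun I _ => ?_
  rw [hM.indep_iff hE ht, hM'.indep_iff hE' ht, h]

/-- Every matroid on a transversal extends to a compatible matroid. -/
theorem exists_compatible [Finite ι] (hT : p.IsTransversal T) (N : Matroid ι) (hN : N.E = T)
    (hf : ∀ i j, p.rel i j → (p.label i)⁻¹ * p.label j = (f i)⁻¹ * f j) :
    ∃ M : MatroidOn ι, p.Compatible M.1 f ∧ M.1 ↾ T = N := by
  obtain ⟨t, ht⟩ := hT.exists_retraction
  -- Pulling back along the retraction makes each block parallel to its representative. Restricting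
  -- to the support and then to everything turns the elements off the support into loops.
  refine ⟨⟨((N.comap t) ↾ p.support) ↾ Set.univ, rfl⟩, ⟨fun i hi => ?_, fun i j hij =>
    ⟨?_, hf i j hij⟩⟩, ?_⟩
  · rw [← Matroid.not_isNonloop_iff (Set.mem_univ i), ← Matroid.indep_singleton]
    simp [hi]
  · have hi := p.mem_of_rel hij
    have hj := p.mem_of_rel (p.rel_symm hij)
    have htij : t i = t j := hT.2.2 _ (ht i hi).1 _ (ht j hj).1
      (p.rel_trans (p.rel_symm (ht i hi).2) (p.rel_trans hij (ht j hj).2))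
    simp [Set.inter_eq_left.2 (Set.singleton_subset_iff.2 hi),
      Set.inter_eq_left.2 (Set.singleton_subset_iff.2 hj), htij]
  · refine Matroid.ext_indep hN.symm fun I (hI : I ⊆ T) => ?_
    have h1 : t '' I = I := by
      have : Set.EqOn t id I := fun i hi => hT.retraction_eq ht (hI hi)
      rw [this.image_eq, Set.image_id]
    simp [h1, hI, hI.trans hT.1, (hT.injOn ht).mono hI]

theorem Compatible.exists_mem_closure (hM : p.Compatible M f) (hE : M.E = Set.univ)
    (hT : p.IsTransversal T) (i : ι) : ∃ X ⊆ T, X.Subsingleton ∧ i ∈ M.closure X := by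
  by_cases hi : i ∈ p.support
  · obtain ⟨j, hj, hij⟩ := hT.2.1 i hi
    refine ⟨{j}, Set.singleton_subset_iff.2 hj, Set.subsingleton_singleton, ?_⟩
    rw [← (hM.2 i j hij).1]
    exact M.mem_closure_of_mem' rfl (hE ▸ Set.mem_univ i)
  · exact ⟨∅, Set.empty_subset _, Set.subsingleton_empty, hM.1 i hi⟩

/-- Outside `T` there are only loops and elements in the span of a single element of `T`; these can
be removed first in one direction, and in the other direction reducibility passes to restrictions.
-/
theorem Compatible.isSPReducible_restrict_iff [Finite ι] (hM : p.Compatible M f)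
    (hE : M.E = Set.univ) (hT : p.IsTransversal T) :
    IsSPReducible (M ↾ T) ↔ IsSPReducible M :=
  ⟨fun h => h.of_restrict (hE ▸ Set.subset_univ T) fun i _ _ => hM.exists_mem_closure hE hT i,
    fun h => h.restrict (hE ▸ Set.subset_univ T)⟩

theorem Compatible.rank_restrict (hM : p.Compatible M f) (hE : M.E = Set.univ)
    (hT : p.IsTransversal T) : rank (M ↾ T) = rank M := by
  have h1 : M.closure T = M.E := by
    refine (M.closure_subset_ground T).antisymm fun i _ => ?_
    obtain ⟨X, hX, -, hi⟩ := hM.exists_mem_closure hE hT i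
    exact M.closure_subset_closure hX hi
  rw [rank, Matroid.eRank_restrict, ← M.eRk_closure_eq, h1, M.eRk_ground, rank]

theorem rank_dual_add_rank [Finite ι] (N : Matroid ι) : rank N + rank N✶ = N.E.ncard := by
  have h : ∀ N : Matroid ι, N.eRank ≠ ⊤ := fun N => ne_top_of_le_ne_top
    (Set.encard_ne_top_iff.2 (Set.toFinite N.E)) N.eRank_le_encard_ground
  rw [rank, rank, ← ENat.toNat_add (h N) (h N✶), N.eRank_add_eRank_dual]
  rfl

/-- Equivalence of compatible labelings can be tested on a transversal. -/
theorem Compatible.equivalent_iff [Finite ι] (hM : p.Compatible M f) (hM' : p.Compatible M f')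
    (hE : M.E = Set.univ) (hT : p.IsTransversal T) :
    (∀ C, IsComponent M C → ∃ g : G, ∀ i ∈ C, f i = g * f' i) ↔
      ∀ i ∈ T, ∀ j ∈ T, j ∈ component (M ↾ T) i → f i * (f' i)⁻¹ = f j * (f' j)⁻¹ := by
  have hTE : T ⊆ M.E := hE ▸ Set.subset_univ T
  constructor
  · intro h i hi j hj hij
    obtain ⟨g, hg⟩ := h _ ⟨i, hTE hi, rfl⟩
    have hij' : j ∈ component M i := by
      rcases hij with h | ⟨C, hC, h1, h2⟩
      · exact Or.inl h
      · exact Or.inr ⟨C, ((Matroid.restrict_isCircuit_iff hTE).1 hC).1, h1, h2⟩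
    rw [hg i (self_mem_component M i), hg j hij', mul_inv_cancel_right, mul_inv_cancel_right]
  · rintro h C ⟨e, he, rfl⟩
    refine ⟨f e * (f' e)⁻¹, fun i hi => ?_⟩
    rw [← mul_inv_eq_iff_eq_mul]
    rcases hi with rfl | ⟨C, hC, heC, hiC⟩
    · rfl
    by_cases hie : i = e
    · rw [hie]
    obtain ⟨t, ht⟩ := hT.exists_retraction
    have hnt : C.Nontrivial := ⟨i, hiC, e, heC, hie⟩
    have hsupp : ∀ x ∈ C, x ∈ p.support := by
      intro x hx
      by_contra h
      exact (hM.1 x h).not_isNonloop (hC.isNonloop_of_mem hnt hx)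
    -- Both labelings have the variation prescribed by `p` along a block, so their ratio is constant
    -- on blocks and may be evaluated at representatives.
    have hlab : ∀ x ∈ p.support, f x * (f' x)⁻¹ = f (t x) * (f' (t x))⁻¹ := by
      intro x hx
      have h1 := (hM.2 _ _ (ht x hx).2).2
      rw [(hM'.2 _ _ (ht x hx).2).2] at h1
      have h2 : f (t x) = f x * ((f' x)⁻¹ * f' (t x)) := by rw [h1, mul_inv_cancel_left]
      rw [h2]
      group
    rw [hlab i (hsupp i hiC), hlab e (hsupp e heC)]
    by_cases hte : t i = t e
    · rw [hte]
    refine h _ (ht i (hsupp i hiC)).1 _ (ht e (hsupp e heC)).1 (mem_component_symm ?_)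
    have hcl : ∀ x ∈ C, M.closure {t x} = M.closure {x} := fun x hx =>
      (hM.2 _ _ (ht x (hsupp x hx)).2).1.symm
    -- If two elements of `C` shared a block they would be parallel, so `C` would be that pair, and
    -- `i` and `e` would have the same representative. Thus `C` slides injectively to a circuit
    -- inside `T`.
    have hinj : Set.InjOn t C := by
      intro x hx y hy hxy
      by_contra hne
      have h1 : M.closure {x} = M.closure {y} := by rw [← hcl x hx, ← hcl y hy, hxy]
      have h2 := ((hC.isNonloop_of_mem hnt hx).closure_eq_closure_iff_isCircuit_of_ne hne).1 h1
      have h3 := h2.eq_of_subset_isCircuit hC (Set.pair_subset hx hy)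
      rw [← h3] at hiC heC
      rcases hiC with rfl | rfl <;> rcases heC with rfl | rfl
      · exact hie rfl
      · exact hte hxy
      · exact hte hxy.symm
      · exact hie rfl
    have hu : ∀ X : Set ι, X ⊆ M.E := fun X => hE ▸ Set.subset_univ X
    refine Or.inr ⟨t '' C, ?_, Set.mem_image_of_mem t heC, Set.mem_image_of_mem t hiC⟩
    rw [Matroid.restrict_isCircuit_iff hTE]
    constructor
    · rw [Matroid.isCircuit_iff_forall_ssubset, Matroid.dep_iff, and_iff_left (hu _),
        indep_image_iff (hu _) (hu _) hcl hinj]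
      refine ⟨hC.not_indep, fun I hI => ?_⟩
      obtain ⟨J, hJ, rfl⟩ := Set.subset_image_iff.1 hI.subset
      rw [indep_image_iff (hu _) (hu _) (fun x hx => hcl x (hJ hx)) (hinj.mono hJ)]
      refine hC.ssubset_indep (hJ.ssubset_of_ne ?_)
      rintro rfl
      exact hI.ne rfl
    · rintro _ ⟨x, hx, rfl⟩
      exact (ht x (hsupp x hx)).1

end PartialGPartition

end Transversal

end


theorem isSimple_iff {α : Type*} {M : Matroid α} :
    IsSimple M ↔ (∀ i, ¬ M.IsLoop i) ∧ ∀ i j, i ≠ j → ¬ M.IsCircuit {i, j} := by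
  constructor
  · refine fun h => ⟨fun i hi => ?_, fun i j hij hC => ?_⟩
    · have := h _ (Matroid.singleton_isCircuit.2 hi)
      simp at this
    · have := h _ hC
      rw [Set.encard_pair hij] at this
      exact lt_irrefl _ this
  · rintro ⟨h, h'⟩ C hC
    by_contra hle
    rw [not_lt] at hle
    rcases lt_or_eq_of_le hle with hlt | heq
    · have h1 : C.encard = 1 :=
        le_antisymm (ENat.lt_add_one_iff (by simp) |>.1 (by rwa [one_add_one_eq_two]))
          (Set.one_le_encard_iff_nonempty.2 hC.nonempty)
      obtain ⟨i, rfl⟩ := Set.encard_eq_one.1 h1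
      exact h i (Matroid.singleton_isCircuit.1 hC)
    · obtain ⟨i, j, hij, rfl⟩ := Set.encard_eq_two.1 heq
      exact h' i j hij hC

/-! ### Duality on the matroids above a given partial partition. -/

section Duality

variable {ι : Type u} {G : Type v} [Group G]

/-- Duality on the classes of labeled matroids that are compatible with `p`: the matroid on the set
of blocks is replaced by its dual. -/
def PartialGPartition.IsDual (p : PartialGPartition ι G) (x y : LabeledMatroid ι G) : Prop :=
  ∃ T M M' f, p.IsTransversal T ∧ p.Compatible M.1 f ∧ p.Compatible M'.1 f ∧
    M'.1 ↾ T = (M.1 ↾ T)✶ ∧ LabeledMatroid.mk M f = x ∧ LabeledMatroid.mk M' f = y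

namespace PartialGPartition

variable {p : PartialGPartition ι G} {x y y' : LabeledMatroid ι G}

theorem IsDual.symm (h : p.IsDual x y) : p.IsDual y x := by
  obtain ⟨T, M, M', f, hT, h1, h2, h3, h4, h5⟩ := h
  exact ⟨T, M', M, f, hT, h2, h1, by rw [h3, Matroid.dual_dual], h5, h4⟩

theorem IsDual.le_flat (h : p.IsDual x y) : DowlingLattice.mk p ≤ x.flat := by
  obtain ⟨T, M, M', f, -, h1, -, -, h4, -⟩ := h
  exact le_flat_iff.2 ⟨M, f, h4, h1⟩

theorem exists_isDual [Finite ι] (h : DowlingLattice.mk p ≤ x.flat) : ∃ y, p.IsDual x y := by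
  obtain ⟨M, f, rfl, hM⟩ := le_flat_iff.1 h
  obtain ⟨T, hT⟩ := p.exists_isTransversal
  obtain ⟨M', h1, h2⟩ := exists_compatible hT (M.1 ↾ T)✶ rfl fun i j hij => (hM.2 i j hij).2
  exact ⟨_, T, M, M', f, hT, hM, h1, h2, rfl, rfl⟩

/-- The dual depends neither on the transversal nor on the representatives. Equivalence of
compatible labelings only sees the components of the matroid on the transversal, and those agree for
a matroid and its dual. -/
theorem IsDual.unique [Finite ι] (h : p.IsDual x y) (h' : p.IsDual x y') : y = y' := by
  obtain ⟨T, M, M', f, hT, h1, h2, h3, h4, rfl⟩ := h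
  obtain ⟨U, N, N', f', hU, k1, k2, k3, k4, rfl⟩ := h'
  obtain ⟨rfl, hf⟩ := LabeledMatroid.exact (h4.trans k4.symm)
  have h5 := h1.restrict_eq_dual M.2 h2 M'.2 hT hU h3
  obtain rfl : M' = N' := Subtype.ext (h2.eq_of_restrict_eq M'.2 k2 N'.2 hU (h5.trans k3.symm))
  refine LabeledMatroid.mk_eq_mk ?_
  rw [h1.equivalent_iff k1 M.2 hT] at hf
  rw [h2.equivalent_iff k2 M'.2 hT, h3]
  simpa only [component_dual] using hf

theorem IsDual.smul (h : p.IsDual x y) (w : DowlingSym ι G)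
    (hw : w • DowlingLattice.mk p = DowlingLattice.mk p) : p.IsDual (w • x) (w • y) := by
  obtain ⟨T, M, M', f, hT, h1, h2, h3, rfl, rfl⟩ := h
  have he : (w.actPartition p).Equivalent p := Quotient.exact hw
  refine ⟨w.perm '' T, M.map w.perm, M'.map w.perm, w.actFun f, (hT.act w).congr he,
    (h1.act w).congr he, (h2.act w).congr he, ?_, rfl, rfl⟩
  change (M'.1.mapEquiv w.perm) ↾ _ = ((M.1.mapEquiv w.perm) ↾ _)✶
  rw [mapEquiv_restrict, mapEquiv_restrict, mapEquiv_dual, Equiv.symm_image_image, h3]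

theorem IsDual.isQuasiSeriesParallel [Finite ι] (h : p.IsDual x y)
    (hx : IsQuasiSeriesParallel x.matroid) : IsQuasiSeriesParallel y.matroid := by
  obtain ⟨T, M, M', f, hT, h1, h2, h3, rfl, rfl⟩ := h
  rw [isQuasiSeriesParallel_iff, LabeledMatroid.matroid_mk] at hx ⊢
  rw [← h2.isSPReducible_restrict_iff M'.2 hT, h3]
  exact ((h1.isSPReducible_restrict_iff M.2 hT).2 hx).dual

theorem IsDual.rank_add_rank [Finite ι] (h : p.IsDual x y) :
    rank x.matroid + rank y.matroid = p.numBlocks := by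
  obtain ⟨T, M, M', f, hT, h1, h2, h3, rfl, rfl⟩ := h
  rw [LabeledMatroid.matroid_mk, LabeledMatroid.matroid_mk, ← h1.rank_restrict M.2 hT,
    ← h2.rank_restrict M'.2 hT, h3, rank_dual_add_rank, Matroid.restrict_ground_eq, hT.ncard_eq]

/-- The rank is at most the number of blocks. -/
theorem rank_le_numBlocks [Finite ι] (h : DowlingLattice.mk p ≤ x.flat) :
    rank x.matroid ≤ p.numBlocks := by
  obtain ⟨y, hy⟩ := exists_isDual h
  exact hy.rank_add_rank ▸ Nat.le_add_right _ _

/-- When the flat is exactly `p`, distinct elements of a transversal are nonparallel nonloops, so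
the restriction to it is simple and the bound for simple reducible matroids applies. -/
theorem numBlocks_lt_two_mul_rank [Finite ι] (h : x.flat = DowlingLattice.mk p)
    (hx : IsQuasiSeriesParallel x.matroid) (hp : 0 < p.numBlocks) :
    p.numBlocks < 2 * rank x.matroid := by
  obtain ⟨M, f, rfl, hM⟩ := le_flat_iff.1 h.ge
  obtain ⟨T, hT⟩ := p.exists_isTransversal
  rw [isQuasiSeriesParallel_iff, LabeledMatroid.matroid_mk] at hx
  rw [← hT.ncard_eq] at hp
  rw [LabeledMatroid.matroid_mk, ← hM.rank_restrict M.2 hT, ← hT.ncard_eq]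
  have hE : T ⊆ M.1.E := fun i _ => M.mem_ground i
  have he : (parallelPartition M f).Equivalent p := Quotient.exact h
  have hnl : ∀ i ∈ T, M.1.IsNonloop i := fun i hi => by
    have h1 := hT.1 hi
    rw [← he.1] at h1
    exact h1
  refine ((hM.isSPReducible_restrict_iff M.2 hT).2 hx).ncard_lt_two_mul_rank ?_
    (Set.nonempty_of_ncard_ne_zero hp.ne')
  refine isSimple_iff.2 ⟨fun i hi => ?_, fun i j hij hC => ?_⟩
  · rw [← Matroid.singleton_isCircuit, Matroid.restrict_isCircuit_iff hE] at hi
    exact (Matroid.singleton_isCircuit.1 hi.1).not_isNonloop (hnl i (hi.2 rfl))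
  · rw [Matroid.restrict_isCircuit_iff hE] at hC
    have hi := hC.2 (Set.mem_insert i {j})
    have hj := hC.2 (Set.mem_insert_of_mem i (Set.mem_singleton j))
    refine hij (hT.2.2 i hi j hj ((he.2.1 i j).1 ⟨hnl i hi, ?_⟩))
    exact ((hnl i hi).closure_eq_closure_iff_isCircuit_of_ne hij).2 hC.1

omit [Group G] in
theorem support_eq_empty [Finite ι] (hp : p.numBlocks = 0) : p.support = ∅ := by
  rw [numBlocks, Set.ncard_eq_zero] at hp
  exact Set.image_eq_empty.1 hp

/-- With no blocks every element is a loop and a component of its own, so all labelings are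
equivalent. This is the rank-zero case of the recursion. -/
theorem eq_of_numBlocks_eq_zero [Finite ι] (hp : p.numBlocks = 0)
    (hx : DowlingLattice.mk p ≤ x.flat) (hy : DowlingLattice.mk p ≤ y.flat) : x = y := by
  obtain ⟨M, f, rfl, hM⟩ := le_flat_iff.1 hx
  obtain ⟨N, f', rfl, hN⟩ := le_flat_iff.1 hy
  have hs := support_eq_empty hp
  have key : ∀ M : MatroidOn ι, ∀ f : ι → G, p.Compatible M.1 f → M.1 = Matroid.loopyOn Set.univ :=
    fun M f hM => Matroid.eq_loopyOn_iff.2 ⟨M.2, fun X _ hX => by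
      by_contra hne
      obtain ⟨i, hi⟩ := Set.nonempty_iff_ne_empty.2 hne
      exact (hM.1 i (hs ▸ Set.notMem_empty i)).not_isNonloop (hX.isNonloop_of_mem hi)⟩
  obtain rfl : M = N := Subtype.ext ((key M f hM).trans (key N f' hN).symm)
  refine LabeledMatroid.mk_eq_mk ?_
  rintro C ⟨e, -, rfl⟩
  rw [component_eq_singleton_of_isLoop (hM.1 e (hs ▸ Set.notMem_empty e))]
  exact ⟨f e * (f' e)⁻¹, by simp⟩

theorem exists_flat_eq [Finite ι] (hp : p.numBlocks = 0) : ∃ x : LabeledMatroid ι G,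
    x.flat = DowlingLattice.mk p ∧ IsQuasiSeriesParallel x.matroid ∧ rank x.matroid = 0 := by
  have hs := support_eq_empty hp
  have h1 : ∀ i, ¬ p.rel i i := fun i hi => Set.notMem_empty i (hs ▸ p.mem_of_rel hi)
  refine ⟨LabeledMatroid.mk ⟨Matroid.loopyOn Set.univ, rfl⟩ 1, le_antisymm ?_ ?_, ?_, ?_⟩
  · exact DowlingLattice.mk_le_mk.2 ⟨hs ▸ Set.empty_subset _,
      fun i hi => absurd hi (hs ▸ Set.notMem_empty i)⟩
  · refine le_flat_iff.2 ⟨_, _, rfl, fun i _ => ?_, fun i j hij => ?_⟩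
    · exact Matroid.loopyOn_isLoop_iff.2 (Set.mem_univ i)
    · exact absurd (p.rel_trans hij (p.rel_symm hij)) (h1 i)
  · rintro C ⟨e, he, rfl⟩
    rw [LabeledMatroid.matroid_mk] at he ⊢
    rw [component_eq_singleton_of_isLoop (Matroid.loopyOn_isLoop_iff.2 (Set.mem_univ e)),
      Matroid.loopyOn_restrict]
    exact .loop e
  · rw [LabeledMatroid.matroid_mk, rank, Matroid.eRank_loopyOn]
    rfl

end PartialGPartition

end Duality


noncomputable section

/-! ### Flats, closure and rank in the Dowling geometry. -/

section DowlingRank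

variable {ι : Type u} {G : Type v} [Group G]

/-- The set of atoms below an element of the lattice of partial `G`-partitions. -/
def below (a : DowlingLattice ι G) : Set (DowlingPoint ι G) := {b | b.1 ≤ a}

theorem mem_below {a : DowlingLattice ι G} {b : DowlingPoint ι G} : b ∈ below a ↔ b.1 ≤ a := Iff.rfl

/-- Compatibility with `p` is a conjunction of single equations, `y i = 0` off the support and one
equation for each related pair, and each of them is an atom below `p`. Hence elements of the lattice
are determined by their atoms. -/
theorem PartialGPartition.sat_of_below {p : PartialGPartition ι G} {y : ι → WithZero G}
    (h : ∀ b ∈ below (DowlingLattice.mk p), b.1.Sat y) : p.Sat y := by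
  refine ⟨fun i hi => ?_, fun i j hij => ?_⟩
  · rw [← PartialGPartition.joint_sat (G := G), ← DowlingLattice.sat_mk]
    refine h ⟨_, PartialGPartition.isAtom_joint i⟩ (mem_below.2 <|
      DowlingLattice.le_iff_sat.2 fun z hz => ?_)
    rw [DowlingLattice.sat_mk] at hz ⊢
    exact PartialGPartition.joint_sat.2 (hz.1 i hi)
  · by_cases hne : i = j
    · subst hne
      simp
    rw [← PartialGPartition.edge_sat hne, ← DowlingLattice.sat_mk]
    refine h ⟨_, PartialGPartition.isAtom_edge hne _⟩ (mem_below.2 <|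
      DowlingLattice.le_iff_sat.2 fun z hz => ?_)
    rw [DowlingLattice.sat_mk] at hz ⊢
    exact (PartialGPartition.edge_sat hne).2 (hz.2 i j hij)

theorem below_subset_below {a b : DowlingLattice ι G} : below a ⊆ below b ↔ a ≤ b := by
  refine ⟨fun h => ?_, fun h c hc => le_trans hc h⟩
  obtain ⟨p, rfl⟩ := a.exists_mk
  refine DowlingLattice.le_iff_sat.2 fun y hy => DowlingLattice.sat_mk.2 ?_
  exact PartialGPartition.sat_of_below fun c hc => DowlingLattice.le_iff_sat.1 (h hc) y hy

theorem below_injective : Function.Injective (below : DowlingLattice ι G → _) := fun _ _ h =>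
  le_antisymm (below_subset_below.1 h.subset) (below_subset_below.1 h.superset)

theorem smul_below (w : DowlingSym ι G) (a : DowlingLattice ι G) :
    w • below a = below (w • a) := by
  ext b
  rw [Set.mem_smul_set_iff_inv_smul_mem]
  change w⁻¹ • b.1 ≤ a ↔ b.1 ≤ w • a
  rw [← w.smul_le_iff, smul_inv_smul]

variable [Finite ι] [Finite G]

theorem isFlat_below (a : DowlingLattice ι G) : (dowlingGeometry ι G).IsFlat (below a) :=
  (dowlingGeometry_spec.2 _).2 ⟨a, rfl⟩

/-- For one potential, the atoms compatible with it are those below a single lattice element, so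
they form a flat; conversely every flat is cut out by the potentials compatible with its lattice
element. Closure thus becomes implication between equations. -/
theorem mem_dowlingGeometry_closure {X : Set (DowlingPoint ι G)} {a : DowlingPoint ι G} :
    a ∈ (dowlingGeometry ι G).closure X ↔ ∀ y, (∀ b ∈ X, b.1.Sat y) → a.1.Sat y := by
  rw [Matroid.mem_closure_iff_forall_mem_isFlat X (by
    rw [dowlingGeometry_spec.1]
    exact Set.subset_univ X)]
  constructor
  · intro h y hy
    obtain ⟨p, hp⟩ := exists_largest_sat {y}
    have h1 := h _ (isFlat_below (DowlingLattice.mk p)) fun b hb =>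
      (hp b.1).2 (by simpa using hy b hb)
    simpa using (hp a.1).1 h1
  · intro h F hF hX
    obtain ⟨q, rfl⟩ := (dowlingGeometry_spec.2 F).1 hF
    exact DowlingLattice.le_iff_sat.2 fun y hy =>
      h y fun b hb => DowlingLattice.le_iff_sat.1 (hX hb) y hy

open Classical in
/-- The atom expressing that `i` lies outside of the support, or its relation to the representative
`t i` of its block. -/
def PartialGPartition.atom (p : PartialGPartition ι G) (t : ι → ι) (i : ι) : DowlingPoint ι G :=
  if h : i ∈ p.support ∧ t i ≠ i then
    ⟨_, PartialGPartition.isAtom_edge h.2 ((p.label (t i))⁻¹ * p.label i)⟩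
  else ⟨_, PartialGPartition.isAtom_joint i⟩

/-- A basis of the flat has one atom for each element outside a transversal, relating it to its
representative or setting it to zero. Together these equations imply all those of `p`. -/
theorem PartialGPartition.setRank_below (p : PartialGPartition ι G) :
    setRank (dowlingGeometry ι G) (below (DowlingLattice.mk p)) + p.numBlocks = Nat.card ι := by
  classical
  obtain ⟨T, hT⟩ := p.exists_isTransversal
  obtain ⟨t, ht⟩ := hT.exists_retraction
  have hne : ∀ i ∉ T, i ∈ p.support → t i ≠ i := fun i hi hi' h => hi (h ▸ (ht i hi').1)
  have hsat : ∀ i ∉ T, ∀ y, (p.atom t i).1.Sat y ↔ if i ∈ p.support then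
      y i = y (t i) * ((p.label (t i))⁻¹ * p.label i : G) else y i = 0 := by
    intro i hi y
    by_cases h : i ∈ p.support
    · have h1 : i ∈ p.support ∧ t i ≠ i := ⟨h, hne i hi h⟩
      rw [if_pos h, atom, dif_pos h1, DowlingLattice.sat_mk, edge_sat h1.2]
    · have h1 : ¬ (i ∈ p.support ∧ t i ≠ i) := fun h' => h h'.1
      rw [if_neg h, atom, dif_neg h1, DowlingLattice.sat_mk, joint_sat]
  -- The indicator of `i` violates the equation of `i` and satisfies those of all other elements
  -- outside `T`, so the atoms are independent.
  let y₀ : ι → ι → WithZero G := fun i j => if j = i then 1 else 0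
  have hy₁ : ∀ i ∉ T, ¬ (p.atom t i).1.Sat (y₀ i) := by
    intro i hi
    rw [hsat i hi]
    split_ifs with h
    · simp [y₀, hne i hi h]
    · simp [y₀]
  have hy₂ : ∀ i ∉ T, ∀ j ∉ T, j ≠ i → (p.atom t j).1.Sat (y₀ i) := by
    intro i hi j hj hij
    rw [hsat j hj]
    split_ifs with h
    · have : t j ≠ i := fun h' => hi (h' ▸ (ht j h).1)
      simp [y₀, hij, this]
    · simp [y₀, hij]
  have hinj : Set.InjOn (p.atom t) Tᶜ := by
    intro i hi j hj hij
    by_contra h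
    exact hy₁ j hj (hij ▸ hy₂ j hj i hi h)
  have hE : ∀ X, X ⊆ (dowlingGeometry ι G).E := fun X => by
    rw [dowlingGeometry_spec.1]
    exact Set.subset_univ X
  have hindep : (dowlingGeometry ι G).Indep (p.atom t '' Tᶜ) := by
    rw [Matroid.indep_iff_forall_notMem_closure_sdiff (hE _)]
    rintro _ ⟨i, hi, rfl⟩ h
    rw [mem_dowlingGeometry_closure] at h
    refine hy₁ i hi (h _ ?_)
    rintro _ ⟨⟨j, hj, rfl⟩, hne⟩
    exact hy₂ i hi j hj fun h => hne (by rw [h]; rfl)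
  have hsub : p.atom t '' Tᶜ ⊆ below (DowlingLattice.mk p) := by
    rintro _ ⟨i, hi, rfl⟩
    refine mem_below.2 (DowlingLattice.le_iff_sat.2 fun y hy => (hsat i hi y).2 ?_)
    rw [DowlingLattice.sat_mk] at hy
    split_ifs with h
    · exact hy.2 _ _ (p.rel_symm (ht i h).2)
    · exact hy.1 i h
  have hspan : below (DowlingLattice.mk p) ⊆ (dowlingGeometry ι G).closure (p.atom t '' Tᶜ) := by
    intro a ha
    rw [mem_dowlingGeometry_closure]
    intro y hy
    refine DowlingLattice.le_iff_sat.1 ha y (DowlingLattice.sat_mk.2 ?_)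
    have h1 : ∀ i ∈ p.support, y i = y (t i) * ((p.label (t i))⁻¹ * p.label i : G) := by
      intro i hi
      by_cases hiT : i ∈ T
      · simp [hT.retraction_eq ht hiT]
      · have := (hsat i hiT y).1 (hy _ (Set.mem_image_of_mem _ hiT))
        rwa [if_pos hi] at this
    refine ⟨fun i hi => ?_, fun i j hij => ?_⟩
    · have hiT : i ∉ T := fun h => hi (hT.1 h)
      have := (hsat i hiT y).1 (hy _ (Set.mem_image_of_mem _ hiT))
      rwa [if_neg hi] at this
    · have hi := p.mem_of_rel hij
      have hj := p.mem_of_rel (p.rel_symm hij)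
      have htij : t i = t j := hT.2.2 _ (ht i hi).1 _ (ht j hj).1
        (p.rel_trans (p.rel_symm (ht i hi).2) (p.rel_trans hij (ht j hj).2))
      rw [h1 i hi, h1 j hj, htij, mul_assoc, ← WithZero.coe_mul]
      congr 2
      group
  have hbasis : (dowlingGeometry ι G).IsBasis (p.atom t '' Tᶜ) (below (DowlingLattice.mk p)) :=
    hindep.isBasis_of_subset_of_subset_closure hsub hspan
  rw [setRank, ← hbasis.encard_eq_eRk, ← hT.ncard_eq]
  change (p.atom t '' Tᶜ).ncard + T.ncard = _
  rw [hinj.ncard_image, add_comm, Set.ncard_add_ncard_compl]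

theorem rank_dowlingGeometry : rank (dowlingGeometry ι G) = Nat.card ι := by
  -- The empty partial partition is the top of the lattice, so its flat is the whole ground set.
  let p : PartialGPartition ι G :=
    { support := ∅, rel := fun _ _ => False, label := 1, rel_refl := fun _ h => h,
      rel_symm := fun h => h, rel_trans := fun h _ => h, mem_of_rel := fun h => h }
  have h1 : p.numBlocks = 0 := by
    rw [PartialGPartition.numBlocks]
    exact (congrArg Set.ncard (Set.image_empty _)).trans (Set.ncard_empty _)
  have h2 : below (DowlingLattice.mk p) = (dowlingGeometry ι G).E := by
    rw [dowlingGeometry_spec.1]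
    refine Set.eq_univ_of_forall fun a => ?_
    obtain ⟨q, hq⟩ := a.1.exists_mk
    change a.1 ≤ _
    rw [← hq]
    exact DowlingLattice.mk_le_mk.2 ⟨Set.empty_subset _, fun i hi => hi.elim⟩
  rw [← p.setRank_below, h1, h2, setRank, Matroid.eRk_ground, add_zero]
  rfl

theorem PartialGPartition.rank_contract_below (p : PartialGPartition ι G) :
    rank (dowlingGeometry ι G ／ below (DowlingLattice.mk p)) = p.numBlocks := by
  have h1 := setRank_add_rank_contract (isFlat_below (DowlingLattice.mk p)).subset_ground
  have h2 := p.setRank_below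
  rw [rank_dowlingGeometry] at h1
  omega

theorem contract_below_isFlat_iff {a : DowlingLattice ι G} {F : Set (DowlingPoint ι G)} :
    (dowlingGeometry ι G ／ below a).IsFlat F ↔ ∃ b, a ≤ b ∧ F = below b \ below a := by
  rw [contract_isFlat_iff (isFlat_below a), dowlingGeometry_spec.2]
  constructor
  · rintro ⟨hd, b, hb⟩
    refine ⟨b, below_subset_below.1 fun c hc => hb.subset (Or.inr hc), ?_⟩
    change _ = below b at hb
    rw [← hb, Set.union_sdiff_right, hd.sdiff_eq_left]
  · rintro ⟨b, hab, rfl⟩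
    exact ⟨Set.disjoint_sdiff_left, b, Set.sdiff_union_of_subset (below_subset_below.2 hab)⟩

theorem contract_below_contract {a b : DowlingLattice ι G} (h : a ≤ b) :
    dowlingGeometry ι G ／ below a ／ (below b \ below a) = dowlingGeometry ι G ／ below b := by
  rw [Matroid.contract_contract, Set.union_sdiff_cancel (below_subset_below.2 h)]

end DowlingRank

end


noncomputable section

/-! ### Palindromy, degree bound and initial case for labeled matroids. -/

section Recursion

/-- Uniqueness in one step of a Kazhdan–Lusztig type recursion. -/
theorem eq_of_reflection {A : Type*} [AddCommGroup A] {c c' S : ℕ → A} {d : ℕ}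
    (hc : ∀ i, c i ≠ 0 → 2 * i < d) (hc' : ∀ i, c' i ≠ 0 → 2 * i < d)
    (h : ∀ i ≤ d, c i + S i = c (d - i) + S (d - i))
    (h' : ∀ i ≤ d, c' i + S i = c' (d - i) + S (d - i)) : c = c' := by
  -- Below the middle degree the reflected coefficient vanishes, so the symmetry expresses `c i`
  -- through `S` alone.
  have key : ∀ c : ℕ → A, (∀ i, c i ≠ 0 → 2 * i < d) →
      (∀ i ≤ d, c i + S i = c (d - i) + S (d - i)) → ∀ i,
      c i = if 2 * i < d then S (d - i) - S i else 0 := by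
    intro c hc h i
    split_ifs with hi
    · have h1 := h i (by omega)
      have h2 : c (d - i) = 0 := by
        by_contra hne
        have := hc _ hne
        omega
      rw [h2, zero_add] at h1
      exact eq_sub_of_add_eq h1
    · by_contra hne
      exact hi (hc _ hne)
  funext i
  rw [key c hc h, key c' hc' h']

variable {ι : Type u} {G : Type v} [Group G]

/-- The labeled quasi series-parallel matroids of rank `r` with a given flat. -/
def exactQSPSet (a : DowlingLattice ι G) (r : ℤ) : Set (LabeledMatroid ι G) :=
  {x | x.flat = a ∧ IsQuasiSeriesParallel x.matroid ∧ (rank x.matroid : ℤ) = r}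

/-- The labeled quasi series-parallel matroids of rank `r` with flat at least `a`. -/
def aboveQSPSet (a : DowlingLattice ι G) (r : ℤ) : Set (LabeledMatroid ι G) :=
  {x | a ≤ x.flat ∧ IsQuasiSeriesParallel x.matroid ∧ (rank x.matroid : ℤ) = r}

variable [Finite ι] [Finite G] {a : DowlingLattice ι G} {r : ℤ}

/-- The rank of the contraction is the number of blocks of `a`, so dualizing on the blocks sends
rank `r` to `d - r`. Uniqueness of the dual yields both invertibility and equivariance. -/
theorem exists_duality_equiv {d : ℕ} (hd : rank (dowlingGeometry ι G ／ below a) = d) (r : ℤ) :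
    ∃ e : aboveQSPSet a r ≃ aboveQSPSet a (d - r), ∀ w : DowlingSym ι G, w • a = a →
      ∀ x y : aboveQSPSet a r, w • x.1 = y.1 → w • (e x).1 = (e y).1 := by
  obtain ⟨p, rfl⟩ := a.exists_mk
  rw [p.rank_contract_below] at hd
  have h1 : ∀ (s : ℤ) (x : aboveQSPSet (DowlingLattice.mk p) s), ∃ y :
      aboveQSPSet (DowlingLattice.mk p) (d - s), p.IsDual x.1 y.1 := by
    rintro s ⟨x, hx1, hx2, hx3⟩
    obtain ⟨y, hy⟩ := PartialGPartition.exists_isDual hx1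
    refine ⟨⟨y, hy.symm.le_flat, hy.isQuasiSeriesParallel hx2, ?_⟩, hy⟩
    have := hy.rank_add_rank
    omega
  choose f hf using h1
  have hr : (d : ℤ) - (d - r) = r := sub_sub_cancel _ _
  refine ⟨⟨f r, fun y => ⟨(f _ y).1,
    (congrArg (fun s => (f _ y).1 ∈ aboveQSPSet (DowlingLattice.mk p) s) hr).mp (f _ y).2⟩, fun x => Subtype.ext ?_,
    fun y => Subtype.ext ?_⟩, ?_⟩
  · exact (hf _ (f r x)).unique (hf r x).symm
  · exact (hf r _).unique (hf _ y).symm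
  · intro w hw x y hxy
    have h2 := (hf r x).smul w hw
    rw [hxy] at h2
    exact h2.unique (hf r y)

theorem exactQSPSet_eq_empty (h : (rank (dowlingGeometry ι G ／ below a) : ℤ) < r) :
    exactQSPSet a r = ∅ := by
  obtain ⟨p, rfl⟩ := a.exists_mk
  rw [p.rank_contract_below] at h
  refine Set.eq_empty_of_forall_notMem fun x hx => ?_
  have := PartialGPartition.rank_le_numBlocks hx.1.ge
  have := hx.2.2
  omega

/-- For the coefficient of degree `i = d - r` this is the Kazhdan–Lusztig bound `2 * i < d`. -/
theorem rank_lt_of_exactQSPSet_nonempty (h : 0 < rank (dowlingGeometry ι G ／ below a))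
    (hne : (exactQSPSet a r).Nonempty) : (rank (dowlingGeometry ι G ／ below a) : ℤ) < 2 * r := by
  obtain ⟨p, rfl⟩ := a.exists_mk
  rw [p.rank_contract_below] at h ⊢
  obtain ⟨x, h1, h2, rfl⟩ := hne
  exact_mod_cast PartialGPartition.numBlocks_lt_two_mul_rank h1 h2 h

theorem existsUnique_exactQSPSet (h : rank (dowlingGeometry ι G ／ below a) = 0) :
    ∃! x, x ∈ exactQSPSet a 0 := by
  obtain ⟨p, rfl⟩ := a.exists_mk
  rw [p.rank_contract_below] at h
  obtain ⟨x, h1, h2, h3⟩ := PartialGPartition.exists_flat_eq h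
  exact ⟨x, ⟨h1, h2, by rw [h3]; rfl⟩,
    fun y hy => PartialGPartition.eq_of_numBlocks_eq_zero h hy.1.ge h1.ge⟩

omit [Finite ι] [Finite G] in
theorem exactQSPSet_of_neg (h : r < 0) : exactQSPSet a r = ∅ :=
  Set.eq_empty_of_forall_notMem fun x hx => by
    have := hx.2.2
    omega

end Recursion

/-! ### The ordinary polynomials of contractions of the Dowling geometry. -/

section Numeric

variable {ι : Type u} {G : Type v} [Group G] [Finite ι] [Finite G]

/-- The contraction of the Dowling geometry by the flat of atoms below `a`. -/
def dowlingContract (a : DowlingLattice ι G) : LooplessMatroid (DowlingPoint ι G) :=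
  ⟨dowlingGeometry ι G ／ below a, contract_loopless (isFlat_below a)⟩

theorem exists_of_flat_contract {a : DowlingLattice ι G} (F : {F : Set (DowlingPoint ι G) //
    (dowlingContract a).1.IsFlat F ∧ F.Nonempty}) :
    ∃ b, a < b ∧ F.1 = below b \ below a := by
  obtain ⟨b, hab, hF⟩ := contract_below_isFlat_iff.1 F.2.1
  refine ⟨b, lt_of_le_of_ne hab ?_, hF⟩
  rintro rfl
  obtain ⟨c, hc⟩ := F.2.2
  rw [hF] at hc
  exact hc.2 hc.1

omit [Finite ι] [Finite G] in
theorem below_sdiff_below_injOn (a : DowlingLattice ι G) {b c : DowlingLattice ι G} (hb : a ≤ b)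
    (hc : a ≤ c) : below b \ below a = below c \ below a ↔ b = c := by
  refine ⟨fun h => below_injective ?_, fun h => by rw [h]⟩
  rw [← Set.sdiff_union_of_subset (below_subset_below.2 hb), h,
    Set.sdiff_union_of_subset (below_subset_below.2 hc)]

/-- The matroids are sorted by their flat: either it is `a`, or it lies strictly above `a` and
corresponds to a nonempty flat of the contraction. -/
theorem ncard_aboveQSPSet (a : DowlingLattice ι G) (r : ℤ) (b : {F : Set (DowlingPoint ι G) //
    (dowlingContract a).1.IsFlat F ∧ F.Nonempty} → DowlingLattice ι G)
    (hb : ∀ F, a < b F ∧ F.1 = below (b F) \ below a) :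
    (aboveQSPSet a r).ncard = (exactQSPSet a r).ncard + ∑ᶠ F, (exactQSPSet (b F) r).ncard := by
  have h1 : aboveQSPSet a r = exactQSPSet a r ∪ ⋃ F, exactQSPSet (b F) r := by
    ext x
    simp only [Set.mem_union, Set.mem_iUnion]
    constructor
    · intro hx
      rcases eq_or_lt_of_le hx.1 with h | h
      · exact Or.inl ⟨h.symm, hx.2⟩
      · have hne : (below x.flat \ below a).Nonempty := by
          rw [Set.sdiff_nonempty, below_subset_below]
          exact h.not_ge
        let F : {F : Set (DowlingPoint ι G) // (dowlingContract a).1.IsFlat F ∧ F.Nonempty} :=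
          ⟨below x.flat \ below a, contract_below_isFlat_iff.2 ⟨_, h.le, rfl⟩, hne⟩
        exact Or.inr ⟨F, (below_sdiff_below_injOn a h.le (hb F).1.le).1 (hb F).2, hx.2⟩
    · rintro (h | ⟨F, h⟩)
      · exact ⟨h.1.ge, h.2⟩
      · exact ⟨(hb F).1.le.trans h.1.ge, h.2⟩
  have h2 : Disjoint (exactQSPSet a r) (⋃ F, exactQSPSet (b F) r) := by
    rw [Set.disjoint_left]
    rintro x hx hx'
    obtain ⟨F, hF⟩ := Set.mem_iUnion.1 hx'
    exact (hb F).1.ne (hx.1.symm.trans hF.1)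
  have h3 : Pairwise (Function.onFun Disjoint fun F => exactQSPSet (b F) r) := by
    intro F F' hne
    rw [Function.onFun, Set.disjoint_left]
    intro x hx hx'
    refine hne (Subtype.ext ?_)
    rw [(hb F).2, (hb F').2, ← hx.1, hx'.1]
  rw [h1, Set.ncard_union_eq h2 (Set.toFinite _) (Set.toFinite _)]
  congr 1
  have := Fintype.ofFinite {F : Set (DowlingPoint ι G) //
    (dowlingContract a).1.IsFlat F ∧ F.Nonempty}
  rw [finsum_eq_sum_of_fintype, ← Nat.card_coe_set_eq,
    Nat.card_congr (Set.unionEqSigmaOfDisjoint h3), Nat.card_sigma]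
  rfl

/-- By induction on the rank of the contraction, the terms of the recursion from nonempty flats
count matroids with flat strictly above `a`. The polynomial and the count of exact matroids then
satisfy the same symmetry with the same correction term, hence agree. -/
theorem klPolynomial_coeff_dowlingContract (a : DowlingLattice ι G) (i : ℕ) :
    (klPolynomial (dowlingContract a)).coeff i =
        (exactQSPSet a (rank (dowlingContract a).1 - i)).ncard ∧
      (zPolynomial (dowlingContract a)).coeff i =
        (aboveQSPSet a (rank (dowlingContract a).1 - i)).ncard := by
  obtain ⟨hP0, hP1, hP2⟩ :=
    (existsUnique_isKLAssignment (α := DowlingPoint ι G)).choose_spec.1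
  induction hN : rank (dowlingContract a).1 using Nat.strong_induction_on generalizing a i with
  | _ N ih =>
  choose b hb using exists_of_flat_contract (a := a)
  have hsum : ∀ i : ℕ, ((∑ᶠ F, (exactQSPSet (b F) ((N : ℤ) - i)).ncard : ℕ) : ℤ) =
      ∑ᶠ F : {F : Set (DowlingPoint ι G) // (dowlingContract a).1.IsFlat F ∧ F.Nonempty},
        if setRank (dowlingContract a).1 F.1 ≤ i then
        (klPolynomial ((dowlingContract a).contract ⟨F.1, F.2.1⟩)).coeff
          (i - setRank (dowlingContract a).1 F.1) else 0 := by
    intro i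
    have := Fintype.ofFinite {F : Set (DowlingPoint ι G) //
      (dowlingContract a).1.IsFlat F ∧ F.Nonempty}
    rw [finsum_eq_sum_of_fintype, finsum_eq_sum_of_fintype, Nat.cast_sum]
    refine Finset.sum_congr rfl fun F _ => ?_
    have h1 : (dowlingContract a).contract ⟨F.1, F.2.1⟩ = dowlingContract (b F) := by
      refine Subtype.ext ?_
      change dowlingGeometry ι G ／ below a ／ F.1 = _
      rw [(hb F).2, contract_below_contract (hb F).1.le]
      rfl
    have h2 : setRank (dowlingContract a).1 F.1 + rank (dowlingContract (b F)).1 = N := by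
      rw [← h1, ← hN]
      exact setRank_add_rank_contract F.2.1.subset_ground
    have h3 := setRank_pos (dowlingContract a).2 F.2.1.subset_ground F.2.2
    rw [h1]
    -- With `s` the rank of `F`, degree `i - s` in a contraction of rank `N - s` corresponds to
    -- matroid rank `N - i` again. If `i < s`, that rank exceeds the number of blocks at `b F`, and
    -- there are no such matroids.
    split_ifs with h
    · rw [(ih _ (by omega) (b F) (i - setRank (dowlingContract a).1 F.1) rfl).1]
      congr 3
      omega
    · rw [exactQSPSet_eq_empty, Set.ncard_empty, Nat.cast_zero]
      change (rank (dowlingContract (b F)).1 : ℤ) < _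
      omega
  have hZ : ∀ i, (zPolynomial (dowlingContract a)).coeff i =
      (klPolynomial (dowlingContract a)).coeff i +
        ((∑ᶠ F, (exactQSPSet (b F) ((N : ℤ) - i)).ncard : ℕ) : ℤ) := by
    intro i
    rw [hsum]
    exact zPoly_coeff _ _ i
  suffices hP : ∀ i, (klPolynomial (dowlingContract a)).coeff i =
      (exactQSPSet a ((N : ℤ) - i)).ncard by
    refine ⟨hP i, ?_⟩
    rw [hZ, hP, ncard_aboveQSPSet a _ b hb, Nat.cast_add]
  rcases Nat.eq_zero_or_pos N with rfl | hpos
  · intro i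
    rw [klPolynomial, hP0 _ hN, Polynomial.coeff_one]
    split_ifs with hi
    · obtain ⟨x, hx, hx'⟩ := existsUnique_exactQSPSet hN
      have : exactQSPSet a ((0 : ℕ) - (i : ℤ)) = {x} := by
        rw [hi]
        exact Set.eq_singleton_iff_unique_mem.2 ⟨hx, hx'⟩
      rw [this, Set.ncard_singleton, Nat.cast_one]
    · rw [exactQSPSet_of_neg (by omega), Set.ncard_empty, Nat.cast_zero]
  · refine congrFun (eq_of_reflection (d := N)
      (S := fun i => ((∑ᶠ F, (exactQSPSet (b F) ((N : ℤ) - i)).ncard : ℕ) : ℤ)) ?_ ?_ ?_ ?_)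
    · intro i hi
      have h1 := hP1 (dowlingContract a) (hN ▸ hpos)
      have h2 := Polynomial.le_natDegree_of_ne_zero hi
      rw [hN] at h1
      exact lt_of_le_of_lt (Nat.mul_le_mul_left 2 h2) h1
    · intro i hi
      have h1 := rank_lt_of_exactQSPSet_nonempty (a := a) (r := (N : ℤ) - i)
        (lt_of_lt_of_eq hpos hN.symm) (Set.nonempty_of_ncard_ne_zero (by exact_mod_cast hi))
      change (rank (dowlingContract a).1 : ℤ) < _ at h1
      omega
    · intro i hi
      have h1 := (hP2 (dowlingContract a)).2.2 i (hN ▸ hi)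
      rw [hN] at h1
      rw [← hZ, ← hZ]
      exact h1
    · intro i hi
      rw [← Nat.cast_add, ← Nat.cast_add, ← ncard_aboveQSPSet a _ b hb,
        ← ncard_aboveQSPSet a _ b hb]
      -- Palindromy of the counts of all matroids above `a` comes from duality on blocks.
      obtain ⟨e, -⟩ := exists_duality_equiv (a := a) hN ((N : ℤ) - i)
      have h1 := Nat.card_congr e
      rw [Nat.card_coe_set_eq, Nat.card_coe_set_eq] at h1
      rw [h1]
      congr 3
      omega

end Numeric

end


noncomputable section

/-! ### The equivariant polynomials of contractions. -/

section EquivariantRecursion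

universe w

variable {ι : Type u} {G : Type v} [Group G]

theorem LabeledMatroid.matroid_smul (w : DowlingSym ι G) (x : LabeledMatroid ι G) :
    (w • x).matroid = x.matroid.mapEquiv w.perm := by
  obtain ⟨M, f, rfl⟩ := x.exists_mk
  rfl

/-- An action on labeled matroids is by symmetries fixing `a` if every element acts as an element
of `(G ≀ 𝔖_ι) ⋊ Aut(G)` that fixes `a`. -/
def ActsBySym (H : Type*) [Group H] [MulAction H (LabeledMatroid ι G)]
    (a : DowlingLattice ι G) : Prop :=
  ∀ h : H, ∃ w : DowlingSym ι G, w • a = a ∧ ∀ x : LabeledMatroid ι G, h • x = w • x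

variable {H : Type*} [Group H] [MulAction H (LabeledMatroid ι G)] {a : DowlingLattice ι G}

/-- The labeled quasi series-parallel matroids of rank `r` with flat `a`, with the action of a group
of symmetries. -/
def exactQSP (hH : ActsBySym H a) (r : ℤ) : SubMulAction H (LabeledMatroid ι G) where
  carrier := exactQSPSet a r
  smul_mem' h x hx := by
    obtain ⟨w, hw, hw'⟩ := hH h
    refine ⟨?_, ?_⟩
    · rw [hw', LabeledMatroid.flat_smul, hx.1, hw]
    · rw [hw', LabeledMatroid.matroid_smul, rank_mapEquiv]
      exact ⟨hx.2.1.mapEquiv _, hx.2.2⟩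

/-- The labeled quasi series-parallel matroids of rank `r` with flat at least `a`, with the action
of a group of symmetries. -/
def aboveQSP (hH : ActsBySym H a) (r : ℤ) : SubMulAction H (LabeledMatroid ι G) where
  carrier := aboveQSPSet a r
  smul_mem' h x hx := by
    obtain ⟨w, hw, hw'⟩ := hH h
    refine ⟨?_, ?_⟩
    · rw [hw', LabeledMatroid.flat_smul, ← hw]
      exact w.smul_mono hx.1
    · rw [hw', LabeledMatroid.matroid_smul, rank_mapEquiv]
      exact ⟨hx.2.1.mapEquiv _, hx.2.2⟩

/-- The labeled quasi series-parallel matroids of rank `r` with flat greater than `a`, with the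
action of a group of symmetries. -/
def strictQSP (hH : ActsBySym H a) (r : ℤ) : SubMulAction H (LabeledMatroid ι G) where
  carrier := {x | x ∈ aboveQSPSet a r ∧ x.flat ≠ a}
  smul_mem' h x hx := by
    refine ⟨(aboveQSP hH r).smul_mem h hx.1, fun h' => hx.2 ?_⟩
    obtain ⟨w, hw, hw'⟩ := hH h
    rw [hw', LabeledMatroid.flat_smul, ← hw] at h'
    exact smul_left_cancel w h'

variable [Finite ι] [Finite G]

variable (k : Type*) [Field k]

theorem perm_aboveQSP_eq_add (hH : ActsBySym H a) (r : ℤ) :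
    VRep.perm k H (aboveQSP hH r) =
      VRep.perm k H (exactQSP hH r) + VRep.perm k H (strictQSP hH r) := by
  rw [VRep.perm_eq_sum (J := Bool) (aboveQSP hH r)
    fun b => if b then exactQSP hH r else strictQSP hH r]
  · simp
  · intro x
    simp only [Bool.exists_bool, if_true, Bool.false_eq_true, if_false]
    constructor
    · intro hx
      by_cases h : x.flat = a
      · exact Or.inr ⟨h, hx.2⟩
      · exact Or.inl ⟨hx, h⟩
    · rintro (h | h)
      · exact h.1
      · exact ⟨h.1.ge, h.2⟩
  · rintro x (_ | _) (_ | _) h h'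
    · rfl
    · exact absurd h'.1 h.2
    · exact absurd h.1 h'.2
    · rfl

theorem perm_aboveQSP_reflection (hH : ActsBySym H a) {d : ℕ}
    (hd : rank (dowlingGeometry ι G ／ below a) = d) (r : ℤ) :
    VRep.perm k H (aboveQSP hH r) = VRep.perm k H (aboveQSP hH (d - r)) := by
  obtain ⟨e, he⟩ := exists_duality_equiv hd r
  refine VRep.perm_congr (X := aboveQSP hH r) (Y := aboveQSP hH (d - r)) e fun h x => Subtype.ext ?_
  obtain ⟨w, hw, hw'⟩ := hH h
  change _ = h • (e x).1
  rw [hw']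
  exact (he w hw x (h • x) (hw' x.1).symm).symm

variable (x : MatroidAction.{w, max u v} (DowlingPoint ι G)) [MulAction x.H (LabeledMatroid ι G)]

/-- The group of the action `x` acts compatibly on the Dowling geometry and on labeled matroids
through elements of `(G ≀ 𝔖_ι) ⋊ Aut(G)`. -/
def MatroidAction.BySym : Prop :=
  ∀ h : x.H, ∃ w : DowlingSym ι G, (∀ b : DowlingPoint ι G, h • b = w • b) ∧
    ∀ y : LabeledMatroid ι G, h • y = w • y

instance (F : x.NonemptyFlats) : MulAction (x.contract F).H (LabeledMatroid ι G) :=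
  inferInstanceAs (MulAction (MulAction.stabilizer x.H F.1) (LabeledMatroid ι G))

variable {x}

omit [Finite ι] [Finite G] in
theorem MatroidAction.BySym.contract (hx : x.BySym) (F : x.NonemptyFlats) :
    (x.contract F).BySym := fun h => hx h.1

/-- The group preserves the ground set of the contraction, which is the complement of the atoms
below `a`. So a symmetry inducing the action of `h` gives `a ≤ w • a`, and `h⁻¹` gives the reverse
inequality. -/
theorem MatroidAction.BySym.exists_smul_eq (hx : x.BySym)
    (hM : x.M = dowlingGeometry ι G ／ below a) (h : x.H) : ∃ w : DowlingSym ι G,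
    w • a = a ∧ (∀ b : DowlingPoint ι G, h • b = w • b) ∧
      ∀ y : LabeledMatroid ι G, h • y = w • y := by
  have key : ∀ (h : x.H) (w : DowlingSym ι G), (∀ b : DowlingPoint ι G, h • b = w • b) →
      a ≤ w • a := by
    intro h w hw
    have h1 := (x.smul_isFlat h _ x.M.ground_isFlat).subset_ground
    have h2 : x.M.E = (below a)ᶜ := by
      rw [hM, Matroid.contract_ground, dowlingGeometry_spec.1, Set.compl_eq_univ_sdiff]
    rw [h2, Set.smul_set_compl, Set.compl_subset_compl, show h • below a = w • below a from
      Set.image_congr fun b _ => hw b, smul_below, below_subset_below] at h1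
    exact h1
  obtain ⟨w, hw, hw'⟩ := hx h
  refine ⟨w, le_antisymm ?_ (key h w hw), hw, hw'⟩
  have h1 := key h⁻¹ w⁻¹ fun b => by rw [inv_smul_eq_iff, hw, smul_inv_smul]
  rwa [← w.smul_le_iff, smul_inv_smul] at h1

theorem MatroidAction.BySym.actsBySym (hx : x.BySym)
    (hM : x.M = dowlingGeometry ι G ／ below a) : ActsBySym x.H a := fun h => by
  obtain ⟨w, h1, -, h2⟩ := hx.exists_smul_eq hM h
  exact ⟨w, h1, h2⟩

omit [MulAction x.H (LabeledMatroid ι G)] in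
theorem MatroidAction.exists_flat (hM : x.M = dowlingGeometry ι G ／ below a)
    (F : x.NonemptyFlats) : ∃ b, a < b ∧ F.1 = below b \ below a :=
  exists_of_flat_contract ⟨F.1, (show (dowlingGeometry ι G ／ below a).IsFlat F.1 from
    hM ▸ F.2.1), F.2.2⟩

omit [MulAction x.H (LabeledMatroid ι G)] in
theorem MatroidAction.contract_M (hM : x.M = dowlingGeometry ι G ／ below a)
    (F : x.NonemptyFlats) {b : DowlingLattice ι G} (hb : a < b ∧ F.1 = below b \ below a) :
    (x.contract F).M = dowlingGeometry ι G ／ below b := by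
  refine (congrArg (fun M => M ／ F.1) hM).trans ?_
  rw [hb.2, contract_below_contract hb.1.le]

theorem MatroidAction.BySym.flat_smul (hx : x.BySym)
    (hM : x.M = dowlingGeometry ι G ／ below a) {y z : LabeledMatroid ι G} {h : x.H}
    (hyz : h • y = z) :
    h • (below y.flat \ below a) = below z.flat \ below a := by
  obtain ⟨w, hw, hw', hw''⟩ := hx.exists_smul_eq hM h
  rw [← hyz, hw'', LabeledMatroid.flat_smul]
  conv_rhs => rw [← hw, ← smul_below, ← smul_below, ← Set.smul_set_sdiff]
  exact Set.image_congr fun b _ => hw' b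

/-- Matroids with flat greater than `a` are grouped according to the orbit of the flat. -/
theorem MatroidAction.BySym.perm_strictQSP [Fintype x.FlatOrbits] (hx : x.BySym)
    (hM : x.M = dowlingGeometry ι G ／ below a) (b : x.NonemptyFlats → DowlingLattice ι G)
    (hb : ∀ F, a < b F ∧ F.1 = below (b F) \ below a) (r : ℤ) :
    VRep.perm k x.H (strictQSP (hx.actsBySym hM) r) = ∑ o : x.FlatOrbits,
      VRep.ind (MulAction.stabilizer x.H o.out.1).subtype (VRep.perm k (x.contract o.out).H
        (exactQSP ((hx.contract o.out).actsBySym (x.contract_M hM o.out (hb _))) r)) := by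
  have hflat : ∀ F F' : x.NonemptyFlats, ∀ y ∈ exactQSPSet (b F) r, ∀ y' ∈ exactQSPSet (b F') r,
      ∀ h : x.H, h • y = y' → h • F.1 = F'.1 := by
    intro F F' y hy y' hy' h e
    have h1 := hx.flat_smul hM e
    rw [hy.1, hy'.1, ← (hb F).2, ← (hb F').2] at h1
    exact h1
  refine VRep.perm_eq_sum_ind (strictQSP (hx.actsBySym hM) r)
    (fun o : x.FlatOrbits => MulAction.stabilizer x.H o.out.1)
    (fun o => exactQSP ((hx.contract o.out).actsBySym (x.contract_M hM o.out (hb _))) r)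
    ?_ ?_ ?_ ?_
  · intro o y hy
    have h1 : y.flat = b o.out := hy.1
    have h2 := (hb o.out).1
    rw [← h1] at h2
    exact ⟨⟨h2.le, hy.2⟩, h2.ne'⟩
  · rintro y ⟨hy, hne⟩
    have hlt : a < y.flat := lt_of_le_of_ne hy.1 (Ne.symm hne)
    let F : x.NonemptyFlats := ⟨below y.flat \ below a, by
      rw [hM]
      exact contract_below_isFlat_iff.2 ⟨_, hy.1, rfl⟩, by
      rw [Set.sdiff_nonempty, below_subset_below]
      exact hlt.not_ge⟩
    -- Move `y` by `h⁻¹` so that its flat becomes the chosen representative of its orbit.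
    obtain ⟨h, e⟩ : ∃ h : x.H, h • (Quotient.mk x.orbitSetoid F).out.1 = F.1 :=
      Quotient.exact (Quotient.out_eq (Quotient.mk x.orbitSetoid F))
    have h0 := (aboveQSP (hx.actsBySym hM) r).smul_mem h⁻¹ hy
    refine ⟨Quotient.mk x.orbitSetoid F, h, h⁻¹ • y, ⟨?_, h0.2⟩, smul_inv_smul h y⟩
    have h1 := hx.flat_smul hM (h := h⁻¹) (y := y) rfl
    rw [← below_sdiff_below_injOn a h0.1 (hb _).1.le, ← h1, ← (hb _).2, inv_smul_eq_iff, e]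
  · intro o o' y hy y' hy' h e
    have h1 := hflat _ _ y hy y' hy' h e
    rw [← Quotient.out_eq o, ← Quotient.out_eq o']
    exact Quotient.sound ⟨h, h1⟩
  · exact fun o y hy y' hy' h e => hflat _ _ y hy y' hy' h e

/-- This is the numerical argument with cardinalities replaced by classes of permutation
representations. Any group acting through symmetries is allowed because the recursion passes to
stabilizers of flats. -/
theorem equivariantKLPolynomial_eq_perm (x : MatroidAction.{w, max u v} (DowlingPoint ι G))
    [MulAction x.H (LabeledMatroid ι G)] (hx : x.BySym) {a : DowlingLattice ι G}
    (hM : x.M = dowlingGeometry ι G ／ below a) (i : ℕ) :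
    equivariantKLPolynomial k x i =
        VRep.perm k x.H (exactQSP (hx.actsBySym hM) (rank x.M - i)) ∧
      equivariantZPolynomial k x i =
        VRep.perm k x.H (aboveQSP (hx.actsBySym hM) (rank x.M - i)) := by
  obtain ⟨hP0, hP1, hP2⟩ := (existsUnique_isEquivariantKLAssignment.{w, max u v} k
    (α := DowlingPoint ι G)).choose_spec.1
  induction hN : rank x.M using Nat.strong_induction_on generalizing x a i with
  | _ N ih =>
  choose b hb using x.exists_flat hM
  have hNa : rank (dowlingGeometry ι G ／ below a) = N := hM ▸ hN
  have := Fintype.ofFinite x.FlatOrbits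
  have hZ : ∀ i, equivariantZPolynomial k x i = equivariantKLPolynomial k x i +
      VRep.perm k x.H (strictQSP (hx.actsBySym hM) ((N : ℤ) - i)) := by
    intro i
    rw [equivariantZPolynomial, equivariantZPoly_apply, hx.perm_strictQSP k hM b hb,
      finsum_eq_sum_of_fintype]
    congr 1
    refine Finset.sum_congr rfl fun o _ => ?_
    have h2 : setRank x.M o.out.1 + rank (x.contract o.out).M = N := by
      rw [← hN]
      exact setRank_add_rank_contract o.out.2.1.subset_ground
    have h3 := setRank_pos x.loopless o.out.2.1.subset_ground o.out.2.2
    have hM' := x.contract_M hM o.out (hb _)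
    split_ifs with h
    · rw [(ih _ (by omega) (x.contract o.out) (hx.contract o.out) hM'
        (i - setRank x.M o.out.1) rfl).1]
      refine congrArg (fun r : ℤ => VRep.ind (MulAction.stabilizer x.H o.out.1).subtype (VRep.perm k
        (x.contract o.out).H (exactQSP ((hx.contract o.out).actsBySym hM') r))) ?_
      omega
    · have : IsEmpty (exactQSP ((hx.contract o.out).actsBySym hM') ((N : ℤ) - i)) := by
        refine Set.isEmpty_coe_sort.2 (exactQSPSet_eq_empty ?_)
        rw [← hM']
        omega
      rw [VRep.perm_of_isEmpty]
      exact (map_zero (VRep.ind _)).symm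
  suffices hP : ∀ i, equivariantKLPolynomial k x i =
      VRep.perm k x.H (exactQSP (hx.actsBySym hM) ((N : ℤ) - i)) by
    refine ⟨hP i, ?_⟩
    rw [hZ, hP, perm_aboveQSP_eq_add]
  rcases Nat.eq_zero_or_pos N with rfl | hpos
  · intro i
    rw [equivariantKLPolynomial, hP0 _ hN, Finsupp.single_apply]
    split_ifs with hi
    · obtain ⟨y, hy, hy'⟩ := existsUnique_exactQSPSet hNa
      subst hi
      let _ : Unique (exactQSP (hx.actsBySym hM) (((0 : ℕ) : ℤ) - ((0 : ℕ) : ℤ))) :=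
        { default := ⟨y, hy⟩
          uniq := fun z => Subtype.ext (hy' z.1 z.2) }
      exact (VRep.perm_of_unique _).symm
    · have : IsEmpty (exactQSP (hx.actsBySym hM) (((0 : ℕ) : ℤ) - i)) :=
        Set.isEmpty_coe_sort.2 (exactQSPSet_of_neg (by omega))
      rw [VRep.perm_of_isEmpty]
  · refine congrFun (eq_of_reflection (d := N)
      (S := fun i => VRep.perm k x.H (strictQSP (hx.actsBySym hM) ((N : ℤ) - i))) ?_ ?_ ?_ ?_)
    · intro i hi
      have h1 := hP1 x (hN ▸ hpos) i (Finsupp.mem_support_iff.2 hi)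
      rwa [hN] at h1
    · intro i hi
      have hne : (exactQSPSet a ((N : ℤ) - i)).Nonempty := by
        by_contra he
        have : IsEmpty (exactQSP (hx.actsBySym hM) ((N : ℤ) - i)) :=
          Set.isEmpty_coe_sort.2 (Set.not_nonempty_iff_eq_empty.1 he)
        exact hi (VRep.perm_of_isEmpty _)
      have h1 := rank_lt_of_exactQSPSet_nonempty (hNa.symm ▸ hpos) hne
      rw [hNa] at h1
      omega
    · intro i hi
      have h1 := (hP2 x).2.2 i (hN ▸ hi)
      rw [hN] at h1
      rw [← hZ, ← hZ]
      exact h1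
    · intro i hi
      rw [← perm_aboveQSP_eq_add, ← perm_aboveQSP_eq_add,
        perm_aboveQSP_reflection k (hx.actsBySym hM) hNa]
      refine congrArg (fun r : ℤ => VRep.perm k x.H (aboveQSP (hx.actsBySym hM) r)) ?_
      omega

end EquivariantRecursion

end


noncomputable section

/-! ### Simplicity, and the number of labelings of a matroid. -/

section Counting

variable {ι : Type u} {G : Type v} [Group G]

theorem LabeledMatroid.flat_eq_bot_iff {x : LabeledMatroid ι G} :
    x.flat = ⊥ ↔ IsSimple x.matroid := by
  obtain ⟨M, f, rfl⟩ := x.exists_mk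
  rw [isSimple_iff, LabeledMatroid.matroid_mk, LabeledMatroid.flat_mk]
  constructor
  · intro h
    have h1 : (parallelPartition M f).Equivalent (PartialGPartition.singletons ι G) :=
      Quotient.exact h
    have hnl : ∀ i, M.1.IsNonloop i := fun i => by
      have : i ∈ (PartialGPartition.singletons ι G).support := Set.mem_univ i
      rw [← h1.1] at this
      exact this
    refine ⟨fun i hi => hi.not_isNonloop (hnl i), fun i j hij hC => hij ((h1.2.1 i j).1
      ⟨hnl i, ((hnl i).closure_eq_closure_iff_isCircuit_of_ne hij).2 hC⟩)⟩
  · rintro ⟨h1, h2⟩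
    refine PartialGPartition.mk_eq_bot
      (fun i => Matroid.isNonloop_of_not_isLoop (M.mem_ground i) (h1 i)) fun i j hij => ?_
    by_contra hne
    exact h2 i j hne ((hij.1.closure_eq_closure_iff_isCircuit_of_ne hne).1 hij.2)

theorem below_bot : below (⊥ : DowlingLattice ι G) = ∅ :=
  Set.eq_empty_of_forall_notMem fun b hb => b.2.1 (le_bot_iff.1 hb)

theorem exists_component_representatives [Finite ι] (M : MatroidOn ι) : ∃ r : ι → ι,
    (∀ i, r i ∈ component M.1 i) ∧ ∀ i, ∀ j ∈ component M.1 i, r j = r i := by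
  have hne : ∀ i, (component M.1 i).Nonempty := fun i => ⟨i, self_mem_component M.1 i⟩
  have h : ∀ s s' : Set ι, s = s' → ∀ (h : s.Nonempty) (h' : s'.Nonempty), h.some = h'.some := by
    rintro s _ rfl h h'
    rfl
  exact ⟨fun i => (hne i).some, fun i => (hne i).some_mem,
    fun i j hj => h _ _ (component_eq_of_mem hj) _ _⟩

variable [Finite ι] [Finite G]

omit [Finite G] in
/-- The number of classes of labelings of a matroid with `n` elements is `q ^ (n - c)`, where `c`
is the number of connected components. -/
theorem card_labelings (M : MatroidOn ι) :
    Nat.card {x : LabeledMatroid ι G // x.matroid = M.1} =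
      Nat.card G ^ (Nat.card ι - numComponents M.1) := by
  classical
  obtain ⟨r, hr, hr'⟩ := exists_component_representatives M
  have hrr : ∀ i, r (r i) = r i := fun i => hr' i _ (hr i)
  have hnum : numComponents M.1 = (Set.range r).ncard := by
    rw [numComponents, ← Set.InjOn.ncard_image (f := component M.1) (s := Set.range r)]
    · congr 1
      ext C
      constructor
      · rintro ⟨e, -, rfl⟩
        exact ⟨r e, ⟨e, rfl⟩, component_eq_of_mem (hr e)⟩
      · rintro ⟨e, -, rfl⟩
        exact ⟨e, M.mem_ground e, rfl⟩
    · rintro _ ⟨i, rfl⟩ _ ⟨j, rfl⟩ h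
      have h1 : r i ∈ component M.1 (r j) := h ▸ self_mem_component M.1 (r i)
      rw [← hrr i, hr' _ _ h1, hrr]
  -- Each class has exactly one labeling that is `1` at the representative of every component; the
  -- other values are free.
  let F : (((Set.range r)ᶜ : Set ι) → G) → ι → G := fun g i =>
    if h : i ∈ Set.range r then 1 else g ⟨i, h⟩
  have hF : ∀ g i, F g (r i) = 1 := fun g i => dif_pos ⟨i, rfl⟩
  have hbij : Function.Bijective fun g => (⟨LabeledMatroid.mk M (F g), rfl⟩ :
      {x : LabeledMatroid ι G // x.matroid = M.1}) := by
    constructor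
    · intro g g' h
      obtain ⟨-, h1⟩ := LabeledMatroid.exact (Subtype.ext_iff.1 h)
      funext i
      obtain ⟨c, hc⟩ := h1 _ ⟨i.1, M.mem_ground i.1, rfl⟩
      have h2 := hc _ (hr i.1)
      rw [hF, hF, mul_one] at h2
      have h3 := hc _ (self_mem_component M.1 i.1)
      rw [← h2, one_mul] at h3
      have h4 : i.1 ∉ Set.range r := i.2
      simpa only [F, dif_neg h4] using h3
    · rintro ⟨x, hx⟩
      obtain ⟨N, f, rfl⟩ := x.exists_mk
      obtain rfl : N = M := Subtype.ext hx
      refine ⟨fun i => (f (r i))⁻¹ * f i, Subtype.ext (LabeledMatroid.mk_eq_mk ?_)⟩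
      rintro C ⟨e, -, rfl⟩
      refine ⟨(f (r e))⁻¹, fun i hi => ?_⟩
      rw [← hr' e i hi]
      by_cases h : i ∈ Set.range r
      · obtain ⟨j, rfl⟩ := h
        simp only [F]
        rw [dif_pos ⟨j, rfl⟩, hrr, inv_mul_cancel]
      · simp only [F, dif_neg h]
  rw [← Nat.card_congr (Equiv.ofBijective _ hbij), Nat.card_fun, hnum, Nat.card_coe_set_eq,
    Set.ncard_compl]

theorem ncard_labeledMatroid (A : Set (Matroid ι)) (hA : ∀ M ∈ A, M.E = Set.univ) :
    ({x : LabeledMatroid ι G | x.matroid ∈ A}.ncard : ℤ) =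
      ∑ᶠ M ∈ A, (Nat.card G : ℤ) ^ (Nat.card ι - numComponents M) := by
  have : Finite A := Finite.of_injective (fun M : A => (⟨M.1, hA M.1 M.2⟩ : MatroidOn ι))
    fun M N h => Subtype.ext (congrArg (fun M : MatroidOn ι => M.1) h)
  have := Fintype.ofFinite A
  rw [← finsum_set_coe_eq_finsum_mem, finsum_eq_sum_of_fintype, ← Nat.card_coe_set_eq,
    ← Nat.card_congr (Equiv.sigmaFiberEquiv
      fun x : {x : LabeledMatroid ι G | x.matroid ∈ A} => (⟨x.1.matroid, x.2⟩ : A)), Nat.card_sigma,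
    Nat.cast_sum]
  refine Finset.sum_congr rfl fun M _ => ?_
  rw [← Nat.cast_pow, ← card_labelings (G := G) ⟨M.1, hA M.1 M.2⟩]
  refine congrArg Nat.cast (Nat.card_congr ⟨fun x => ⟨x.1.1, Subtype.ext_iff.1 x.2⟩, fun x =>
    ⟨⟨x.1, by rw [Set.mem_ofPred_eq, x.2]; exact M.2⟩, Subtype.ext x.2⟩, fun _ => rfl, fun _ => rfl⟩)

end Counting

/-! ### Specialization to the bottom of the lattice. -/

section Main

variable {ι : Type u} {G : Type v} [Group G] [Finite ι] [Finite G]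

/-- No atom lies below `⊥`, so the results on contractions apply to the geometry itself. -/
theorem dowlingGeometry_eq_contract :
    dowlingGeometry ι G = dowlingGeometry ι G ／ below (⊥ : DowlingLattice ι G) := by
  rw [below_bot, Matroid.contract_empty]

omit [Finite ι] [Finite G] in
theorem mem_exactQSPSet_bot {x : LabeledMatroid ι G} {r : ℤ} : x ∈ exactQSPSet ⊥ r ↔
    IsSimple x.matroid ∧ IsQuasiSeriesParallel x.matroid ∧ (rank x.matroid : ℤ) = r :=
  and_congr_left' LabeledMatroid.flat_eq_bot_iff

omit [Finite ι] [Finite G] in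
theorem mem_aboveQSPSet_bot {x : LabeledMatroid ι G} {r : ℤ} : x ∈ aboveQSPSet ⊥ r ↔
    IsQuasiSeriesParallel x.matroid ∧ (rank x.matroid : ℤ) = r :=
  and_iff_right bot_le

theorem klPolynomial_dowlingGeometry_coeff (i : ℕ) :
    (klPolynomial ⟨dowlingGeometry ι G, dowlingGeometry_loopless⟩).coeff i =
      ∑ᶠ M ∈ {M : Matroid ι | M.E = Set.univ ∧ IsSimple M ∧ IsQuasiSeriesParallel M ∧
        (rank M : ℤ) = Nat.card ι - i}, (Nat.card G : ℤ) ^ (Nat.card ι - numComponents M) := by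
  have h1 : (⟨dowlingGeometry ι G, dowlingGeometry_loopless⟩ : LooplessMatroid _) =
      dowlingContract ⊥ := Subtype.ext dowlingGeometry_eq_contract
  have h2 : rank (dowlingContract (⊥ : DowlingLattice ι G)).1 = Nat.card ι := by
    rw [← h1, rank_dowlingGeometry]
  have h3 := ncard_labeledMatroid (ι := ι) (G := G) {M : Matroid ι | M.E = Set.univ ∧ IsSimple M ∧
    IsQuasiSeriesParallel M ∧ (rank M : ℤ) = Nat.card ι - i} fun M hM => hM.1
  have h4 : exactQSPSet (⊥ : DowlingLattice ι G) (Nat.card ι - i) =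
      {x : LabeledMatroid ι G | x.matroid ∈ {M : Matroid ι | M.E = Set.univ ∧ IsSimple M ∧
        IsQuasiSeriesParallel M ∧ (rank M : ℤ) = Nat.card ι - i}} := by
    ext x
    obtain ⟨M, f, rfl⟩ := x.exists_mk
    rw [mem_exactQSPSet_bot]
    exact (and_iff_right M.2).symm
  rw [h1, (klPolynomial_coeff_dowlingContract _ i).1, h2, h4, h3]

theorem zPolynomial_dowlingGeometry_coeff (i : ℕ) :
    (zPolynomial ⟨dowlingGeometry ι G, dowlingGeometry_loopless⟩).coeff i =
      ∑ᶠ M ∈ {M : Matroid ι | M.E = Set.univ ∧ IsQuasiSeriesParallel M ∧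
        (rank M : ℤ) = Nat.card ι - i}, (Nat.card G : ℤ) ^ (Nat.card ι - numComponents M) := by
  have h1 : (⟨dowlingGeometry ι G, dowlingGeometry_loopless⟩ : LooplessMatroid _) =
      dowlingContract ⊥ := Subtype.ext dowlingGeometry_eq_contract
  have h2 : rank (dowlingContract (⊥ : DowlingLattice ι G)).1 = Nat.card ι := by
    rw [← h1, rank_dowlingGeometry]
  have h3 := ncard_labeledMatroid (ι := ι) (G := G) {M : Matroid ι | M.E = Set.univ ∧
    IsQuasiSeriesParallel M ∧ (rank M : ℤ) = Nat.card ι - i} fun M hM => hM.1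
  have h4 : aboveQSPSet (⊥ : DowlingLattice ι G) (Nat.card ι - i) =
      {x : LabeledMatroid ι G | x.matroid ∈ {M : Matroid ι | M.E = Set.univ ∧
        IsQuasiSeriesParallel M ∧ (rank M : ℤ) = Nat.card ι - i}} := by
    ext x
    obtain ⟨M, f, rfl⟩ := x.exists_mk
    rw [mem_aboveQSPSet_bot]
    exact (and_iff_right M.2).symm
  rw [h1, (klPolynomial_coeff_dowlingContract _ i).2, h2, h4, h3]

instance : MulAction (dowlingAction ι G).H (LabeledMatroid ι G) :=
  inferInstanceAs (MulAction (dowlingGamma ι G) (LabeledMatroid ι G))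

theorem actsBySym_dowlingGamma : ActsBySym (dowlingGamma ι G) (⊥ : DowlingLattice ι G) := by
  intro γ
  obtain ⟨w, hw⟩ := γ.2
  exact ⟨w, w.orderIso.map_bot, fun y => LabeledMatroid.gamma_smul γ w hw y⟩

theorem dowlingAction_bySym : (dowlingAction ι G).BySym := by
  intro γ
  obtain ⟨w, hw⟩ := γ.2
  refine ⟨w, fun b => ?_, fun y => LabeledMatroid.gamma_smul γ w hw y⟩
  exact (Equiv.congr_fun (congrArg Subtype.val hw) b).symm

variable (k : Type*) [Field k]

theorem equivariantKLPolynomial_dowlingAction (i : ℕ) :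
    equivariantKLPolynomial k (dowlingAction ι G) i =
      VRep.perm k (dowlingGamma ι G) (labeledSimpleQSP ι G (Nat.card ι - i)) := by
  rw [(equivariantKLPolynomial_eq_perm k (dowlingAction ι G) dowlingAction_bySym
    dowlingGeometry_eq_contract i).1]
  have h : rank (dowlingAction ι G).M = Nat.card ι := rank_dowlingGeometry
  rw [h]
  have key := VRep.perm_congr (k := k) (H := dowlingGamma ι G)
    (X := exactQSP actsBySym_dowlingGamma (Nat.card ι - i))
    (Y := labeledSimpleQSP ι G (Nat.card ι - i))
    (Equiv.subtypeEquivRight fun x => mem_exactQSPSet_bot) fun γ x => rfl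
  exact key

theorem equivariantZPolynomial_dowlingAction (i : ℕ) :
    equivariantZPolynomial k (dowlingAction ι G) i =
      VRep.perm k (dowlingGamma ι G) (labeledQSP ι G (Nat.card ι - i)) := by
  rw [(equivariantKLPolynomial_eq_perm k (dowlingAction ι G) dowlingAction_bySym
    dowlingGeometry_eq_contract i).2]
  have h : rank (dowlingAction ι G).M = Nat.card ι := rank_dowlingGeometry
  rw [h]
  have key := VRep.perm_congr (k := k) (H := dowlingGamma ι G)
    (X := aboveQSP actsBySym_dowlingGamma (Nat.card ι - i))
    (Y := labeledQSP ι G (Nat.card ι - i))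
    (Equiv.subtypeEquivRight fun x => mem_aboveQSPSet_bot) fun γ x => rfl
  exact key

end Main

end


noncomputable section

/-! ### Automorphisms of the Dowling geometry. -/

section Automorphisms

/-- Families of permutations `φ i j` of a group that are compatible with products are twisted forms
of a single automorphism. -/
theorem exists_mulAut_of_family {ι G : Type*} [Group G] [Finite G] [Nonempty ι]
    (hι : ∀ i j : ι, ∃ l, l ≠ i ∧ l ≠ j) (φ : ι → ι → G → G)
    (hmul : ∀ i j l, i ≠ j → j ≠ l → i ≠ l → ∀ g h, φ i l (g * h) = φ i j g * φ j l h)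
    (hinv : ∀ i j, i ≠ j → ∀ g, φ j i g⁻¹ = (φ i j g)⁻¹)
    (hinj : ∀ i j, i ≠ j → Function.Injective (φ i j)) :
    ∃ (v : ι → G) (θ : MulAut G), ∀ i j, i ≠ j → ∀ g, φ i j g = (v i)⁻¹ * θ g * v j := by
  classical
  let o : ι := Classical.arbitrary ι
  -- Twisting by `v` normalizes the family so that `ψ o i 1 = 1` for the base point `o`; products
  -- and inverses extend this to all pairs.
  let v : ι → G := fun i => if i = o then 1 else φ o i 1
  let ψ : ι → ι → G → G := fun i j g => v i * φ i j g * (v j)⁻¹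
  have hψmul : ∀ i j l, i ≠ j → j ≠ l → i ≠ l → ∀ g h, ψ i l (g * h) = ψ i j g * ψ j l h := by
    intro i j l h1 h2 h3 g h
    simp only [ψ, hmul i j l h1 h2 h3]
    group
  have hψinv : ∀ i j, i ≠ j → ∀ g, ψ j i g⁻¹ = (ψ i j g)⁻¹ := by
    intro i j h g
    simp only [ψ, hinv i j h]
    group
  have h0 : ∀ i, o ≠ i → ψ o i 1 = 1 := by
    intro i hi
    simp [ψ, v, hi.symm]
  have h0' : ∀ i, i ≠ o → ψ i o 1 = 1 := by
    intro i hi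
    have := hψinv o i hi.symm 1
    rwa [inv_one, h0 i hi.symm, inv_one] at this
  have h1 : ∀ i j, i ≠ j → ψ i j 1 = 1 := by
    intro i j hij
    by_cases hi : i = o
    · rw [hi] at hij ⊢
      exact h0 j hij
    by_cases hj : j = o
    · rw [hj]
      exact h0' i hi
    have := hψmul i o j hi (Ne.symm hj) hij 1 1
    rwa [h0' i hi, h0 j (Ne.symm hj), one_mul] at this
  -- Once every `ψ i j` fixes `1`, the product rule with one factor `1` shows that `ψ i j` does not
  -- depend on either index. A third index lets any pair be linked to `(o, b)`.
  have hr : ∀ i j l, i ≠ j → i ≠ l → ψ i j = ψ i l := by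
    intro i j l h2 h3
    by_cases h4 : j = l
    · rw [h4]
    funext g
    have := hψmul i j l h2 h4 h3 g 1
    rw [mul_one, h1 j l h4, mul_one] at this
    exact this.symm
  have hl : ∀ i j l, i ≠ l → j ≠ l → ψ i l = ψ j l := by
    intro i j l h2 h3
    by_cases h4 : i = j
    · rw [h4]
    funext g
    have := hψmul i j l h4 h3 h2 1 g
    rwa [one_mul, h1 i j h4, one_mul] at this
  obtain ⟨b, hb, -⟩ := hι o o
  have hall : ∀ i j, i ≠ j → ψ i j = ψ o b := by
    intro i j hij
    obtain ⟨l, hl1, hl2⟩ := hι i o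
    rw [hr i j l hij hl1.symm, hl i o l hl1.symm hl2.symm, hr o l b hl2.symm hb.symm]
  obtain ⟨c, hc, hc'⟩ := hι o b
  have hinjψ : Function.Injective (ψ o b) := by
    intro g h e
    exact hinj o b hb.symm (mul_left_cancel (mul_right_cancel e))
  -- For three distinct indices the product rule now says that the common map is multiplicative.
  let θ : G →* G :=
    { toFun := ψ o b
      map_one' := h1 o b hb.symm
      map_mul' := fun g h => by
        have := hψmul o b c hb.symm hc'.symm hc.symm g h
        rwa [hall o c hc.symm, hall b c hc'.symm] at this }
  refine ⟨v, MulEquiv.ofBijective θ (Finite.injective_iff_bijective.1 hinjψ), fun i j hij g => ?_⟩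
  change _ = (v i)⁻¹ * ψ o b g * v j
  rw [← hall i j hij]
  simp only [ψ]
  group

variable {ι : Type u} {G : Type v} [Group G]

namespace DowlingPoint

/-- The joints of the Dowling geometry. -/
def joint (G : Type v) [Group G] (i : ι) : DowlingPoint ι G := ⟨_, PartialGPartition.isAtom_joint i⟩

/-- The points of the Dowling geometry that are not joints. -/
def edge {i j : ι} (hij : i ≠ j) (g : G) : DowlingPoint ι G :=
  ⟨_, PartialGPartition.isAtom_edge hij g⟩

theorem joint_sat {i : ι} {y : ι → WithZero G} : (joint G i).1.Sat y ↔ y i = 0 :=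
  DowlingLattice.sat_mk.trans PartialGPartition.joint_sat

theorem edge_sat {i j : ι} {hij : i ≠ j} {g : G} {y : ι → WithZero G} :
    (edge hij g).1.Sat y ↔ y j = y i * g :=
  DowlingLattice.sat_mk.trans (PartialGPartition.edge_sat hij)

theorem eq_joint_or_edge (a : DowlingPoint ι G) :
    (∃ i, a = joint G i) ∨ ∃ (i j : ι) (hij : i ≠ j) (g : G), a = edge hij g := by
  rcases a.cases with ⟨i, h⟩ | ⟨i, j, hij, g, h⟩
  · exact Or.inl ⟨i, Subtype.ext h⟩
  · exact Or.inr ⟨i, j, hij, g, Subtype.ext h⟩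

theorem ext_sat {a b : DowlingPoint ι G} (h : ∀ y, a.1.Sat y ↔ b.1.Sat y) : a = b :=
  Subtype.ext (le_antisymm (DowlingLattice.le_iff_sat.2 fun y => (h y).2)
    (DowlingLattice.le_iff_sat.2 fun y => (h y).1))

theorem edge_symm {i j : ι} (hij : i ≠ j) (g : G) : edge hij g = edge hij.symm g⁻¹ := by
  refine ext_sat fun y => ?_
  rw [edge_sat, edge_sat]
  constructor
  · intro h
    rw [h, mul_assoc, ← WithZero.coe_mul, mul_inv_cancel, WithZero.coe_one, mul_one]
  · intro h
    rw [h, mul_assoc, ← WithZero.coe_mul, inv_mul_cancel, WithZero.coe_one, mul_one]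

theorem joint_injective : Function.Injective (joint G : ι → DowlingPoint ι G) := by
  classical
  intro i j h
  by_contra hij
  have h1 : (joint G i).1.Sat (fun l => if l = j then 1 else 0) := joint_sat.2 (if_neg hij)
  rw [h, joint_sat, if_pos rfl] at h1
  exact one_ne_zero h1

theorem edge_ne_joint {i j : ι} {hij : i ≠ j} {g : G} {l : ι} : edge hij g ≠ joint G l := by
  classical
  intro h
  have h1 : (edge hij g).1.Sat (fun m => if m = j then (g : WithZero G) else 1) := by
    simp [edge_sat, hij]
  rw [h, joint_sat] at h1
  split_ifs at h1
  · exact WithZero.coe_ne_zero h1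
  · exact one_ne_zero h1

theorem edge_injective {i j : ι} {hij : i ≠ j} : Function.Injective (edge hij : G → _) := by
  classical
  intro g h e
  have h1 : (edge hij g).1.Sat (fun m => if m = j then (g : WithZero G) else 1) := by
    simp [edge_sat, hij]
  rw [e, edge_sat] at h1
  simpa [hij] using h1

theorem smul_joint (w : DowlingSym ι G) (i : ι) : w • joint G i = joint G (w.perm i) := by
  refine Subtype.ext (Quotient.sound ⟨?_, ?_, ?_⟩)
  · ext j
    change w.perm⁻¹ j ≠ i ↔ j ≠ w.perm i
    rw [not_iff_not]
    exact w.perm.symm_apply_eq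
  · intro j l
    change w.perm⁻¹ j = w.perm⁻¹ l ∧ w.perm⁻¹ j ≠ i ↔ j = l ∧ j ≠ w.perm i
    refine and_congr w.perm⁻¹.injective.eq_iff (not_congr w.perm.symm_apply_eq)
  · rintro j -
    refine ⟨w.actFun 1 j, ?_⟩
    rintro l ⟨h, -⟩
    obtain rfl := w.perm⁻¹.injective h
    exact (mul_one _).symm

theorem smul_edge (w : DowlingSym ι G) {i j : ι} (hij : i ≠ j) (g : G) :
    w • edge hij g = edge (w.perm.injective.ne hij) ((w.vec i)⁻¹ * w.aut g * w.vec j) := by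
  classical
  have hi : w.perm⁻¹ (w.perm i) = i := w.perm.symm_apply_apply i
  have hj : w.perm⁻¹ (w.perm j) = j := w.perm.symm_apply_apply j
  have h1 : edge (w.perm.injective.ne hij) ((w.vec i)⁻¹ * w.aut g * w.vec j) ≤ w • edge hij g := by
    refine DowlingLattice.le_iff_sat.2 fun y hy => edge_sat.2 ?_
    have h2 := (DowlingLattice.sat_mk.1 hy).2 (w.perm i) (w.perm j)
      (Or.inr (Or.inl ⟨hi, hj⟩))
    simpa [DowlingSym.actPartition, DowlingSym.actFun, PartialGPartition.edge, hij, mul_assoc]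
      using h2
  exact (Subtype.ext (((w • edge hij g).2.le_iff.1 h1).resolve_left
    (DowlingLattice.edge_ne_bot (w.perm.injective.ne hij) _))).symm

end DowlingPoint

open DowlingPoint

variable [Finite ι] [Finite G]

theorem mem_dowlingGeometry_closure_pair {a b c : DowlingPoint ι G} :
    c ∈ (dowlingGeometry ι G).closure {a, b} ↔ ∀ y, a.1.Sat y → b.1.Sat y → c.1.Sat y := by
  rw [mem_dowlingGeometry_closure]
  simp

theorem mem_closure_of_matroidAut {π : Equiv.Perm (DowlingPoint ι G)}
    (hπ : π ∈ matroidAut (dowlingGeometry ι G)) {a b c : DowlingPoint ι G} :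
    π c ∈ (dowlingGeometry ι G).closure {π a, π b} ↔ c ∈ (dowlingGeometry ι G).closure {a, b} := by
  have hE : ∀ X, X ⊆ (dowlingGeometry ι G).E := fun X => by
    rw [dowlingGeometry_spec.1]
    exact Set.subset_univ X
  have key : ∀ π ∈ matroidAut (dowlingGeometry ι G), ∀ a b c : DowlingPoint ι G,
      c ∈ (dowlingGeometry ι G).closure {a, b} →
      π c ∈ (dowlingGeometry ι G).closure {π a, π b} := by
    intro π hπ a b c h
    rw [Matroid.mem_closure_iff_forall_mem_isFlat _ (hE _)] at h ⊢
    intro F hF hsub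
    have h1 := h (π ⁻¹' F) (by
      rw [hπ, Set.image_preimage_eq _ π.surjective]
      exact hF) (by
      rintro d (rfl | rfl)
      · exact hsub (Set.mem_insert _ _)
      · exact hsub (Set.mem_insert_of_mem _ rfl))
    exact h1
  refine ⟨fun h => ?_, key π hπ a b c⟩
  simpa using key π⁻¹ (inv_mem hπ) _ _ _ h

/-- A point such that every line through it with at least three points has at least four points. -/
def HasLongLines (a : DowlingPoint ι G) : Prop :=
  ∀ b c, b ≠ a → c ≠ a → c ≠ b → c ∈ (dowlingGeometry ι G).closure {a, b} →
    ∃ d ∈ (dowlingGeometry ι G).closure {a, b}, d ≠ a ∧ d ≠ b ∧ d ≠ c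

theorem HasLongLines.map {π : Equiv.Perm (DowlingPoint ι G)}
    (hπ : π ∈ matroidAut (dowlingGeometry ι G)) {a : DowlingPoint ι G} (h : HasLongLines a) :
    HasLongLines (π a) := by
  intro b c hb hc hcb hcl
  obtain ⟨b, rfl⟩ := π.surjective b
  obtain ⟨c, rfl⟩ := π.surjective c
  rw [mem_closure_of_matroidAut hπ] at hcl
  obtain ⟨d, hd, h1, h2, h3⟩ := h b c (fun e => hb (e ▸ rfl)) (fun e => hc (e ▸ rfl))
    (fun e => hcb (e ▸ rfl)) hcl
  exact ⟨π d, (mem_closure_of_matroidAut hπ).2 hd, π.injective.ne h1, π.injective.ne h2,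
    π.injective.ne h3⟩

omit [Finite ι] [Finite G] in
theorem DowlingPoint.joint_sat_single [DecidableEq ι] {s i : ι} (h : i ≠ s) :
    (joint G i).1.Sat (fun t => if t = s then 1 else 0) := joint_sat.2 (if_neg h)

-- Indicator potentials detect which indices a point involves, and so confine the points of a line
-- to the indices of its generators.
omit [Finite ι] [Finite G] in
theorem DowlingPoint.edge_sat_single [DecidableEq ι] {s i j : ι} {hij : i ≠ j} {g : G} :
    (edge hij g).1.Sat (fun t => if t = s then 1 else 0) ↔ i ≠ s ∧ j ≠ s := by
  rw [edge_sat]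
  by_cases hi : i = s
  · simp [hi, show ¬ j = s from fun h => hij (hi.trans h.symm)]
  · by_cases hj : j = s <;> simp [hi, hj]

-- A nowhere-zero potential determines the label of a compatible edge as the ratio of its values, so
-- it is compatible with only one edge on each pair of indices.
omit [Finite ι] [Finite G] in
theorem DowlingPoint.edge_eq_edge {y : ι → WithZero G} {i j l m : ι} {hij : i ≠ j} {hlm : l ≠ m}
    {g h : G} (h0 : ∀ i, y i = 0 → False) (h1 : (l = i ∧ m = j) ∨ (l = j ∧ m = i))
    (h2 : (edge hlm g).1.Sat y) (h3 : (edge hij h).1.Sat y) : edge hlm g = edge hij h := by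
  have key : ∀ {i j : ι} {hij : i ≠ j} {g h : G}, (edge hij g).1.Sat y → (edge hij h).1.Sat y →
      edge hij g = edge hij h := by
    intro i j hij g h h2 h3
    rw [edge_sat] at h2 h3
    rw [h2] at h3
    rw [WithZero.coe_inj.1 (mul_left_cancel₀ (h0 i) h3)]
  rcases h1 with ⟨rfl, rfl⟩ | ⟨rfl, rfl⟩
  · exact key h2 h3
  · rw [edge_symm hij] at h3 ⊢
    exact key h2 h3

theorem edge_mem_closure_joint_joint {i j : ι} (hij : i ≠ j) (g : G) :
    edge hij g ∈ (dowlingGeometry ι G).closure {joint G i, joint G j} := by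
  rw [mem_dowlingGeometry_closure_pair]
  intro y h1 h2
  rw [joint_sat] at h1 h2
  rw [edge_sat, h1, h2, zero_mul]

theorem edge_mem_closure_joint_edge {i j : ι} (hij : i ≠ j) (g h : G) :
    edge hij h ∈ (dowlingGeometry ι G).closure {joint G i, edge hij g} := by
  rw [mem_dowlingGeometry_closure_pair]
  intro y h1 h2
  rw [joint_sat] at h1
  rw [edge_sat] at h2 ⊢
  rw [h2, h1, zero_mul, zero_mul]

theorem joint_mem_closure_joint_edge {i j : ι} (hij : i ≠ j) (g : G) :
    joint G j ∈ (dowlingGeometry ι G).closure {joint G i, edge hij g} := by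
  rw [mem_dowlingGeometry_closure_pair]
  intro y h1 h2
  rw [joint_sat] at h1 ⊢
  rw [edge_sat] at h2
  rw [h2, h1, zero_mul]

theorem edge_mem_closure_edge_edge {i j l : ι} (hij : i ≠ j) (hjl : j ≠ l) (hil : i ≠ l) (g h : G) :
    edge hil (g * h) ∈ (dowlingGeometry ι G).closure {edge hij g, edge hjl h} := by
  rw [mem_dowlingGeometry_closure_pair]
  intro y h1 h2
  rw [edge_sat] at h1 h2 ⊢
  rw [h2, h1, mul_assoc, WithZero.coe_mul]

theorem eq_of_edge_mem_closure_joint_joint {i j l m : ι} {hlm : l ≠ m} {g : G}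
    (h : edge hlm g ∈ (dowlingGeometry ι G).closure {joint G i, joint G j}) :
    (l = i ∧ m = j) ∨ (l = j ∧ m = i) := by
  classical
  rw [mem_dowlingGeometry_closure_pair] at h
  have key : ∀ s, i ≠ s → j ≠ s → l ≠ s ∧ m ≠ s := fun s h1 h2 =>
    edge_sat_single.1 (h _ (joint_sat_single h1) (joint_sat_single h2))
  have h1 : l = i ∨ l = j := by
    by_contra! hne
    exact (key l hne.1.symm hne.2.symm).1 rfl
  have h2 : m = i ∨ m = j := by
    by_contra! hne
    exact (key m hne.1.symm hne.2.symm).2 rfl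
  grind

/-- The line through a joint and an edge on two other indices has only these two points. A potential
vanishing exactly at `i` excludes other joints and edges at `i`, indicators leave only the pair `j`,
`l`, and the potential then fixes the label. -/
theorem eq_of_mem_closure_joint_edge {i j l : ι} {hjl : j ≠ l} {g : G} (hij : i ≠ j) (hil : i ≠ l)
    {c : DowlingPoint ι G} (h : c ∈ (dowlingGeometry ι G).closure {joint G i, edge hjl g}) :
    c = joint G i ∨ c = edge hjl g := by
  classical
  rw [mem_dowlingGeometry_closure_pair] at h
  let y : ι → WithZero G := fun t => if t = l then (g : WithZero G) else 1
  have hy : ∀ t, y t = 0 → False := fun t h => by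
    simp only [y] at h
    split_ifs at h
    · exact WithZero.coe_ne_zero h
    · exact one_ne_zero h
  have hyE : (edge hjl g).1.Sat y := by simp [edge_sat, y, hjl]
  let y' : ι → WithZero G := fun t => if t = i then 0 else y t
  have hy'E : (edge hjl g).1.Sat y' := by
    rw [edge_sat] at hyE ⊢
    simpa [y', hij.symm, hil.symm] using hyE
  have hc := h y' (joint_sat.2 (if_pos rfl)) hy'E
  rcases c.eq_joint_or_edge with ⟨s, rfl⟩ | ⟨s, t, hst, x, rfl⟩
  · left
    rw [joint_sat] at hc
    by_contra hne
    have hsi : s ≠ i := fun h => hne (h ▸ rfl)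
    simp only [y', if_neg hsi] at hc
    exact hy s hc
  · right
    have key : ∀ r, i ≠ r → j ≠ r → l ≠ r → s ≠ r ∧ t ≠ r := fun r h1 h2 h3 =>
      edge_sat_single.1 (h _ (joint_sat_single h1) (edge_sat_single.2 ⟨h2, h3⟩))
    rw [edge_sat] at hc
    have hs : s ≠ i := by
      rintro rfl
      simp only [y', if_true, if_neg hst.symm, zero_mul] at hc
      exact hy t hc
    have ht : t ≠ i := by
      rintro rfl
      simp only [y', if_true, if_neg hst] at hc
      exact mul_ne_zero (hy s) WithZero.coe_ne_zero hc.symm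
    have h1 : s = j ∨ s = l := by
      by_contra! hne
      exact (key s hs.symm hne.1.symm hne.2.symm).1 rfl
    have h2 : t = j ∨ t = l := by
      by_contra! hne
      exact (key t ht.symm hne.1.symm hne.2.symm).2 rfl
    refine edge_eq_edge hy (by grind) (edge_sat.2 ?_) hyE
    simpa only [y', if_neg hs, if_neg ht] using hc

/-- A nowhere-zero potential is compatible with both edges, so there is no joint on the line and at
most one edge for each of the three pairs. Such a line has exactly three points. -/
theorem eq_of_mem_closure_edge_edge {i j l : ι} {hij : i ≠ j} {hjl : j ≠ l} (hil : i ≠ l) {g h : G}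
    {c : DowlingPoint ι G} (hc : c ∈ (dowlingGeometry ι G).closure {edge hij g, edge hjl h}) :
    c = edge hij g ∨ c = edge hjl h ∨ c = edge hil (g * h) := by
  classical
  have hmem := mem_dowlingGeometry_closure_pair.1 (edge_mem_closure_edge_edge hij hjl hil g h)
  rw [mem_dowlingGeometry_closure_pair] at hc
  let y : ι → WithZero G := fun t => if t = j then (g : WithZero G) else
    if t = l then (g * h : G) else 1
  have hy : ∀ t, y t = 0 → False := fun t h => by
    simp only [y] at h
    split_ifs at h
    · exact WithZero.coe_ne_zero h
    · exact WithZero.coe_ne_zero h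
    · exact one_ne_zero h
  have h1 : (edge hij g).1.Sat y := by simp [edge_sat, y, hij, hil]
  have h2 : (edge hjl h).1.Sat y := by simp [edge_sat, y, hjl.symm]
  rcases c.eq_joint_or_edge with ⟨s, rfl⟩ | ⟨s, t, hst, x, rfl⟩
  · exact (hy s (joint_sat.1 (hc y h1 h2))).elim
  · have key : ∀ r, i ≠ r → j ≠ r → l ≠ r → s ≠ r ∧ t ≠ r := fun r h1 h2 h3 =>
      edge_sat_single.1 (hc _ (edge_sat_single.2 ⟨h1, h2⟩) (edge_sat_single.2 ⟨h2, h3⟩))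
    have hs : s = i ∨ s = j ∨ s = l := by
      by_contra! hne
      exact (key s hne.1.symm hne.2.1.symm hne.2.2.symm).1 rfl
    have ht : t = i ∨ t = j ∨ t = l := by
      by_contra! hne
      exact (key t hne.1.symm hne.2.1.symm hne.2.2.symm).2 rfl
    have h3 := hc y h1 h2
    have h4 : ((s = i ∧ t = j) ∨ (s = j ∧ t = i)) ∨ ((s = j ∧ t = l) ∨ (s = l ∧ t = j)) ∨
        ((s = i ∧ t = l) ∨ (s = l ∧ t = i)) := by grind
    rcases h4 with h4 | h4 | h4
    · exact Or.inl (edge_eq_edge hy h4 h3 h1)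
    · exact Or.inr (Or.inl (edge_eq_edge hy h4 h3 h2))
    · exact Or.inr (Or.inr (edge_eq_edge hy h4 h3 (hmem y h1 h2)))

/-- A line with at least three points through the joint `i` consists of two joints and all edges
between their indices. A nontrivial `G` makes that at least four points. -/
theorem hasLongLines_joint [Nontrivial G] (i : ι) : HasLongLines (joint G i) := by
  intro b c hb hc hcb hcl
  have two : ∀ d d', d ≠ d' → d ∈ (dowlingGeometry ι G).closure {joint G i, b} →
      d' ∈ (dowlingGeometry ι G).closure {joint G i, b} → d ≠ joint G i → d' ≠ joint G i →
      d ≠ b → d' ≠ b → ∃ d ∈ (dowlingGeometry ι G).closure {joint G i, b},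
        d ≠ joint G i ∧ d ≠ b ∧ d ≠ c := by
    intro d d' hdd h1 h2 h3 h4 h5 h6
    by_cases h : d = c
    · exact ⟨d', h2, h4, h6, fun h' => hdd (h.trans h'.symm)⟩
    · exact ⟨d, h1, h3, h5, h⟩
  have hedge : ∀ (j : ι) (hij : i ≠ j) (g : G), b = edge hij g →
      ∃ d ∈ (dowlingGeometry ι G).closure {joint G i, b}, d ≠ joint G i ∧ d ≠ b ∧ d ≠ c := by
    rintro j hij g rfl
    obtain ⟨g', hg'⟩ := exists_ne g
    exact two (joint G j) (edge hij g') edge_ne_joint.symm (joint_mem_closure_joint_edge hij g)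
      (edge_mem_closure_joint_edge hij g g') (joint_injective.ne hij.symm) edge_ne_joint
      edge_ne_joint.symm (edge_injective.ne hg')
  rcases b.eq_joint_or_edge with ⟨j, rfl⟩ | ⟨j, l, hjl, g, rfl⟩
  · have hij : i ≠ j := fun h => hb (h ▸ rfl)
    obtain ⟨g, hg⟩ := exists_ne (1 : G)
    exact two (edge hij g) (edge hij 1) (edge_injective.ne hg) (edge_mem_closure_joint_joint hij g)
      (edge_mem_closure_joint_joint hij 1) edge_ne_joint edge_ne_joint edge_ne_joint edge_ne_joint
  · by_cases hij : i = j
    · subst hij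
      exact hedge l hjl g rfl
    by_cases hil : i = l
    · subst hil
      exact hedge j hjl.symm g⁻¹ (edge_symm hjl g)
    · rcases eq_of_mem_closure_joint_edge hij hil hcl with h | h
      · exact absurd h hc
      · exact absurd h hcb

/-- With a third index `l`, the edges on `i`, `j`, `l` labeled `g`, `1` and `g * 1` form a line of
exactly three points. -/
theorem not_hasLongLines_edge (hι : ∀ i j : ι, ∃ l, l ≠ i ∧ l ≠ j) {i j : ι} (hij : i ≠ j) (g : G) :
    ¬ HasLongLines (edge hij g) := by
  intro h
  obtain ⟨l, hl1, hl2⟩ := hι i j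
  have ne : ∀ {i j l m : ι} (hij : i ≠ j) (hlm : l ≠ m) (g h : G), l ≠ i → l ≠ j →
      edge hlm h ≠ edge hij g := by
    classical
    intro i j l m hij hlm g h h1 h2 e
    have h3 : (edge hij g).1.Sat (fun t => if t = l then 1 else 0) :=
      edge_sat_single.2 ⟨h1.symm, h2.symm⟩
    rw [← e, edge_sat_single] at h3
    exact h3.1 rfl
  obtain ⟨d, hd, h1, h2, h3⟩ := h (edge hl2.symm 1) (edge hl1.symm (g * 1))
    (by rw [edge_symm hl2.symm]; exact ne _ _ _ _ hl1 hl2)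
    (by rw [edge_symm hl1.symm]; exact ne _ _ _ _ hl1 hl2)
    (ne _ _ _ _ hij hl1.symm) (edge_mem_closure_edge_edge hij hl2.symm hl1.symm g 1)
  rcases eq_of_mem_closure_edge_edge hl1.symm hd with h | h | h
  · exact h1 h
  · exact h2 h
  · exact h3 h

/-- Every automorphism of a Dowling geometry of rank at least three over a nontrivial group is
induced by an element of `(G ≀ 𝔖_ι) ⋊ Aut(G)`. -/
theorem dowlingGamma_eq_top [Nontrivial G] [Nonempty ι] (hι : ∀ i j : ι, ∃ l, l ≠ i ∧ l ≠ j) :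
    dowlingGamma ι G = ⊤ := by
  rw [eq_top_iff]
  rintro ⟨π, hπ⟩ -
  -- Automorphisms preserve the long-line property, which joints have and edges lack.
  have hjoint : ∀ i, ∃ j, π (joint G i) = joint G j := by
    intro i
    rcases (π (joint G i)).eq_joint_or_edge with h | ⟨j, l, hjl, g, h⟩
    · exact h
    · exact absurd (h ▸ (hasLongLines_joint i).map hπ) (not_hasLongLines_edge hι hjl g)
  choose s hs using hjoint
  have hsinj : Function.Injective s := by
    intro i j h
    apply joint_injective (G := G)
    apply π.injective
    rw [hs, hs, h]
  have hedge : ∀ i j, ∀ g : G, ∃ x : G, ∀ hij : i ≠ j, π (edge hij g) = edge (hsinj.ne hij) x := by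
    intro i j g
    by_cases hij : i = j
    -- For `i = j` there is no edge; the value `1` only makes `φ` a total function.
    · exact ⟨1, fun h => absurd hij h⟩
    have h1 := (mem_closure_of_matroidAut hπ).2 (edge_mem_closure_joint_joint hij g)
    rw [hs, hs] at h1
    rcases (π (edge hij g)).eq_joint_or_edge with ⟨l, h⟩ | ⟨l, m, hlm, x, h⟩
    · have h2 : HasLongLines (π⁻¹ (joint G l)) := (hasLongLines_joint l).map (inv_mem hπ)
      rw [← h] at h2
      exact absurd (by simpa using h2) (not_hasLongLines_edge hι hij g)
    · rw [h] at h1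
      rcases eq_of_edge_mem_closure_joint_joint h1 with ⟨rfl, rfl⟩ | ⟨rfl, rfl⟩
      · exact ⟨x, fun _ => h⟩
      · exact ⟨x⁻¹, fun _ => h.trans (edge_symm hlm x)⟩
  choose φ hφ using hedge
  obtain ⟨v, θ, hv⟩ := exists_mulAut_of_family hι φ (by
    intro i j l hij hjl hil g h
    have h1 := (mem_closure_of_matroidAut hπ).2 (edge_mem_closure_edge_edge hij hjl hil g h)
    rw [hφ i j g hij, hφ j l h hjl, hφ i l _ hil, mem_dowlingGeometry_closure_pair] at h1
    have h2 := mem_dowlingGeometry_closure_pair.1 (edge_mem_closure_edge_edge (hsinj.ne hij)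
      (hsinj.ne hjl) (hsinj.ne hil) (φ i j g) (φ j l h))
    classical
    have hsij : s i ≠ s j := hsinj.ne hij
    have hsjl : s j ≠ s l := hsinj.ne hjl
    have hsil : s i ≠ s l := hsinj.ne hil
    -- This potential is compatible with the images of both edges and nowhere zero, so it reads off
    -- the label of the third point of their line.
    let y : ι → WithZero G := fun t => if t = s j then (φ i j g : WithZero G) else
      if t = s l then (φ i j g * φ j l h : G) else 1
    have h3 := h1 y (edge_sat.2 (by simp [y, hsij, hsil])) (edge_sat.2 (by simp [y, hsjl.symm]))
    rw [edge_sat] at h3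
    simp only [y, if_neg hsjl.symm, if_true, if_neg hsij, if_neg hsil, one_mul] at h3
    exact (WithZero.coe_inj.1 h3).symm) (by
    intro i j hij g
    have h1 := hφ i j g hij
    rw [edge_symm hij, hφ j i g⁻¹ hij.symm, edge_symm (hsinj.ne hij)] at h1
    exact edge_injective h1) (by
    intro i j hij g h e
    have h1 := hφ i j g hij
    rw [e, ← hφ i j h hij] at h1
    exact edge_injective (π.injective h1))
  -- The formula `(v i)⁻¹ * θ g * v j` is exactly how this symmetry changes the label of an edge, by
  -- `smul_edge`.
  let w : DowlingSym ι G := ⟨v, Equiv.ofBijective s (Finite.injective_iff_bijective.1 hsinj), θ⟩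
  refine ⟨w, Subtype.ext (Equiv.ext fun a => ?_)⟩
  change w • a = π a
  rcases a.eq_joint_or_edge with ⟨i, rfl⟩ | ⟨i, j, hij, g, rfl⟩
  · rw [smul_joint, hs]
    rfl
  · rw [smul_edge, hφ i j g hij, hv i j hij]
    rfl

end Automorphisms

end

end DowlingKL

/-! ### The theorem for the ground set `Fin n`. -/

theorem theorem1p1 {k : Type*} [Field k] [CharZero k] {G : Type*} [Group G] [Finite G] (n : ℕ) :
    (Nontrivial G → 3 ≤ n → DowlingKL.dowlingGamma (Fin n) G = ⊤) ∧
    (∀ i : ℕ, DowlingKL.equivariantKLPolynomial k (DowlingKL.dowlingAction (Fin n) G) i =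
      DowlingKL.VRep.perm k (DowlingKL.dowlingGamma (Fin n) G)
        (DowlingKL.labeledSimpleQSP (Fin n) G (n - i))) ∧
    (∀ i : ℕ, DowlingKL.equivariantZPolynomial k (DowlingKL.dowlingAction (Fin n) G) i =
      DowlingKL.VRep.perm k (DowlingKL.dowlingGamma (Fin n) G)
        (DowlingKL.labeledQSP (Fin n) G (n - i))) ∧
    (∀ i : ℕ, (DowlingKL.klPolynomial
        ⟨DowlingKL.dowlingGeometry (Fin n) G, DowlingKL.dowlingGeometry_loopless⟩).coeff i =
      ∑ᶠ M ∈ {M : Matroid (Fin n) | M.E = Set.univ ∧ DowlingKL.IsSimple M ∧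
        DowlingKL.IsQuasiSeriesParallel M ∧ (DowlingKL.rank M : ℤ) = n - i},
        (Nat.card G : ℤ) ^ (n - DowlingKL.numComponents M)) ∧
    (∀ i : ℕ, (DowlingKL.zPolynomial
        ⟨DowlingKL.dowlingGeometry (Fin n) G, DowlingKL.dowlingGeometry_loopless⟩).coeff i =
      ∑ᶠ M ∈ {M : Matroid (Fin n) | M.E = Set.univ ∧
        DowlingKL.IsQuasiSeriesParallel M ∧ (DowlingKL.rank M : ℤ) = n - i},
        (Nat.card G : ℤ) ^ (n - DowlingKL.numComponents M)) := by
  have hn : Nat.card (Fin n) = n := Nat.card_fin n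
  refine ⟨fun _ h => ?_, fun i => ?_, fun i => ?_, fun i => ?_, fun i => ?_⟩
  · have : Nonempty (Fin n) := ⟨⟨0, by omega⟩⟩
    refine DowlingKL.dowlingGamma_eq_top fun i j => ?_
    -- A third index exists because `{i, j}` has at most two elements and `3 ≤ n`.
    obtain ⟨l, hl⟩ := Finset.exists_mem_notMem_of_card_lt_card (s := {i, j}) (t := Finset.univ)
      (lt_of_le_of_lt Finset.card_le_two (by rw [Finset.card_univ, Fintype.card_fin]; exact h))
    simp only [Finset.mem_insert, Finset.mem_singleton, not_or] at hl
    exact ⟨l, hl.2⟩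
  · have h := DowlingKL.equivariantKLPolynomial_dowlingAction (ι := Fin n) (G := G) k i
    rwa [hn] at h
  · have h := DowlingKL.equivariantZPolynomial_dowlingAction (ι := Fin n) (G := G) k i
    rwa [hn] at h
  · have h := DowlingKL.klPolynomial_dowlingGeometry_coeff (ι := Fin n) (G := G) i
    rwa [hn] at h
  · have h := DowlingKL.zPolynomial_dowlingGeometry_coeff (ι := Fin n) (G := G) i
    rwa [hn] at h
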